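/- Let $n\ge 1$ and let $\varphi\in C^\infty(\mathbb R)$ be a decreasing function with $\varphi=1$ on $(-\infty,1]$ and $\varphi=0$ on $[2,\infty)$. Write $\widehat f(\xi)=\int_{\mathbb R^n}f(x)e^{-2\pi i x\cdot\xi}\,dx$, let $h_{\le 0},h_1,h_2,\dots$ be the Schwartz functions on $\mathbb R^n$ with $\widehat{h_{\le0}}(\xi)=\varphi(|\xi|)$ and $\widehat{h_j}(\xi)=\varphi(|\xi|/2^{j})-\varphi(|\xi|/2^{j-1})$ for $j\ge 1$, and put $P_{\le0}f=f*h_{\le0}$, $P_jf=f*h_j$. For $f\in L^2(\mathbb R^n)$ (complex-valued) set $$\|f\|_B=\|P_{\le0}f\|_{L^\infty}+\sup_{j\ge1}\|P_jf\|_{L^\infty}+\|f\|_{L^2},\qquad B=\{f\in L^2(\mathbb R^n):\|f\|_B<\infty\}.$$ Let $B_r(x)$ denote the ball of radius $r$ centred at $x$, and for locally integrable $f$ set $$(M^\diamond f)(x)=\sup_{r>0}\Bigl|\frac1{|B_r(x)|}\int_{B_r(x)}\frac{y-x}{|y-x|}f(y)\,dy\Bigr|,$$ $$(M^\sharp f)(x)=\sup_{r>0}\frac1{|B_r(x)|}\int_{B_r(x)}\Bigl|f(y)-\frac1{|B_r(x)|}\int_{B_r(x)}f\Bigr|\,dy.$$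 Then: 1. $B$ with the norm $\|\cdot\|_B$ is a Banach space, and it is translation-invariant: if $f\in B$ and $x_0\in\mathbb R^n$, then $f(\cdot-x_0)\in B$ and $\|f(\cdot-x_0)\|_B=\|f\|_B$. 2. $M^\diamond$ is bounded on $B$: there is a constant $C$ such that $M^\diamond f\in B$ and $\|M^\diamond f\|_B\le C\|f\|_B$ for all $f\in B$. 3. $M^\sharp$ is not bounded on $B$: there is no constant $C$ such that $M^\sharp f\in B$ and $\|M^\sharp f\|_B\le C\|f\|_B$ for all $f\in B$. Quantitatively, let $\psi\in C_c^\infty(\mathbb R^n)$ be real-valued with $\psi=1$ on $B_2(0)$, and put $$F_N(x)=\psi(x)\sum_{k=1}^N\sin(2\pi 2^kx_1),\qquad f_N(x)=F_N\bigl(2^{\lfloor\log_2N\rfloor}x\bigr).$$ Then there is $c>0$ such that for every $N\ge2$ one has $f_N\in B$, $f_N\neq0$, $M^\sharp f_N\in B$ and $$\frac{\|M^\sharp f_N\|_B}{\|f_N\|_B}\ \ge\ c\,\frac{N^{1/2}}{\log N}.$$ -/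

import Mathlib

open MeasureTheory Metric
open scoped ENNReal ContDiff SchwartzMap FourierTransform Convolution

noncomputable section

namespace MaxOp

/-- Euclidean space of dimension `n`. -/
abbrev Rn (n : ℕ) : Type := EuclideanSpace ℝ (Fin n)

/-- A smooth decreasing cutoff on the line: `1` on `(-∞, 1]` and `0` on `[2, ∞)`. -/
structure Cutoff where
  toFun : ℝ → ℝ
  smooth : ContDiff ℝ ∞ toFun
  antitone : Antitone toFun
  eq_one : ∀ t, t ≤ 1 → toFun t = 1
  eq_zero : ∀ t, 2 ≤ t → toFun t = 0

lemma Cutoff.contDiff_symbol (φ : Cutoff) (n : ℕ) (k : ℤ) :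
    ContDiff ℝ ∞ (fun ξ : Rn n => ((φ.toFun (‖ξ‖ / 2 ^ k) : ℝ) : ℂ)) := by
  refine Complex.ofRealCLM.contDiff.comp ?_
  rw [contDiff_iff_contDiffAt]
  intro ξ
  have h2 : (0 : ℝ) < 2 ^ k := by positivity
  by_cases hξ : ξ = 0
  · have : (fun ξ : Rn n => φ.toFun (‖ξ‖ / 2 ^ k)) =ᶠ[nhds ξ] fun _ => 1 := by
      subst hξ
      filter_upwards [ball_mem_nhds (0 : Rn n) h2] with y hy
      apply φ.eq_one
      rw [div_le_one h2]
      simpa using (mem_ball_zero_iff.1 hy).le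
    exact contDiffAt_const.congr_of_eventuallyEq this
  · exact φ.smooth.contDiffAt.comp ξ ((contDiffAt_norm ℝ hξ).div_const _)

lemma Cutoff.hasCompactSupport_symbol (φ : Cutoff) (n : ℕ) (k : ℤ) :
    HasCompactSupport (fun ξ : Rn n => ((φ.toFun (‖ξ‖ / 2 ^ k) : ℝ) : ℂ)) := by
  have h2 : (0 : ℝ) < 2 ^ k := by positivity
  refine HasCompactSupport.intro (isCompact_closedBall (0 : Rn n) (2 * 2 ^ k)) ?_
  intro ξ hξ
  rw [mem_closedBall_zero_iff, not_le] at hξ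
  rw [φ.eq_zero _ ((le_div_iff₀ h2).2 hξ.le), Complex.ofReal_zero]

/-- The symbol `ξ ↦ φ(|ξ| / 2 ^ k)`, a Schwartz function. -/
def Cutoff.symbol (φ : Cutoff) (n : ℕ) (k : ℤ) : 𝓢(Rn n, ℂ) :=
  (φ.hasCompactSupport_symbol n k).toSchwartzMap (φ.contDiff_symbol n k)

/-- The kernel `h_{≤ 0}`, with Fourier transform `φ(|ξ|)`. -/
def lowKernel (φ : Cutoff) (n : ℕ) : 𝓢(Rn n, ℂ) :=
  𝓕⁻ (φ.symbol n 0)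

/-- The kernel `h_j`, with Fourier transform `φ(|ξ| / 2 ^ j) - φ(|ξ| / 2 ^ (j - 1))`. -/
def kernel (φ : Cutoff) (n : ℕ) (j : ℕ) : 𝓢(Rn n, ℂ) :=
  𝓕⁻ (φ.symbol n j - φ.symbol n ((j : ℤ) - 1))

/-- The convolution `f ∗ h`. -/
def conv {n : ℕ} (f h : Rn n → ℂ) : Rn n → ℂ :=
  f ⋆[ContinuousLinearMap.mul ℂ ℂ, volume] h

/-- The extended-real value
`‖P_{≤ 0} f‖_∞ + sup_{j ≥ 1} ‖P_j f‖_∞ + ‖f‖_2`. -/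
def bENorm (φ : Cutoff) {n : ℕ} (f : Rn n → ℂ) : ℝ≥0∞ :=
  eLpNorm (conv f (lowKernel φ n)) ⊤ volume
    + (⨆ (j : ℕ) (_ : 1 ≤ j), eLpNorm (conv f (kernel φ n j)) ⊤ volume)
    + eLpNorm f 2 volume

lemma convExists {n : ℕ} {f : Rn n → ℂ} (hf : MemLp f 2 volume) (h : 𝓢(Rn n, ℂ)) :
    ConvolutionExists f h (ContinuousLinearMap.mul ℂ ℂ) volume := by
  intro x
  have h1 : MemLp (fun t => h (x - t)) 2 (volume : Measure (Rn n)) :=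
    (h.memLp 2 volume).comp_measurePreserving (Measure.measurePreserving_sub_left volume x)
  exact hf.integrable_mul h1

lemma conv_congr {n : ℕ} {f g : Rn n → ℂ} (h : Rn n → ℂ) (hfg : f =ᵐ[volume] g) :
    conv f h = conv g h := by
  funext x
  refine integral_congr_ae ?_
  filter_upwards [hfg] with t ht
  simp [ht]

lemma bENorm_congr (φ : Cutoff) {n : ℕ} {f g : Rn n → ℂ} (hfg : f =ᵐ[volume] g) :
    bENorm φ f = bENorm φ g := by
  simp only [bENorm, conv_congr _ hfg, eLpNorm_congr_ae hfg]

lemma conv_add {n : ℕ} {f g : Rn n → ℂ} (hf : MemLp f 2 volume) (hg : MemLp g 2 volume)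
    (h : 𝓢(Rn n, ℂ)) : conv (f + g) h = conv f h + conv g h :=
  (convExists hf h).add_distrib (convExists hg h)

lemma conv_smul {n : ℕ} (c : ℂ) (f h : Rn n → ℂ) : conv (c • f) h = c • conv f h :=
  smul_convolution

lemma eLpNorm_top_conv_add_le {n : ℕ} {f g : Rn n → ℂ} (hf : MemLp f 2 volume)
    (hg : MemLp g 2 volume) (h : 𝓢(Rn n, ℂ)) :
    eLpNorm (conv (f + g) h) ⊤ volume
      ≤ eLpNorm (conv f h) ⊤ volume + eLpNorm (conv g h) ⊤ volume := by
  rw [conv_add hf hg]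
  simp only [eLpNorm_exponent_top]
  exact eLpNormEssSup_add_le

lemma bENorm_add_le (φ : Cutoff) {n : ℕ} {f g : Rn n → ℂ} (hf : MemLp f 2 volume)
    (hg : MemLp g 2 volume) : bENorm φ (f + g) ≤ bENorm φ f + bENorm φ g := by
  have h1 := eLpNorm_top_conv_add_le hf hg (lowKernel φ n)
  have h2 : (⨆ (j : ℕ) (_ : 1 ≤ j), eLpNorm (conv (f + g) (kernel φ n j)) ⊤ volume)
      ≤ (⨆ (j : ℕ) (_ : 1 ≤ j), eLpNorm (conv f (kernel φ n j)) ⊤ volume)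
        + ⨆ (j : ℕ) (_ : 1 ≤ j), eLpNorm (conv g (kernel φ n j)) ⊤ volume := by
    refine iSup₂_le fun j hj => (eLpNorm_top_conv_add_le hf hg (kernel φ n j)).trans ?_
    exact add_le_add
      (le_iSup₂ (f := fun (j : ℕ) (_ : 1 ≤ j) => eLpNorm (conv f (kernel φ n j)) ⊤ volume) j hj)
      (le_iSup₂ (f := fun (j : ℕ) (_ : 1 ≤ j) => eLpNorm (conv g (kernel φ n j)) ⊤ volume) j hj)
  have h3 := eLpNorm_add_le hf.1 hg.1 (le_of_lt ENNReal.one_lt_two)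
  calc bENorm φ (f + g) ≤ _ := add_le_add (add_le_add h1 h2) h3
    _ = bENorm φ f + bENorm φ g := by simp only [bENorm]; ring

lemma bENorm_smul (φ : Cutoff) {n : ℕ} (c : ℂ) (f : Rn n → ℂ) :
    bENorm φ (c • f) = ‖c‖ₑ * bENorm φ f := by
  simp only [bENorm, conv_smul, eLpNorm_const_smul, mul_add, ENNReal.mul_iSup]

/-- The elements of `L²` with finite norm, as a linear subspace of `L²`. -/
def bSubmodule (φ : Cutoff) (n : ℕ) : Submodule ℂ (Lp ℂ 2 (volume : Measure (Rn n))) where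
  carrier := {f | bENorm φ f < ⊤}
  add_mem' := by
    intro f g hf hg
    refine lt_of_le_of_lt ?_ (ENNReal.add_lt_top.2 ⟨hf, hg⟩)
    rw [bENorm_congr φ (Lp.coeFn_add f g)]
    exact bENorm_add_le φ (Lp.memLp f) (Lp.memLp g)
  zero_mem' := by
    have h : bENorm φ ((0 : ℂ) • (0 : Rn n → ℂ)) = 0 := by
      rw [bENorm_smul]; simp
    rw [zero_smul] at h
    simp only [Set.mem_ofPred_eq]
    rw [bENorm_congr φ (Lp.coeFn_zero ℂ 2 volume), h]
    exact ENNReal.zero_lt_top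
  smul_mem' := by
    intro c f hf
    simp only [Set.mem_ofPred_eq] at hf ⊢
    rw [bENorm_congr φ (Lp.coeFn_smul c f), bENorm_smul]
    exact ENNReal.mul_lt_top enorm_lt_top hf

/-- The space `B`, kept separate from the subspace of `L²` so that it carries its own norm. -/
def BSpace (φ : Cutoff) (n : ℕ) : Type := bSubmodule φ n

instance (φ : Cutoff) (n : ℕ) : AddCommGroup (BSpace φ n) :=
  inferInstanceAs (AddCommGroup (bSubmodule φ n))

instance (φ : Cutoff) (n : ℕ) : Module ℂ (BSpace φ n) :=
  inferInstanceAs (Module ℂ (bSubmodule φ n))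

/-- The underlying element of `L²`. -/
def BSpace.toLp {φ : Cutoff} {n : ℕ} (f : BSpace φ n) : Lp ℂ 2 (volume : Measure (Rn n)) :=
  f.1

/-- A representative of an element of `B`, defined up to null sets. -/
instance (φ : Cutoff) (n : ℕ) : CoeFun (BSpace φ n) (fun _ => Rn n → ℂ) :=
  ⟨fun f => (f.toLp : Rn n → ℂ)⟩

/-- The norm `‖P_{≤ 0} f‖_∞ + sup_{j ≥ 1} ‖P_j f‖_∞ + ‖f‖_2` of `B`. -/
instance (φ : Cutoff) (n : ℕ) : Norm (BSpace φ n) :=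
  ⟨fun f => (bENorm φ f).toReal⟩

lemma BSpace.normCore (φ : Cutoff) (n : ℕ) : NormedSpace.Core ℂ (BSpace φ n) where
  norm_nonneg _ := ENNReal.toReal_nonneg
  norm_smul c f := by
    change (bENorm φ (c • f.toLp : Lp ℂ 2 (volume : Measure (Rn n)))).toReal
      = ‖c‖ * (bENorm φ f).toReal
    rw [bENorm_congr φ (Lp.coeFn_smul c f.toLp), bENorm_smul, ENNReal.toReal_mul, toReal_enorm]
  norm_triangle f g := by
    change (bENorm φ (f.toLp + g.toLp : Lp ℂ 2 (volume : Measure (Rn n)))).toReal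
      ≤ (bENorm φ f).toReal + (bENorm φ g).toReal
    have hf : bENorm φ f < ⊤ := f.2
    have hg : bENorm φ g < ⊤ := g.2
    rw [bENorm_congr φ (Lp.coeFn_add f.toLp g.toLp), ← ENNReal.toReal_add hf.ne hg.ne]
    exact ENNReal.toReal_mono (ENNReal.add_lt_top.2 ⟨hf, hg⟩).ne
      (bENorm_add_le φ (Lp.memLp _) (Lp.memLp _))
  norm_eq_zero_iff f := by
    have hf : bENorm φ f < ⊤ := f.2
    constructor
    · intro h
      have h0 : bENorm φ f = 0 := by
        rcases (ENNReal.toReal_eq_zero_iff _).1 h with h | h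
        · exact h
        · exact absurd h hf.ne
      have h1 : eLpNorm f 2 volume = 0 := by
        simp only [bENorm, add_eq_zero] at h0
        exact h0.2
      have h2 : f.toLp = 0 := Lp.ext
        (((eLpNorm_eq_zero_iff (Lp.aestronglyMeasurable f.toLp) two_ne_zero).1 h1).trans
          (Lp.coeFn_zero ℂ 2 volume).symm)
      exact Subtype.ext h2
    · rintro rfl
      change (bENorm φ ((0 : Lp ℂ 2 (volume : Measure (Rn n))) : Rn n → ℂ)).toReal = 0
      have h : bENorm φ ((0 : ℂ) • (0 : Rn n → ℂ)) = 0 := by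
        rw [bENorm_smul]; simp
      rw [zero_smul] at h
      rw [bENorm_congr φ (Lp.coeFn_zero ℂ 2 volume), h, ENNReal.toReal_zero]

instance (φ : Cutoff) (n : ℕ) : NormedAddCommGroup (BSpace φ n) :=
  NormedAddCommGroup.ofCore (BSpace.normCore φ n)

instance (φ : Cutoff) (n : ℕ) : NormedSpace ℂ (BSpace φ n) :=
  NormedSpace.ofCore (BSpace.normCore φ n)

/-- The vector `((y - x) / |y - x|) f(y)` of `ℂⁿ`, which is `0` for `y = x`. -/
def signVector {n : ℕ} (f : Rn n → ℂ) (x y : Rn n) : EuclideanSpace ℂ (Fin n) :=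
  WithLp.toLp 2 fun i => (((y i - x i) / ‖y - x‖ : ℝ) : ℂ) * f y

/-- The Maz'ya–Shaposhnikova maximal function. -/
def mDiamond {n : ℕ} (f : Rn n → ℂ) (x : Rn n) : ℝ≥0∞ :=
  ⨆ (r : ℝ) (_ : 0 < r), ‖⨍ y in ball x r, signVector f x y ∂volume‖ₑ

/-- The Fefferman–Stein sharp maximal function. -/
def mSharp {n : ℕ} (f : Rn n → ℂ) (x : Rn n) : ℝ≥0∞ :=
  ⨆ (r : ℝ) (_ : 0 < r), ⨍⁻ y in ball x r, ‖f y - ⨍ z in ball x r, f z ∂volume‖ₑ ∂volume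

/-- The function `u` with values in `[0, ∞]` is finite almost everywhere and its class is `g`. -/
def Represents {φ : Cutoff} {n : ℕ} (g : BSpace φ n) (u : Rn n → ℝ≥0∞) : Prop :=
  ∀ᵐ x ∂(volume : Measure (Rn n)), u x ≠ ⊤ ∧ g x = ((u x).toReal : ℂ)

/-- The operator `T` maps `B` to itself, with `‖T f‖_B ≤ C ‖f‖_B` for one constant `C`. -/
def BoundedOnB (φ : Cutoff) (n : ℕ) (T : (Rn n → ℂ) → Rn n → ℝ≥0∞) : Prop :=
  ∃ C : ℝ, ∀ f : BSpace φ n, ∃ g : BSpace φ n, Represents g (T f) ∧ ‖g‖ ≤ C * ‖f‖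

/-- The lacunary sum `S_N(t) = ∑_{k=1}^N sin(2 π 2^k t)`. -/
def lacunary (N : ℕ) (t : ℝ) : ℝ :=
  ∑ k ∈ Finset.Icc 1 N, Real.sin (2 * Real.pi * 2 ^ k * t)

/-- `F_N(x) = ψ(x) S_N(x₁)`. -/
def cutLacunary {n : ℕ} [NeZero n] (ψ : Rn n → ℝ) (N : ℕ) (x : Rn n) : ℂ :=
  ((ψ x * lacunary N (x 0) : ℝ) : ℂ)

/-- `f_N(x) = F_N(2^m x)` with `m = ⌊log₂ N⌋`. -/
def witness {n : ℕ} [NeZero n] (ψ : Rn n → ℝ) (N : ℕ) (x : Rn n) : ℂ :=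
  cutLacunary ψ N ((2 : ℝ) ^ Nat.log 2 N • x)

end MaxOp

end

/-! Everything rests on averages over balls of the Littlewood–Paley pieces P_j f, each of which is
bounded by ‖f‖_B. Such a piece reproduces itself under convolution with `fatKernel`, a kernel of
mean zero concentrated at scale 2^{-j}. Hence its average over a ball of radius r is O((2^j
r)^{-1/2}) (`exists_norm_angAvg_kernel_le_large`), because the truncated averaging kernel has an L¹
modulus of continuity of order 1/2. If the averaging kernel also has mean zero, the Lipschitz bound
on P_j f gives O(2^j r) as well (`exists_norm_angAvg_kernel_le_small`).

The field z/|z| is odd, so M^⋄ enjoys both bounds. They sum over j uniformly in r, and M^⋄ f ≤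
C‖f‖_B pointwise (`exists_mDiamond_le`). Since M^⋄ f is also dominated by the Hardy–Littlewood
maximal function, it lies in L^∞ ∩ L², which embeds in B (`exists_represents`).

Plain averages lack the cancellation. Over a ball of radius 2^{-m} each of the first m pieces may
contribute ‖g‖_B, so an average of g ∈ B can be of size m‖g‖_B but no larger
(`exists_norm_setAverage_le`). The functions f_N turn this into a lower bound for norms. They are
bounded in B uniformly in N (`exists_witness_mem`): each piece sees boundedly many of the lacunary
frequencies, and the dilation by about N compensates the L² growth √N. Yet M^♯ f_N ≥ c√N on a ball
of radius comparable to 1/N (`exists_sqrt_le_mSharp_witness`), because a lacunary sum has L¹ size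
√N, by comparison of its second and fourth moments. The average of M^♯ f_N over that ball is then at
least c√N and at most C log N ‖M^♯ f_N‖_B.

Completeness holds because B embeds in L² and convolution with a fixed Schwartz function maps L² to
L^∞, so bounds on the pieces survive L² limits. -/

namespace MaxOp

/-! ### Littlewood–Paley kernels and their scaling -/

/-- The kernel with Fourier transform `φ(|ξ| / 2 ^ k)`. -/
noncomputable def lowPass (φ : Cutoff) (n : ℕ) (k : ℤ) : 𝓢(Rn n, ℂ) :=
  𝓕⁻ (φ.symbol n k)

lemma Cutoff.symbol_apply (φ : Cutoff) (n : ℕ) (k : ℤ) (ξ : Rn n) :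
    φ.symbol n k ξ = ((φ.toFun (‖ξ‖ / 2 ^ k) : ℝ) : ℂ) := rfl

lemma lowPass_sub (φ : Cutoff) (n : ℕ) (k l : ℤ) :
    lowPass φ n k - lowPass φ n l = 𝓕⁻ (φ.symbol n k - φ.symbol n l) :=
  ((FourierTransform.fourierInvCLM ℂ 𝓢(Rn n, ℂ)).map_sub _ _).symm

lemma kernel_eq (φ : Cutoff) (n j : ℕ) :
    kernel φ n j = lowPass φ n j - lowPass φ n ((j : ℤ) - 1) := by
  rw [lowPass_sub, kernel]

lemma integral_dilate {E : Type*} [NormedAddCommGroup E] [NormedSpace ℝ E] {n : ℕ}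
    (G : Rn n → E) {R : ℝ} (hR : 0 < R) :
    ∫ w, R ^ n • G (R • w) = ∫ w, G w := by
  rw [integral_smul, Measure.integral_comp_smul, smul_smul]
  simp only [finrank_euclideanSpace, Fintype.card_fin]
  rw [abs_of_pos (by positivity), mul_inv_cancel₀ (by positivity), one_smul]

lemma lowPass_apply (φ : Cutoff) (n : ℕ) (k : ℤ) (x : Rn n) :
    lowPass φ n k x = ((2 : ℝ) ^ k) ^ n • lowPass φ n 0 ((2 : ℝ) ^ k • x) := by
  have h2 : (0 : ℝ) < 2 ^ k := by positivity
  simp only [lowPass, SchwartzMap.fourierInv_coe, Real.fourierInv_eq']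
  rw [← integral_dilate (R := (2 : ℝ) ^ k) _ h2, ← integral_smul]
  refine integral_congr_ae (Filter.Eventually.of_forall fun v => ?_)
  simp only [Cutoff.symbol_apply, norm_smul, Real.norm_eq_abs, abs_of_pos h2, zpow_zero, div_one,
    inner_smul_left, inner_smul_right, conj_trivial, mul_div_cancel_left₀ _ h2.ne']

lemma integral_lowPass (φ : Cutoff) (n : ℕ) (k : ℤ) : ∫ w, lowPass φ n k w = 1 := by
  have h : 𝓕 (lowPass φ n k) 0 = φ.symbol n k 0 := by
    simp [lowPass]
  rw [SchwartzMap.fourier_coe, Real.fourier_eq'] at h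
  simpa [Cutoff.symbol_apply, φ.eq_one 0 zero_le_one] using h

lemma integral_norm_lowPass (φ : Cutoff) (n : ℕ) (k : ℤ) :
    ∫ w, ‖lowPass φ n k w‖ = ∫ w, ‖lowPass φ n 0 w‖ := by
  have h2 : (0 : ℝ) < 2 ^ k := by positivity
  rw [← integral_dilate (fun w => ‖lowPass φ n 0 w‖) h2]
  refine integral_congr_ae (Filter.Eventually.of_forall fun w => ?_)
  simp only [lowPass_apply φ n k w, norm_smul, norm_pow, Real.norm_eq_abs, abs_of_pos h2,
    smul_eq_mul]

/-- The half-moment scales like 2^{-k/2}. It is the weight that meets the Hölder exponent 1/2 of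
ball averages in `norm_angAvg_sub_le`. -/
lemma integral_norm_mul_sqrt_lowPass (φ : Cutoff) (n : ℕ) (k : ℤ) :
    ∫ w, ‖lowPass φ n k w‖ * √‖w‖
      = (√(2 ^ k))⁻¹ * ∫ w, ‖lowPass φ n 0 w‖ * √‖w‖ := by
  have h2 : (0 : ℝ) < 2 ^ k := by positivity
  rw [← integral_dilate (fun w => ‖lowPass φ n 0 w‖ * √‖w‖) h2, ← integral_const_mul]
  refine integral_congr_ae (Filter.Eventually.of_forall fun w => ?_)
  simp only [lowPass_apply φ n k w, norm_smul, norm_pow, Real.norm_eq_abs, abs_of_pos h2,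
    smul_eq_mul, Real.sqrt_mul h2.le]
  field_simp

/-- Fundamental theorem of calculus along the segment from w to w + v, then Tonelli and translation
invariance; the constant is the L¹ norm of the derivative. -/
lemma exists_integral_norm_sub_translate_le {n : ℕ} (H : 𝓢(Rn n, ℂ)) :
    ∃ C : ℝ, 0 ≤ C ∧ ∀ v : Rn n, ∫ w, ‖H (w + v) - H w‖ ≤ C * ‖v‖ := by
  refine ⟨∫ w, ‖fderiv ℝ H w‖, by positivity, fun v => ?_⟩
  have hD : Integrable (fun w => fderiv ℝ H w) :=
    (SchwartzMap.fderivCLM ℝ (Rn n) ℂ H).integrable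
  have hcont : Continuous (fderiv ℝ H) := (SchwartzMap.fderivCLM ℝ (Rn n) ℂ H).continuous
  have hpt : ∀ w, ‖H (w + v) - H w‖ₑ
      ≤ ∫⁻ t in Set.Ioc (0 : ℝ) 1, ‖fderiv ℝ H (w + t • v)‖ₑ * ‖v‖ₑ := by
    intro w
    have hder : ∀ t ∈ Set.uIcc (0 : ℝ) 1,
        HasDerivAt (fun t : ℝ => H (w + t • v)) (fderiv ℝ H (w + t • v) v) t := by
      intro t _
      have h1 : HasDerivAt (fun t : ℝ => w + t • v) v t := by
        simpa using ((hasDerivAt_id t).smul_const v).const_add w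
      exact (H.differentiableAt.hasFDerivAt).comp_hasDerivAt t h1
    have hint : IntervalIntegrable (fun t : ℝ => fderiv ℝ H (w + t • v) v) volume 0 1 := by
      apply Continuous.intervalIntegrable
      fun_prop
    have := intervalIntegral.integral_eq_sub_of_hasDerivAt hder hint
    simp only [one_smul, zero_smul, add_zero] at this
    rw [← this, intervalIntegral.integral_of_le zero_le_one]
    refine (enorm_integral_le_lintegral_enorm _).trans (lintegral_mono fun t => ?_)
    exact ContinuousLinearMap.le_opENorm _ _
  have hl : ∫⁻ w, ‖H (w + v) - H w‖ₑ ≤ (∫⁻ w, ‖fderiv ℝ H w‖ₑ) * ‖v‖ₑ := by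
    refine (lintegral_mono hpt).trans ?_
    rw [lintegral_lintegral_swap (by
      apply Measurable.aemeasurable
      have : Continuous (Function.uncurry fun (x : Rn n) (y : ℝ) => ‖fderiv ℝ H (x + y • v)‖ₑ) := by
        simp only [Function.uncurry_def]
        fun_prop
      exact this.measurable.mul_const _)]
    have : ∀ t : ℝ, ∫⁻ w, ‖fderiv ℝ H (w + t • v)‖ₑ * ‖v‖ₑ
        = (∫⁻ w, ‖fderiv ℝ H w‖ₑ) * ‖v‖ₑ := by
      intro t
      rw [lintegral_mul_const _ (by fun_prop),
        lintegral_add_right_eq_self (fun w => ‖fderiv ℝ H w‖ₑ) (t • v)]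
    simp [this]
  have hI : Integrable (fun w => H (w + v) - H w) :=
    (H.integrable.comp_add_right v).sub H.integrable
  rw [integral_norm_eq_lintegral_enorm hI.1, integral_norm_eq_lintegral_enorm hD.1,
    ← toReal_enorm v, ← ENNReal.toReal_mul]
  refine ENNReal.toReal_mono ?_ hl
  exact ENNReal.mul_ne_top hD.2.ne enorm_ne_top

lemma exists_integral_norm_lowPass_sub_translate_le (φ : Cutoff) (n : ℕ) :
    ∃ C : ℝ, 0 ≤ C ∧ ∀ (k : ℤ) (v : Rn n),
      ∫ w, ‖lowPass φ n k (w + v) - lowPass φ n k w‖ ≤ C * (2 ^ k * ‖v‖) := by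
  obtain ⟨C, hC, h⟩ := exists_integral_norm_sub_translate_le (lowPass φ n 0)
  refine ⟨C, hC, fun k v => ?_⟩
  have h2 : (0 : ℝ) < 2 ^ k := by positivity
  have h3 := h ((2 : ℝ) ^ k • v)
  rw [norm_smul, Real.norm_eq_abs, abs_of_pos h2] at h3
  refine le_of_eq_of_le ?_ h3
  rw [← integral_dilate (fun w => ‖lowPass φ n 0 (w + (2 : ℝ) ^ k • v) - lowPass φ n 0 w‖) h2]
  refine integral_congr_ae (Filter.Eventually.of_forall fun w => ?_)
  simp only [lowPass_apply φ n k]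
  rw [← smul_sub, norm_smul, smul_add]
  simp only [norm_pow, Real.norm_eq_abs, abs_of_pos h2, smul_eq_mul]

/-- A kernel whose symbol is `1` on the support of the symbol of `kernel φ n j`. -/
noncomputable def fatKernel (φ : Cutoff) (n : ℕ) (j : ℕ) : 𝓢(Rn n, ℂ) :=
  lowPass φ n (j + 1) - lowPass φ n (j - 2)

lemma integrable_norm_mul_sqrt {n : ℕ} (H : 𝓢(Rn n, ℂ)) :
    Integrable (fun w => ‖H w‖ * √‖w‖) := by
  have h0 : Integrable (fun w => ‖H w‖ + ‖w‖ ^ 1 * ‖H w‖) :=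
    H.integrable.norm.add (H.integrable_pow_mul volume 1)
  refine h0.mono' (by fun_prop) (Filter.Eventually.of_forall fun w => ?_)
  have h1 : √‖w‖ ≤ 1 + ‖w‖ := by
    rw [Real.sqrt_le_left (by positivity)]
    nlinarith [norm_nonneg w]
  rw [Real.norm_eq_abs, abs_of_nonneg (by positivity)]
  nlinarith [norm_nonneg (H w), mul_le_mul_of_nonneg_left h1 (norm_nonneg (H w))]

/-- The bounds, uniform in the scale, for the kernels of the Littlewood–Paley decomposition. -/
lemma exists_fatKernel_bounds (φ : Cutoff) (n : ℕ) :
    ∃ C : ℝ, 0 ≤ C ∧ (∀ k, ∫ w, ‖lowPass φ n k w‖ ≤ C) ∧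
      (∀ j, ∫ w, ‖fatKernel φ n j w‖ * √‖w‖ ≤ C * (√(2 ^ j))⁻¹) ∧
      (∀ (j : ℕ) (v : Rn n), ∫ w, ‖fatKernel φ n j (w + v) - fatKernel φ n j w‖
        ≤ C * (2 ^ j * ‖v‖)) := by
  obtain ⟨C₁, hC₁, h₁⟩ := exists_integral_norm_lowPass_sub_translate_le φ n
  set C₂ := ∫ w, ‖lowPass φ n 0 w‖ with hC₂
  set C₃ := ∫ w, ‖lowPass φ n 0 w‖ * √‖w‖ with hC₃
  have hp2 : 0 ≤ C₂ := by positivity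
  have hp3 : 0 ≤ C₃ := by positivity
  -- The levels j + 1 and j - 2 together cost (2 + 1/4) C₁ in the translation modulus and at most (1
  -- + 2) C₃ in the half-moment.
  refine ⟨4 * C₁ + C₂ + 4 * C₃, by positivity, fun k => ?_, fun j => ?_, fun j v => ?_⟩
  · rw [integral_norm_lowPass]; linarith
  · have hj : (0 : ℝ) < 2 ^ j := by positivity
    have hb : ∫ w, ‖fatKernel φ n j w‖ * √‖w‖ ≤ ∫ w, (‖lowPass φ n (j + 1) w‖ * √‖w‖
        + ‖lowPass φ n (j - 2) w‖ * √‖w‖) := by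
      refine integral_mono (integrable_norm_mul_sqrt _)
        ((integrable_norm_mul_sqrt _).add (integrable_norm_mul_sqrt _))
        fun w => ?_
      simp only [← add_mul]
      gcongr
      exact norm_sub_le _ _
    refine hb.trans ?_
    rw [integral_add (integrable_norm_mul_sqrt _)
      (integrable_norm_mul_sqrt _), integral_norm_mul_sqrt_lowPass,
      integral_norm_mul_sqrt_lowPass φ n (j - 2), ← hC₃]
    have e1 : (√((2 : ℝ) ^ ((j : ℤ) + 1)))⁻¹ ≤ (√(2 ^ j))⁻¹ := by
      gcongr
      rw [zpow_add₀ two_ne_zero]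
      simp only [zpow_natCast, zpow_one]
      linarith
    have e2 : (√((2 : ℝ) ^ ((j : ℤ) - 2)))⁻¹ = 2 * (√(2 ^ j))⁻¹ := by
      rw [zpow_sub₀ two_ne_zero]
      rw [Real.sqrt_div' _ (by positivity), show ((2 : ℝ) ^ (2 : ℤ)) = 2 ^ 2 by norm_cast,
        Real.sqrt_sq zero_le_two]
      simp only [zpow_natCast, inv_div]
      ring
    rw [e2]
    have e3 : 0 ≤ (√((2 : ℝ) ^ j))⁻¹ := by positivity
    nlinarith [mul_le_mul_of_nonneg_right e1 hp3, mul_nonneg hp3 e3, mul_nonneg hC₁ e3,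
      mul_nonneg hp2 e3]
  · have hi : ∀ k, Integrable (fun w => ‖lowPass φ n k (w + v) - lowPass φ n k w‖) := fun k =>
      (((lowPass φ n k).integrable.comp_add_right v).sub (lowPass φ n k).integrable).norm
    have hb : ∫ w, ‖fatKernel φ n j (w + v) - fatKernel φ n j w‖
        ≤ ∫ w, (‖lowPass φ n (j + 1) (w + v) - lowPass φ n (j + 1) w‖
          + ‖lowPass φ n (j - 2) (w + v) - lowPass φ n (j - 2) w‖) := by
      refine integral_mono (((fatKernel φ n j).integrable.comp_add_right v).sub
        (fatKernel φ n j).integrable).norm ((hi _).add (hi _)) fun w => ?_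
      refine le_trans (le_of_eq ?_) (norm_sub_le _ _)
      congr 1
      simp only [fatKernel, sub_apply]
      ring
    refine hb.trans ?_
    rw [integral_add (hi _) (hi _)]
    have e1 := h₁ (j + 1) v
    have e2 := h₁ (j - 2) v
    rw [zpow_add₀ two_ne_zero] at e1
    rw [zpow_sub₀ two_ne_zero] at e2
    simp only [zpow_natCast, zpow_one] at e1 e2
    have e3 : (2 : ℝ) ^ j / 2 ^ (2 : ℤ) * ‖v‖ ≤ 2 ^ j * ‖v‖ := by
      gcongr
      apply div_le_self (by positivity)
      norm_num
    have e4 : (0 : ℝ) ≤ 2 ^ j * ‖v‖ := by positivity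
    nlinarith [mul_le_mul_of_nonneg_left e3 hC₁, mul_nonneg hp2 e4, mul_nonneg hp3 e4,
      mul_nonneg hC₁ e4]

lemma integral_fatKernel (φ : Cutoff) (n j : ℕ) : ∫ w, fatKernel φ n j w = 0 := by
  have : ∀ w, fatKernel φ n j w = lowPass φ n (j + 1) w - lowPass φ n (j - 2) w := fun _ => rfl
  simp_rw [this]
  rw [integral_sub (lowPass φ n _).integrable (lowPass φ n _).integrable, integral_lowPass,
    integral_lowPass, sub_self]

/-- The first factor vanishes off the annulus 2^{j-1} ≤ |ξ| ≤ 2^{j+1}. On it φ(|ξ|/2^{j+1}) = 1 and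
φ(|ξ|/2^{j-2}) = 0, so the second factor is 1. -/
lemma Cutoff.symbol_mul_symbol_sub (φ : Cutoff) (n j : ℕ) (ξ : Rn n) :
    (φ.symbol n j ξ - φ.symbol n (j - 1) ξ) * (φ.symbol n (j + 1) ξ - φ.symbol n (j - 2) ξ)
      = φ.symbol n j ξ - φ.symbol n (j - 1) ξ := by
  have h2 : (0 : ℝ) < 2 ^ j := by positivity
  simp only [Cutoff.symbol_apply]
  rw [zpow_sub₀ two_ne_zero, zpow_add₀ two_ne_zero, zpow_sub₀ two_ne_zero]
  simp only [zpow_natCast, zpow_one]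
  rcases le_or_gt ‖ξ‖ (2 ^ j / 2) with h | h
  · rw [φ.eq_one (‖ξ‖ / 2 ^ j), φ.eq_one (‖ξ‖ / (2 ^ j / 2))]
    · simp
    · rw [div_le_one (by positivity)]; exact h
    · rw [div_le_one (by positivity)]; linarith
  rcases le_or_gt ‖ξ‖ (2 ^ j * 2) with h' | h'
  · rw [φ.eq_one (‖ξ‖ / (2 ^ j * 2)), φ.eq_zero (‖ξ‖ / (2 ^ j / 2 ^ 2))]
    · simp
    · rw [le_div_iff₀ (by positivity)]; norm_num; linarith
    · rw [div_le_one (by positivity)]; linarith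
  · rw [φ.eq_zero (‖ξ‖ / 2 ^ j), φ.eq_zero (‖ξ‖ / (2 ^ j / 2))]
    · simp
    · rw [le_div_iff₀ (by positivity)]; linarith
    · rw [le_div_iff₀ (by positivity)]; linarith

lemma conv_kernel_fatKernel (φ : Cutoff) (n j : ℕ) :
    conv (kernel φ n j) (fatKernel φ n j) = kernel φ n j := by
  have h : SchwartzMap.convolution (ContinuousLinearMap.mul ℂ ℂ) (kernel φ n j) (fatKernel φ n j)
      = kernel φ n j := by
    have h1 : 𝓕 (SchwartzMap.convolution (ContinuousLinearMap.mul ℂ ℂ) (kernel φ n j)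
        (fatKernel φ n j)) = 𝓕 (kernel φ n j) := by
      rw [SchwartzMap.fourier_convolution]
      ext ξ
      rw [fatKernel, lowPass_sub, kernel]
      have hm := φ.symbol_mul_symbol_sub n j ξ
      simp
      linear_combination hm
    have h2 := congrArg (fun u => 𝓕⁻ u) h1
    simpa using h2
  funext x
  rw [conv, ← SchwartzMap.convolution_apply, h]

/-! ### Convolution estimates and the norm of B -/

lemma lintegral_enorm_mul_enorm_le {E F : Type*} [NormedAddCommGroup E] [NormedAddCommGroup F]
    {n : ℕ} {f : Rn n → E} {g : Rn n → F} (hf : AEStronglyMeasurable f volume)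
    (hg : AEStronglyMeasurable g volume) :
    ∫⁻ x, ‖f x‖ₑ * ‖g x‖ₑ ≤ eLpNorm f 2 volume * eLpNorm g 2 volume := by
  have h := ENNReal.lintegral_mul_le_Lp_mul_Lq volume
    (Real.HolderConjugate.two_two) hf.enorm hg.enorm
  simpa [eLpNorm_eq_lintegral_rpow_enorm_toReal two_ne_zero ENNReal.ofNat_ne_top] using h

lemma enorm_conv_le {n : ℕ} (f h : Rn n → ℂ) (x : Rn n) :
    ‖conv f h x‖ₑ ≤ ∫⁻ t, ‖f t‖ₑ * ‖h (x - t)‖ₑ := by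
  refine (enorm_integral_le_lintegral_enorm _).trans_eq ?_
  simp

lemma enorm_conv_le_two {n : ℕ} {f h : Rn n → ℂ} (hf : AEStronglyMeasurable f volume)
    (hh : AEStronglyMeasurable h volume) (x : Rn n) :
    ‖conv f h x‖ₑ ≤ eLpNorm f 2 volume * eLpNorm h 2 volume := by
  have hp := Measure.measurePreserving_sub_left (volume : Measure (Rn n)) x
  refine (enorm_conv_le f h x).trans ?_
  refine (lintegral_enorm_mul_enorm_le hf (hh.comp_measurePreserving hp)).trans_eq ?_
  rw [eLpNorm_comp_measurePreserving hh hp]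

lemma enorm_conv_le_top {n : ℕ} (f : Rn n → ℂ) {h : Rn n → ℂ}
    (hh : AEStronglyMeasurable h volume) (x : Rn n) :
    ‖conv f h x‖ₑ ≤ eLpNorm f ⊤ volume * ∫⁻ w, ‖h w‖ₑ := by
  refine (enorm_conv_le f h x).trans ?_
  have hp := Measure.measurePreserving_sub_left (volume : Measure (Rn n)) x
  rw [← lintegral_sub_left_eq_self (fun w => ‖h w‖ₑ) x, eLpNorm_exponent_top]
  refine le_of_le_of_eq (lintegral_mono_ae ?_)
    (lintegral_const_mul'' _ (hh.comp_measurePreserving hp).enorm)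
  filter_upwards [enorm_ae_le_eLpNormEssSup f volume] with t ht
  gcongr

lemma aestronglyMeasurable_conv {n : ℕ} {f h : Rn n → ℂ} (hf : AEStronglyMeasurable f volume)
    (hh : AEStronglyMeasurable h volume) : AEStronglyMeasurable (conv f h) volume :=
  (hf.convolution_integrand (ContinuousLinearMap.mul ℂ ℂ) hh).integral_prod_right'

lemma lintegral_enorm_eq_ofReal {n : ℕ} (h : 𝓢(Rn n, ℂ)) :
    ∫⁻ w, ‖h w‖ₑ = ENNReal.ofReal (∫ w, ‖h w‖) :=
  (ofReal_integral_norm_eq_lintegral_enorm h.integrable).symm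

/-- Bounded square-integrable functions belong to `B`. -/
lemma exists_bENorm_le (φ : Cutoff) (n : ℕ) :
    ∃ C : ℝ, 0 ≤ C ∧ ∀ g : Rn n → ℂ,
      bENorm φ g ≤ ENNReal.ofReal C * eLpNorm g ⊤ volume + eLpNorm g 2 volume := by
  obtain ⟨C, hC, h1, -, -⟩ := exists_fatKernel_bounds φ n
  refine ⟨3 * C, by positivity, fun g => ?_⟩
  have key : ∀ (h : 𝓢(Rn n, ℂ)) (c : ℝ), ∫ w, ‖h w‖ ≤ c →
      eLpNorm (conv g h) ⊤ volume ≤ ENNReal.ofReal c * eLpNorm g ⊤ volume := by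
    intro h c hc
    rw [eLpNorm_exponent_top]
    refine eLpNormEssSup_le_of_ae_enorm_bound (Filter.Eventually.of_forall fun x => ?_)
    refine (enorm_conv_le_top g h.continuous.aestronglyMeasurable x).trans ?_
    rw [lintegral_enorm_eq_ofReal, mul_comm]
    gcongr
  have hlow := key (lowKernel φ n) C (h1 0)
  have hk : ∀ j, eLpNorm (conv g (kernel φ n j)) ⊤ volume
      ≤ ENNReal.ofReal (2 * C) * eLpNorm g ⊤ volume := by
    intro j
    refine key _ _ ?_
    rw [kernel_eq]
    have : ∫ w, ‖(lowPass φ n j - lowPass φ n (j - 1)) w‖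
        ≤ ∫ w, (‖lowPass φ n j w‖ + ‖lowPass φ n (j - 1) w‖) :=
      integral_mono (SchwartzMap.integrable _).norm
        ((SchwartzMap.integrable _).norm.add (SchwartzMap.integrable _).norm)
        fun w => norm_sub_le _ _
    rw [integral_add (SchwartzMap.integrable _).norm (SchwartzMap.integrable _).norm] at this
    linarith [h1 j, h1 (j - 1)]
  unfold bENorm
  gcongr
  calc _ ≤ ENNReal.ofReal C * eLpNorm g ⊤ volume
        + ENNReal.ofReal (2 * C) * eLpNorm g ⊤ volume :=
        add_le_add hlow (iSup₂_le fun j _ => hk j)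
    _ = _ := by
        rw [← add_mul, ← ENNReal.ofReal_add hC (by positivity)]
        ring_nf

lemma exists_bSpace {φ : Cutoff} {n : ℕ} {v : Rn n → ℂ} (hv : MemLp v 2 volume)
    (hb : bENorm φ v < ⊤) :
    ∃ g : BSpace φ n, g =ᵐ[volume] v ∧ ‖g‖ = (bENorm φ v).toReal := by
  have h : bENorm φ (hv.toLp v) = bENorm φ v := bENorm_congr φ hv.coeFn_toLp
  refine ⟨⟨hv.toLp v, ?_⟩, hv.coeFn_toLp, ?_⟩
  · change bENorm φ (hv.toLp v) < ⊤
    rwa [h]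
  · change (bENorm φ (hv.toLp v)).toReal = _
    rw [h]

lemma BSpace.norm_def {φ : Cutoff} {n : ℕ} (f : BSpace φ n) : ‖f‖ = (bENorm φ f).toReal := rfl

lemma BSpace.bENorm_eq {φ : Cutoff} {n : ℕ} (f : BSpace φ n) :
    bENorm φ f = ENNReal.ofReal ‖f‖ := by
  rw [BSpace.norm_def, ENNReal.ofReal_toReal]
  exact ne_of_lt f.2

lemma BSpace.memLp {φ : Cutoff} {n : ℕ} (f : BSpace φ n) : MemLp f 2 volume := Lp.memLp _

lemma BSpace.eLpNorm_low_le {φ : Cutoff} {n : ℕ} (f : BSpace φ n) :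
    eLpNorm (conv f (lowKernel φ n)) ⊤ volume ≤ ENNReal.ofReal ‖f‖ := by
  rw [← f.bENorm_eq, bENorm, add_assoc]
  exact le_self_add

lemma BSpace.eLpNorm_kernel_le {φ : Cutoff} {n : ℕ} (f : BSpace φ n) {j : ℕ} (hj : 1 ≤ j) :
    eLpNorm (conv f (kernel φ n j)) ⊤ volume ≤ ENNReal.ofReal ‖f‖ := by
  rw [← f.bENorm_eq, bENorm]
  refine le_trans ?_ le_self_add
  refine le_trans ?_ le_add_self
  exact le_iSup₂ (f := fun (j : ℕ) (_ : 1 ≤ j) => eLpNorm (conv f (kernel φ n j)) ⊤ volume) j hj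

lemma BSpace.eLpNorm_two_le {φ : Cutoff} {n : ℕ} (f : BSpace φ n) :
    eLpNorm f 2 volume ≤ ENNReal.ofReal ‖f‖ := by
  rw [← f.bENorm_eq, bENorm]
  exact le_add_self

/-! ### Translation invariance and completeness of B -/

lemma conv_translate {n : ℕ} (f h : Rn n → ℂ) (x₀ x : Rn n) :
    conv (fun y => f (y - x₀)) h x = conv f h (x - x₀) := by
  simp only [conv, convolution_def]
  rw [← integral_sub_right_eq_self (fun t => ContinuousLinearMap.mul ℂ ℂ (f t) (h (x - x₀ - t))) x₀]
  simp

lemma exists_translate {φ : Cutoff} {n : ℕ} (x₀ : Rn n) (f : BSpace φ n) :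
    ∃ g : BSpace φ n, (∀ᵐ x ∂(volume : Measure (Rn n)), g x = f (x - x₀)) ∧ ‖g‖ = ‖f‖ := by
  have hp := measurePreserving_sub_right (volume : Measure (Rn n)) x₀
  have hv : MemLp (fun y => f (y - x₀)) 2 volume := f.memLp.comp_measurePreserving hp
  have hconv : ∀ h : 𝓢(Rn n, ℂ), eLpNorm (conv (fun y => f (y - x₀)) h) ⊤ volume
      = eLpNorm (conv f h) ⊤ volume := by
    intro h
    have : conv (fun y => f (y - x₀)) h = conv f h ∘ (fun x => x - x₀) :=
      funext fun x => conv_translate _ _ _ _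
    rw [this, eLpNorm_comp_measurePreserving
      (aestronglyMeasurable_conv f.memLp.1 h.continuous.aestronglyMeasurable) hp]
  have hb : bENorm φ (fun y => f (y - x₀)) = bENorm φ f := by
    have h2 : eLpNorm (fun y => f (y - x₀)) 2 volume = eLpNorm f 2 volume :=
      eLpNorm_comp_measurePreserving f.memLp.1 hp
    simp only [bENorm, hconv, h2]
  obtain ⟨g, hg, hg'⟩ := exists_bSpace hv (φ := φ) (by rw [hb]; exact f.2)
  exact ⟨g, hg, by rw [hg', hb, BSpace.norm_def]⟩

lemma BSpace.norm_toLp_le {φ : Cutoff} {n : ℕ} (f : BSpace φ n) : ‖f.toLp‖ ≤ ‖f‖ := by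
  rw [Lp.norm_def]
  exact ENNReal.toReal_le_of_le_ofReal (norm_nonneg _) f.eLpNorm_two_le

lemma BSpace.toLp_sub {φ : Cutoff} {n : ℕ} (f g : BSpace φ n) :
    (f - g).toLp = f.toLp - g.toLp := rfl

/-- For fixed h, convolution with h is continuous from L² to L^∞, so the Cauchy bound ε passes to
the limit for every kernel, with no dependence on j. The factor 3 counts the three terms of the
norm. -/
lemma bENorm_sub_le_of_tendsto {φ : Cutoff} {n : ℕ} {u : ℕ → BSpace φ n}
    {F : Lp ℂ 2 (volume : Measure (Rn n))}
    (hF : Filter.Tendsto (fun m => (u m).toLp) Filter.atTop (nhds F)) {ε : ℝ}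
    {N : ℕ} (hN : ∀ m ≥ N, ∀ k ≥ N, ‖u m - u k‖ ≤ ε) {k : ℕ} (hk : N ≤ k) :
    bENorm φ ((u k).toLp - F : Lp ℂ 2 (volume : Measure (Rn n))) ≤ ENNReal.ofReal (3 * ε) := by
  have hε : 0 ≤ ε := (norm_nonneg _).trans (hN k hk k hk)
  have hz : Filter.Tendsto (fun m => ‖(u m).toLp - F‖ₑ) Filter.atTop (nhds 0) := by
    have := (tendsto_iff_norm_sub_tendsto_zero.1 hF)
    have h2 := (ENNReal.continuous_ofReal.tendsto 0).comp this
    simpa [Function.comp_def, ofReal_norm] using h2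
  have hconv : ∀ h : 𝓢(Rn n, ℂ),
      (∀ f : BSpace φ n, eLpNorm (conv f h) ⊤ volume ≤ ENNReal.ofReal ‖f‖) →
      eLpNorm (conv ((u k).toLp - F : Lp ℂ 2 (volume : Measure (Rn n))) h) ⊤ volume
        ≤ ENNReal.ofReal ε := by
    intro h hh
    have hlim : Filter.Tendsto (fun m => ENNReal.ofReal ε
        + ‖(u m).toLp - F‖ₑ * eLpNorm h 2 volume) Filter.atTop (nhds (ENNReal.ofReal ε)) := by
      have := ENNReal.Tendsto.mul_const hz (b := eLpNorm h 2 volume)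
        (Or.inr (h.memLp 2 volume).2.ne)
      simpa using tendsto_const_nhds.add this
    refine ge_of_tendsto hlim ?_
    filter_upwards [Filter.eventually_ge_atTop N] with m hm
    have hsplit : (u k).toLp - F = (u k - u m).toLp + ((u m).toLp - F) := by
      rw [BSpace.toLp_sub]; abel
    rw [hsplit, conv_congr _ (Lp.coeFn_add _ _)]
    refine (eLpNorm_top_conv_add_le (Lp.memLp _) (Lp.memLp _) h).trans (add_le_add ?_ ?_)
    · exact (hh (u k - u m)).trans (ENNReal.ofReal_le_ofReal (hN k hk m hm))
    · rw [eLpNorm_exponent_top]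
      refine eLpNormEssSup_le_of_ae_enorm_bound (Filter.Eventually.of_forall fun x => ?_)
      refine (enorm_conv_le_two (Lp.memLp _).1 h.continuous.aestronglyMeasurable x).trans_eq ?_
      rw [Lp.enorm_def]
  have h2 : eLpNorm ((u k).toLp - F : Lp ℂ 2 (volume : Measure (Rn n))) 2 volume
      ≤ ENNReal.ofReal ε := by
    rw [← Lp.enorm_def, ← ofReal_norm]
    refine ENNReal.ofReal_le_ofReal ?_
    have hlim : Filter.Tendsto (fun m => ‖(u k).toLp - (u m).toLp‖) Filter.atTop
        (nhds ‖(u k).toLp - F‖) := (tendsto_const_nhds.sub hF).norm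
    refine le_of_tendsto hlim ?_
    filter_upwards [Filter.eventually_ge_atTop N] with m hm
    exact (BSpace.norm_toLp_le (u k - u m)).trans (hN k hk m hm)
  calc _ ≤ ENNReal.ofReal ε + ENNReal.ofReal ε + ENNReal.ofReal ε := by
        unfold bENorm
        gcongr
        · exact hconv _ fun f => f.eLpNorm_low_le
        · exact iSup₂_le fun j hj => hconv _ fun f => f.eLpNorm_kernel_le hj
    _ = _ := by
        rw [← ENNReal.ofReal_add hε hε, ← ENNReal.ofReal_add (by positivity) hε]
        ring_nf

/-- A Cauchy sequence in B converges in L². Its limit F is in B because u_N - F has finite norm, and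
the same estimate gives convergence in B. -/
instance (φ : Cutoff) (n : ℕ) : CompleteSpace (BSpace φ n) := by
  refine Metric.complete_of_cauchySeq_tendsto fun u hu => ?_
  have hc : CauchySeq fun m => (u m).toLp := by
    rw [Metric.cauchySeq_iff] at hu ⊢
    intro ε hε
    obtain ⟨N, hN⟩ := hu ε hε
    refine ⟨N, fun m hm k hk => lt_of_le_of_lt ?_ (hN m hm k hk)⟩
    rw [dist_eq_norm, dist_eq_norm, ← BSpace.toLp_sub]
    exact BSpace.norm_toLp_le _
  obtain ⟨F, hF⟩ := cauchySeq_tendsto_of_complete hc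
  have hlim : ∀ ε > 0, ∃ N, ∀ k ≥ N,
      bENorm φ ((u k).toLp - F : Lp ℂ 2 (volume : Measure (Rn n))) ≤ ENNReal.ofReal (3 * ε) := by
    intro ε hε
    obtain ⟨N, hN⟩ := Metric.cauchySeq_iff.1 hu ε hε
    refine ⟨N, fun k hk => bENorm_sub_le_of_tendsto hF (fun m hm k hk => ?_) hk⟩
    rw [← dist_eq_norm]
    exact (hN m hm k hk).le
  have hmem : F ∈ bSubmodule φ n := by
    obtain ⟨N, hN⟩ := hlim 1 one_pos
    have h1 : (u N).toLp - F ∈ bSubmodule φ n := (hN N le_rfl).trans_lt ENNReal.ofReal_lt_top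
    have h2 : F = (u N).toLp - ((u N).toLp - F) := by abel
    rw [h2]
    exact Submodule.sub_mem _ (u N).2 h1
  let G : BSpace φ n := ⟨F, hmem⟩
  refine ⟨G, Metric.tendsto_atTop.2 fun ε hε => ?_⟩
  obtain ⟨N, hN⟩ := hlim (ε / 4) (by positivity)
  refine ⟨N, fun k hk => ?_⟩
  rw [dist_eq_norm, BSpace.norm_def]
  refine (ENNReal.toReal_le_of_le_ofReal (by positivity) (hN k hk)).trans_lt ?_
  linarith

/-! ### The Hardy–Littlewood maximal function -/

/-- The Hardy–Littlewood maximal function. -/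
noncomputable def hlMax {n : ℕ} (u : Rn n → ℝ≥0∞) (x : Rn n) : ℝ≥0∞ :=
  ⨆ (r : ℝ) (_ : 0 < r), (volume (ball x r))⁻¹ * ∫⁻ y in ball x r, u y

lemma volume_ball_eq {n : ℕ} (x : Rn n) {r : ℝ} (hr : 0 < r) :
    volume (ball x r) = ENNReal.ofReal (r ^ n) * volume (ball (0 : Rn n) 1) := by
  have h := Measure.addHaar_ball_mul_of_pos (volume : Measure (Rn n)) x hr 1
  simpa using h

lemma volume_ball_ne_zero {n : ℕ} (x : Rn n) {r : ℝ} (hr : 0 < r) : volume (ball x r) ≠ 0 :=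
  (measure_ball_pos volume x hr).ne'

lemma volume_ball_ne_top {n : ℕ} (x : Rn n) (r : ℝ) : volume (ball x r) ≠ ⊤ :=
  measure_ball_lt_top.ne

/-- The weak type `(1, 1)` bound for the Hardy–Littlewood maximal function. -/
lemma mul_volume_lt_hlMax_le {n : ℕ} [NeZero n] (u : Rn n → ℝ≥0∞) {t : ℝ≥0∞} (ht : t ≠ 0)
    (ht' : t ≠ ⊤) : t * volume {x | t < hlMax u x} ≤ 4 ^ n * ∫⁻ y, u y := by
  by_cases hu : ∫⁻ y, u y = ⊤
  · rw [hu, ENNReal.mul_top (by positivity)]; exact le_top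
  have hx : ∀ x ∈ {x | t < hlMax u x}, ∃ r : ℝ, 0 < r ∧
      t * volume (ball x r) ≤ ∫⁻ y in ball x r, u y := by
    intro x hx
    simp only [Set.mem_ofPred_eq, hlMax, lt_iSup_iff] at hx
    obtain ⟨r, hr, h⟩ := hx
    refine ⟨r, hr, ?_⟩
    rw [mul_comm, ← div_eq_mul_inv] at h
    exact ((ENNReal.lt_div_iff_mul_lt (Or.inl (volume_ball_ne_zero x hr))
      (Or.inl (volume_ball_ne_top x r))).1 h).le
  choose! r hr hle using hx
  -- The Vitali covering lemma needs bounded radii. They are bounded because t |B(x, r)| ≤ ∫ u < ∞.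
  obtain ⟨R, hR⟩ : ∃ R : ℝ, ∀ x ∈ {x | t < hlMax u x}, r x ≤ R := by
    set M := (t * volume (ball (0 : Rn n) 1))⁻¹ * ∫⁻ y, u y with hM
    have ht1 : t * volume (ball (0 : Rn n) 1) ≠ 0 :=
      mul_ne_zero ht (volume_ball_ne_zero 0 one_pos)
    have ht2 : t * volume (ball (0 : Rn n) 1) ≠ ⊤ :=
      ENNReal.mul_ne_top ht' (volume_ball_ne_top 0 1)
    have hMt : M ≠ ⊤ := ENNReal.mul_ne_top (ENNReal.inv_ne_top.2 ht1) hu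
    refine ⟨max 1 M.toReal, fun x hx => ?_⟩
    rcases le_total (r x) 1 with h1 | h1
    · exact h1.trans (le_max_left _ _)
    refine le_trans ?_ (le_max_right _ _)
    have h2 : ENNReal.ofReal (r x ^ n) ≤ M := by
      have h3 := (hle x hx).trans (setLIntegral_le_lintegral _ _)
      rw [volume_ball_eq x (hr x hx), mul_left_comm, mul_comm] at h3
      rw [hM, mul_comm, ← div_eq_mul_inv]
      exact (ENNReal.le_div_iff_mul_le (Or.inl ht1) (Or.inl ht2)).2 (by rw [mul_comm]; exact h3)
    rw [ENNReal.ofReal_le_iff_le_toReal hMt] at h2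
    exact (le_self_pow₀ h1 (NeZero.ne n)).trans h2
  -- Any enlargement factor above 3 is admissible; 4 is the source of the constant 4 ^ n.
  obtain ⟨s, hst, hdisj, hcov⟩ := Vitali.exists_disjoint_subfamily_covering_enlargement_ball
    {x | t < hlMax u x} (fun x => x) r R hR 4 (by norm_num)
  have hs : s.Countable := hdisj.countable_of_isOpen (fun _ _ => isOpen_ball)
    fun x hx => nonempty_ball.2 (hr x (hst hx))
  have hsub : {x | t < hlMax u x} ⊆ ⋃ b ∈ s, ball b (4 * r b) := by
    intro x hx
    obtain ⟨b, hb, h⟩ := hcov x hx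
    exact Set.mem_biUnion hb (h (mem_ball_self (hr x hx)))
  calc t * volume {x | t < hlMax u x}
      ≤ t * ∑' b : s, volume (ball (b : Rn n) (4 * r b)) := by
        gcongr
        exact (measure_mono hsub).trans (measure_biUnion_le volume hs _)
    _ = ∑' b : s, 4 ^ n * (t * volume (ball (b : Rn n) (r b))) := by
        rw [← ENNReal.tsum_mul_left]
        refine tsum_congr fun b => ?_
        have hb := hr b (hst b.2)
        rw [volume_ball_eq _ hb, volume_ball_eq _ (by positivity), mul_pow,
          ENNReal.ofReal_mul (by positivity), ENNReal.ofReal_pow (by norm_num)]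
        simp only [ENNReal.ofReal_ofNat]
        ring
    _ ≤ ∑' b : s, 4 ^ n * ∫⁻ y in ball (b : Rn n) (r b), u y := by
        gcongr with b
        exact hle b (hst b.2)
    _ = 4 ^ n * ∫⁻ y in ⋃ b ∈ s, ball b (r b), u y := by
        rw [ENNReal.tsum_mul_left, lintegral_biUnion hs (fun _ _ => measurableSet_ball) hdisj]
    _ ≤ 4 ^ n * ∫⁻ y, u y := by
        gcongr
        exact Measure.restrict_le_self

/-- The part of u of height at most t adds at most t to any average. This is the truncation used to
interpolate between the weak (1, 1) bound and the trivial L^∞ bound. -/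
lemma hlMax_le_hlMax_indicator_add {n : ℕ} (u : Rn n → ℝ≥0∞) (t : ℝ≥0∞) (x : Rn n) :
    hlMax u x ≤ hlMax ({y | t < u y}.indicator u) x + t := by
  refine iSup₂_le fun r hr => ?_
  have h1 : ∫⁻ y in ball x r, u y
      ≤ (∫⁻ y in ball x r, {y | t < u y}.indicator u y) + t * volume (ball x r) := by
    rw [← setLIntegral_const, ← lintegral_add_right _ measurable_const]
    refine lintegral_mono fun y => ?_
    by_cases hy : t < u y
    · simp [Set.indicator, hy]
    · simp only [Set.indicator, Set.mem_ofPred_eq, hy, if_false, zero_add]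
      exact not_lt.1 hy
  calc _ ≤ (volume (ball x r))⁻¹ * ((∫⁻ y in ball x r, {y | t < u y}.indicator u y)
        + t * volume (ball x r)) := by gcongr
    _ = (volume (ball x r))⁻¹ * (∫⁻ y in ball x r, {y | t < u y}.indicator u y) + t := by
        rw [mul_add, mul_left_comm, ENNReal.inv_mul_cancel (volume_ball_ne_zero x hr)
          (volume_ball_ne_top x r), mul_one]
    _ ≤ _ := by
        gcongr
        exact le_iSup₂ (f := fun (r : ℝ) (_ : 0 < r) => (volume (ball x r))⁻¹ *
          ∫⁻ y in ball x r, {y | t < u y}.indicator u y) r hr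

/-- This is the inner integral that remains, after Tonelli, in the layer-cake argument: the heights
t for which the value a survives truncation at t / 2. -/
lemma volume_pos_lt_le (a : ℝ≥0∞) :
    volume {t : ℝ | 0 < t ∧ ENNReal.ofReal (t / 2) < a} ≤ 2 * a := by
  by_cases ha : a = ⊤
  · simp [ha]
  have hsub : {t : ℝ | 0 < t ∧ ENNReal.ofReal (t / 2) < a} ⊆ Set.Ioo 0 (2 * a.toReal) := by
    rintro t ⟨h0, h1⟩
    rw [ENNReal.ofReal_lt_iff_lt_toReal (by positivity) ha] at h1
    exact ⟨h0, by linarith⟩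
  refine (measure_mono hsub).trans_eq ?_
  rw [Real.volume_Ioo, sub_zero, ENNReal.ofReal_mul zero_le_two, ENNReal.ofReal_toReal ha,
    ENNReal.ofReal_ofNat]

/-- The `L²` bound for functions dominated by the Hardy–Littlewood maximal function. -/
lemma lintegral_sq_le_of_le_hlMax {n : ℕ} [NeZero n] {u : Rn n → ℝ≥0∞} (hu : Measurable u)
    {V : Rn n → ℝ} (hV : AEMeasurable V volume) (hV0 : ∀ x, 0 ≤ V x)
    (hle : ∀ x, ENNReal.ofReal (V x) ≤ hlMax u x) :
    ∫⁻ x, ENNReal.ofReal (V x ^ 2) ≤ 8 * 4 ^ n * ∫⁻ x, u x ^ 2 := by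
  have hcake := lintegral_comp_eq_lintegral_meas_lt_mul (g := fun t => 2 * t) volume
    (Filter.Eventually.of_forall hV0) hV
    (fun t _ => (by fun_prop : Continuous fun t : ℝ => 2 * t).intervalIntegrable _ _)
    ((ae_restrict_iff' measurableSet_Ioi).2 (Filter.Eventually.of_forall fun t ht =>
      mul_nonneg zero_le_two (le_of_lt ht)))
  have hint : ∀ a : ℝ, ∫ t in (0 : ℝ)..a, 2 * t = a ^ 2 := by
    intro a
    rw [intervalIntegral.integral_const_mul, integral_id]
    ring
  simp only [hint] at hcake
  rw [hcake]
  -- If V > t, the maximal function of the part of u above t / 2 exceeds t / 2. The weak type bound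
  -- at that level, with 2t = 4 (t / 2), gives the constant.
  have hpt : ∀ t ∈ Set.Ioi (0 : ℝ), volume {a | t < V a} * ENNReal.ofReal (2 * t)
      ≤ 4 * 4 ^ n * ∫⁻ y, {y | ENNReal.ofReal (t / 2) < u y}.indicator u y := by
    intro t ht
    have ht0 : (0 : ℝ) < t := ht
    have h1 : {a | t < V a} ⊆ {x | ENNReal.ofReal (t / 2)
        < hlMax ({y | ENNReal.ofReal (t / 2) < u y}.indicator u) x} := by
      intro x hx
      have h2 := (hle x).trans (hlMax_le_hlMax_indicator_add u (ENNReal.ofReal (t / 2)) x)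
      have h3 : ENNReal.ofReal t < ENNReal.ofReal (V x) := by
        rw [ENNReal.ofReal_lt_ofReal_iff (ht0.trans hx)]; exact hx
      have h4 : ENNReal.ofReal t = ENNReal.ofReal (t / 2) + ENNReal.ofReal (t / 2) := by
        rw [← ENNReal.ofReal_add (by positivity) (by positivity), add_halves]
      rw [h4] at h3
      exact (ENNReal.add_lt_add_iff_right ENNReal.ofReal_ne_top).1 (h3.trans_le h2)
    calc volume {a | t < V a} * ENNReal.ofReal (2 * t)
        ≤ 4 * (ENNReal.ofReal (t / 2) * volume {x | ENNReal.ofReal (t / 2)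
          < hlMax ({y | ENNReal.ofReal (t / 2) < u y}.indicator u) x}) := by
          rw [show 2 * t = 4 * (t / 2) by ring, ENNReal.ofReal_mul (by norm_num),
            ENNReal.ofReal_ofNat, mul_comm, mul_assoc]
          gcongr
      _ ≤ 4 * (4 ^ n * ∫⁻ y, {y | ENNReal.ofReal (t / 2) < u y}.indicator u y) := by
          refine mul_le_mul_right (mul_volume_lt_hlMax_le (n := n) _ ?_ ENNReal.ofReal_ne_top) _
          simpa using ht0
      _ = _ := by ring
  have hmeas : MeasurableSet {p : ℝ × Rn n | 0 < p.1 ∧ ENNReal.ofReal (p.1 / 2) < u p.2} := by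
    have h1 : MeasurableSet {p : ℝ × Rn n | 0 < p.1} :=
      measurableSet_lt measurable_const measurable_fst
    have h2 : MeasurableSet {p : ℝ × Rn n | ENNReal.ofReal (p.1 / 2) < u p.2} :=
      measurableSet_lt (by fun_prop) (hu.comp measurable_snd)
    exact h1.inter h2
  calc _ ≤ ∫⁻ t in Set.Ioi (0 : ℝ), 4 * 4 ^ n *
        ∫⁻ y, {y | ENNReal.ofReal (t / 2) < u y}.indicator u y :=
        setLIntegral_mono' measurableSet_Ioi hpt
    _ = 4 * 4 ^ n * ∫⁻ t in Set.Ioi (0 : ℝ),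
        ∫⁻ y, {y | ENNReal.ofReal (t / 2) < u y}.indicator u y :=
        lintegral_const_mul' _ _ (ENNReal.mul_ne_top (by norm_num)
          (ENNReal.pow_ne_top (by norm_num)))
    _ = 4 * 4 ^ n * ∫⁻ t : ℝ, ∫⁻ y,
        {p : ℝ × Rn n | 0 < p.1 ∧ ENNReal.ofReal (p.1 / 2) < u p.2}.indicator
          (fun p => u p.2) (t, y) := by
        rw [← lintegral_indicator measurableSet_Ioi]
        congr 2
        funext t
        by_cases ht : 0 < t
        · rw [Set.indicator_of_mem (Set.mem_Ioi.2 ht)]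
          refine lintegral_congr fun y => ?_
          by_cases hy : ENNReal.ofReal (t / 2) < u y <;> simp [Set.indicator, ht, hy]
        · simp [Set.indicator, ht]
    _ = 4 * 4 ^ n * ∫⁻ y, u y * volume {t : ℝ | 0 < t ∧ ENNReal.ofReal (t / 2) < u y} := by
        rw [lintegral_lintegral_swap (f := fun t y =>
          {p : ℝ × Rn n | 0 < p.1 ∧ ENNReal.ofReal (p.1 / 2) < u p.2}.indicator
          (fun p => u p.2) (t, y)) ((hu.comp measurable_snd).indicator hmeas).aemeasurable]
        congr 2
        funext y
        have : ∀ t : ℝ, {p : ℝ × Rn n | 0 < p.1 ∧ ENNReal.ofReal (p.1 / 2) < u p.2}.indicator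
            (fun p => u p.2) (t, y)
            = {t : ℝ | 0 < t ∧ ENNReal.ofReal (t / 2) < u y}.indicator (fun _ => u y) t := by
          intro t
          simp [Set.indicator]
        simp_rw [this]
        rw [lintegral_indicator_const]
        exact hmeas.preimage (measurable_id.prodMk measurable_const)
    _ ≤ 4 * 4 ^ n * ∫⁻ y, 2 * u y ^ 2 := by
        refine mul_le_mul_right (lintegral_mono fun y => ?_) _
        rw [show 2 * u y ^ 2 = u y * (2 * u y) by ring]
        gcongr
        exact volume_pos_lt_le (u y)
    _ = _ := by
        rw [lintegral_const_mul' _ _ (by norm_num)]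
        ring

/-! ### Truncated angular kernels and their moduli of continuity -/

/-- Bounded kernels that are Lipschitz at unit scale on every sphere, uniformly under dilations. -/
structure IsAngular {n : ℕ} {E : Type*} [NormedAddCommGroup E] (k : Rn n → E) : Prop where
  measurable : StronglyMeasurable k
  norm_le : ∀ z, ‖k z‖ ≤ 1
  norm_sub_mul_le : ∀ z w, ‖k z - k w‖ * ‖z‖ ≤ 2 * ‖z - w‖

variable {n : ℕ} {E : Type*} [NormedAddCommGroup E]

lemma IsAngular.stronglyMeasurable_indicator {k : Rn n → E} (hk : IsAngular k) (r : ℝ) :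
    StronglyMeasurable ((ball (0 : Rn n) r).indicator k) :=
  hk.measurable.indicator measurableSet_ball

lemma IsAngular.enorm_indicator_le {k : Rn n → E} (hk : IsAngular k) (r : ℝ) (z : Rn n) :
    ‖(ball (0 : Rn n) r).indicator k z‖ₑ ≤ (ball (0 : Rn n) r).indicator 1 z := by
  by_cases hz : z ∈ ball (0 : Rn n) r
  · have h : ‖k z‖ₑ ≤ 1 := by
      rw [← ofReal_norm]
      exact ENNReal.ofReal_le_one.2 (hk.norm_le z)
    simpa [hz] using h
  · simp [hz]

/-- Bernoulli's inequality gives the relative volume n a / r. It is weakened to n √(a / r), the rate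
forced by the discontinuity of the kernel at the origin. -/
lemma volume_annulus_le {r a : ℝ} (ha : 0 ≤ a) (har : a < r) :
    volume (ball (0 : Rn n) r \ ball 0 (r - a))
      ≤ ENNReal.ofReal (n * √(a / r)) * volume (ball (0 : Rn n) r) := by
  have hr : 0 < r := ha.trans_lt har
  have hra : 0 < r - a := sub_pos.2 har
  rw [measure_sdiff (ball_subset_ball (by linarith)) measurableSet_ball.nullMeasurableSet
    (volume_ball_ne_top _ _), tsub_le_iff_right, volume_ball_eq 0 hr, volume_ball_eq 0 hra,
    ← mul_assoc, ← add_mul, ← ENNReal.ofReal_mul (by positivity),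
    ← ENNReal.ofReal_add (by positivity) (by positivity)]
  gcongr
  have h0 : a / r ≤ 1 := (div_le_one hr).2 har.le
  have h1 : a / r ≤ √(a / r) := Real.le_sqrt_of_sq_le (by nlinarith [div_nonneg ha hr.le])
  have h2 : 1 + (n : ℝ) * (-(a / r)) ≤ (1 + -(a / r)) ^ n :=
    one_add_mul_le_pow (by linarith) n
  have h3 : (r - a) ^ n = r ^ n * (1 + -(a / r)) ^ n := by
    rw [← mul_pow]
    congr 1
    field_simp
    ring
  rw [h3]
  have h4 : (0 : ℝ) < r ^ n := by positivity
  have h5 : (n : ℝ) * (a / r) ≤ n * √(a / r) := by gcongr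
  nlinarith

/-- The radius √(a r) is where the two costs balance: the ball removed around 0 has relative volume
at most √(a / r), and outside it the Lipschitz bound 2a / |z| is at most 2 √(a / r). -/
lemma volume_ball_sqrt_le [NeZero n] {r a : ℝ} (ha : 0 < a) (har : a < r) :
    volume (ball (0 : Rn n) √(a * r)) ≤ ENNReal.ofReal √(a / r) * volume (ball (0 : Rn n) r) := by
  have hr : 0 < r := ha.trans har
  rw [volume_ball_eq 0 hr, volume_ball_eq 0 (Real.sqrt_pos.2 (mul_pos ha hr)), ← mul_assoc,
    ← ENNReal.ofReal_mul (by positivity)]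
  gcongr
  have h1 : √(a * r) = √(a / r) * r := by
    rw [show a * r = a / r * r ^ 2 by field_simp, Real.sqrt_mul (by positivity),
      Real.sqrt_sq hr.le]
  rw [h1, mul_pow]
  gcongr
  refine pow_le_of_le_one (by positivity) ?_ (NeZero.ne n)
  exact Real.sqrt_le_one.2 ((div_le_one hr).2 har.le)

/-- The modulus of continuity in `L¹` of a truncated kernel. -/
lemma IsAngular.lintegral_enorm_translate_sub_le [NeZero n] {k : Rn n → E} (hk : IsAngular k)
    {r : ℝ} (hr : 0 < r) (h : Rn n) :
    ∫⁻ z, ‖(ball (0 : Rn n) r).indicator k (z + h) - (ball (0 : Rn n) r).indicator k z‖ₑ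
      ≤ ENNReal.ofReal ((2 * n + 4) * √(‖h‖ / r)) * volume (ball (0 : Rn n) r) := by
  have hball : ∀ s : ℝ, ∫⁻ z : Rn n, (ball (0 : Rn n) s).indicator (1 : Rn n → ℝ≥0∞) z
      = volume (ball (0 : Rn n) s) := fun s => lintegral_indicator_one measurableSet_ball
  rcases eq_or_ne h 0 with rfl | hh
  · simp
  have ha : 0 < ‖h‖ := norm_pos_iff.2 hh
  -- For shifts of at least r the square root is at least 1, and the trivial bound 2 |B_r| suffices.
  rcases le_or_gt r ‖h‖ with har | har
  · calc _ ≤ ∫⁻ z, ((ball (0 : Rn n) r).indicator (1 : Rn n → ℝ≥0∞) (z + h)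
          + (ball (0 : Rn n) r).indicator (1 : Rn n → ℝ≥0∞) z) := by
          refine lintegral_mono fun z => (enorm_sub_le).trans ?_
          exact add_le_add (hk.enorm_indicator_le r _) (hk.enorm_indicator_le r _)
      _ = 2 * volume (ball (0 : Rn n) r) := by
          rw [lintegral_add_right _ (measurable_one.indicator measurableSet_ball),
            lintegral_add_right_eq_self (fun z => (ball (0 : Rn n) r).indicator
              (1 : Rn n → ℝ≥0∞) z) h, hball, two_mul]
      _ ≤ _ := by
          gcongr
          refine (ENNReal.ofReal_ofNat 2).ge.trans (ENNReal.ofReal_le_ofReal ?_)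
          have h1 : 1 ≤ √(‖h‖ / r) := Real.one_le_sqrt.2 ((one_le_div hr).2 har)
          have h2 : (0 : ℝ) ≤ n := n.cast_nonneg
          nlinarith
  set a := ‖h‖ with ha_def
  set A := ball (0 : Rn n) r \ ball 0 (r - a) with hA
  have hAm : MeasurableSet A := measurableSet_ball.diff measurableSet_ball
  -- Where exactly one indicator is on, z or z + h lies in the thin annulus A. Where both are on,
  -- the bound is 2 near the origin and comes from `norm_sub_mul_le` elsewhere. The relative costs n
  -- + n + 2 + 2 add up to 2n + 4.
  have hpt : ∀ z, ‖(ball (0 : Rn n) r).indicator k (z + h) - (ball (0 : Rn n) r).indicator k z‖ₑ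
      ≤ A.indicator 1 z + A.indicator 1 (z + h) + 2 * (ball (0 : Rn n) √(a * r)).indicator 1 z
        + ENNReal.ofReal (2 * √(a / r)) * (ball (0 : Rn n) r).indicator 1 z := by
    intro z
    by_cases hz : z ∈ ball (0 : Rn n) r
    · by_cases hz' : z + h ∈ ball (0 : Rn n) r
      · by_cases hs : z ∈ ball (0 : Rn n) √(a * r)
        · refine le_trans ?_ (le_add_right (le_add_left le_rfl))
          refine (enorm_sub_le).trans ?_
          simp only [hs, Set.indicator_of_mem, Pi.one_apply, mul_one]
          refine le_of_le_of_eq (add_le_add (b := 1) (d := 1) ((hk.enorm_indicator_le r _).trans ?_)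
            ((hk.enorm_indicator_le r _).trans ?_)) one_add_one_eq_two <;> simp [hz, hz']
        · refine le_trans ?_ (le_add_left le_rfl)
          simp only [hz, hz', Set.indicator_of_mem, Pi.one_apply, mul_one]
          rw [← ofReal_norm]
          refine ENNReal.ofReal_le_ofReal ?_
          have h1 := hk.norm_sub_mul_le z (z + h)
          rw [norm_sub_rev, sub_add_cancel_left, norm_neg, ← ha_def] at h1
          rw [mem_ball_zero_iff, not_lt] at hs
          have h2 : √(a * r) * √(a / r) = a := by
            rw [← Real.sqrt_mul (by positivity), show a * r * (a / r) = a ^ 2 by field_simp,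
              Real.sqrt_sq ha.le]
          have h3 : 0 < √(a * r) := Real.sqrt_pos.2 (mul_pos ha hr)
          have h4 : ‖k (z + h) - k z‖ * √(a * r) ≤ 2 * √(a / r) * √(a * r) := by
            calc _ ≤ ‖k (z + h) - k z‖ * ‖z‖ := by gcongr
              _ ≤ 2 * a := h1
              _ = _ := by rw [mul_assoc, mul_comm √(a / r), h2]
          exact le_of_mul_le_mul_right h4 h3
      · have hzA : z ∈ A := by
          refine ⟨hz, fun hc => hz' ?_⟩
          rw [mem_ball_zero_iff] at hc ⊢
          linarith [norm_add_le z h]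
        rw [add_assoc, add_assoc]
        refine le_trans ?_ le_self_add
        simp only [hz', not_false_eq_true, Set.indicator_of_notMem, zero_sub, enorm_neg, hzA,
          Set.indicator_of_mem, Pi.one_apply]
        exact (hk.enorm_indicator_le r z).trans (by simp [hz])
    · by_cases hz' : z + h ∈ ball (0 : Rn n) r
      · have hzA : z + h ∈ A := by
          refine ⟨hz', fun hc => hz ?_⟩
          rw [mem_ball_zero_iff] at hc ⊢
          have := norm_sub_le (z + h) h
          rw [add_sub_cancel_right] at this
          linarith
        refine le_trans ?_ (le_add_right (le_add_right (le_add_left le_rfl)))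
        simp only [hz, not_false_eq_true, Set.indicator_of_notMem, sub_zero, hzA,
          Set.indicator_of_mem (s := A), Pi.one_apply]
        exact (hk.enorm_indicator_le r _).trans (by simp [hz'])
      · simp [hz, hz']
  have hAv := volume_annulus_le (n := n) ha.le har
  have hA1 : ∫⁻ z : Rn n, A.indicator (1 : Rn n → ℝ≥0∞) z = volume A :=
    lintegral_indicator_one hAm
  have hm1 : ∀ s : ℝ, Measurable fun z => (ball (0 : Rn n) s).indicator (1 : Rn n → ℝ≥0∞) z :=
    fun s => measurable_one.indicator measurableSet_ball
  have hm2 : Measurable fun z => A.indicator (1 : Rn n → ℝ≥0∞) z := measurable_one.indicator hAm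
  calc _ ≤ _ := lintegral_mono hpt
    _ = volume A + volume A + 2 * volume (ball (0 : Rn n) √(a * r))
        + ENNReal.ofReal (2 * √(a / r)) * volume (ball (0 : Rn n) r) := by
        rw [lintegral_add_right _ ((hm1 r).const_mul _),
          lintegral_add_right _ ((hm1 _).const_mul _),
          lintegral_add_left hm2, lintegral_add_right_eq_self (fun z => A.indicator
              (1 : Rn n → ℝ≥0∞) z) h, lintegral_const_mul _ (hm1 _), lintegral_const_mul _ (hm1 _),
          hball, hball, hA1]
    _ ≤ ENNReal.ofReal (n * √(a / r)) * volume (ball (0 : Rn n) r)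
        + ENNReal.ofReal (n * √(a / r)) * volume (ball (0 : Rn n) r)
        + 2 * (ENNReal.ofReal √(a / r) * volume (ball (0 : Rn n) r))
        + ENNReal.ofReal (2 * √(a / r)) * volume (ball (0 : Rn n) r) := by
        gcongr
        exact volume_ball_sqrt_le ha har
    _ = _ := by
        have hT : 0 ≤ √(a / r) := Real.sqrt_nonneg _
        generalize √(a / r) = T at hT
        generalize volume (ball (0 : Rn n) r) = v
        rw [← ENNReal.ofReal_ofNat 2, ← mul_assoc, ← ENNReal.ofReal_mul (by norm_num), ← add_mul,
          ← add_mul, ← add_mul, ← ENNReal.ofReal_add (by positivity) (by positivity),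
          ← ENNReal.ofReal_add (by positivity) (by positivity),
          ← ENNReal.ofReal_add (by positivity) (by positivity)]
        congr 2
        ring

/-- The difference is at most 2 in norm, so its square is at most twice its absolute value and the
L¹ modulus applies. -/
lemma IsAngular.eLpNorm_translate_sub_le [NeZero n] {k : Rn n → E} (hk : IsAngular k)
    {r : ℝ} (hr : 0 < r) (h : Rn n) :
    eLpNorm (fun z => (ball (0 : Rn n) r).indicator k (z + h)
        - (ball (0 : Rn n) r).indicator k z) 2 volume
      ≤ (2 * (ENNReal.ofReal ((2 * n + 4) * √(‖h‖ / r)) * volume (ball (0 : Rn n) r)))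
        ^ (1 / 2 : ℝ) := by
  rw [eLpNorm_eq_lintegral_rpow_enorm_toReal two_ne_zero ENNReal.ofNat_ne_top]
  simp only [ENNReal.toReal_ofNat, ENNReal.rpow_ofNat]
  gcongr
  calc _ ≤ ∫⁻ z, 2 * ‖(ball (0 : Rn n) r).indicator k (z + h)
        - (ball (0 : Rn n) r).indicator k z‖ₑ := by
        refine lintegral_mono fun z => ?_
        rw [sq]
        gcongr
        refine enorm_sub_le.trans (le_of_le_of_eq (add_le_add (b := 1) (d := 1)
          ((hk.enorm_indicator_le r _).trans ?_)
            ((hk.enorm_indicator_le r _).trans ?_)) one_add_one_eq_two)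
        · exact Set.indicator_le_self' (by simp) _
        · exact Set.indicator_le_self' (by simp) _
    _ = 2 * _ := lintegral_const_mul' _ _ (by norm_num)
    _ ≤ _ := by
        gcongr
        exact hk.lintegral_enorm_translate_sub_le hr h

/-! ### Averages over balls against angular kernels -/

section Averages

variable {n : ℕ} {E : Type*} [NormedAddCommGroup E] [NormedSpace ℂ E]

/-- The average of `g(y) k(y - x)` over the ball of radius `r` centred at `x`. -/
noncomputable def angAvg (k : Rn n → E) (r : ℝ) (g : Rn n → ℂ) (x : Rn n) : E :=
  (volume.real (ball (0 : Rn n) r))⁻¹ • ∫ y, g y • (ball (0 : Rn n) r).indicator k (y - x)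

lemma smul_indicator_sub (k : Rn n → E) (r : ℝ) (g : Rn n → ℂ) (x y : Rn n) :
    g y • (ball (0 : Rn n) r).indicator k (y - x)
      = (ball x r).indicator (fun y => g y • k (y - x)) y := by
  by_cases h : y ∈ ball x r
  · have h' : y - x ∈ ball (0 : Rn n) r := by rwa [mem_ball_zero_iff, ← mem_ball_iff_norm]
    simp [h, h']
  · have h' : y - x ∉ ball (0 : Rn n) r := by rwa [mem_ball_zero_iff, ← mem_ball_iff_norm]
    simp [h, h']

lemma angAvg_eq_setAverage (k : Rn n → E) (r : ℝ) (g : Rn n → ℂ) (x : Rn n) :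
    angAvg k r g x = ⨍ y in ball x r, g y • k (y - x) := by
  rw [setAverage_eq, angAvg, ← integral_indicator measurableSet_ball]
  simp_rw [smul_indicator_sub]
  rw [measureReal_def, measureReal_def, Measure.addHaar_ball_center volume x]

lemma lintegral_enorm_smul_indicator (k : Rn n → E) (hk : IsAngular k) (r : ℝ) (g : Rn n → ℂ)
    (x : Rn n) : ∫⁻ y, ‖g y • (ball (0 : Rn n) r).indicator k (y - x)‖ₑ
      ≤ ∫⁻ y in ball x r, ‖g y‖ₑ := by
  rw [← lintegral_indicator measurableSet_ball]
  refine lintegral_mono fun y => ?_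
  rw [smul_indicator_sub, enorm_indicator_eq_indicator_enorm]
  refine Set.indicator_le_indicator ?_
  rw [enorm_smul]
  refine mul_le_of_le_one_right' ?_
  rw [← ofReal_norm]
  exact ENNReal.ofReal_le_one.2 (hk.norm_le _)

lemma aestronglyMeasurable_smul_indicator {k : Rn n → E} (hk : IsAngular k) (r : ℝ)
    {g : Rn n → ℂ} (hg : AEStronglyMeasurable g volume) (x : Rn n) :
    AEStronglyMeasurable (fun y => g y • (ball (0 : Rn n) r).indicator k (y - x)) volume :=
  hg.smul ((hk.stronglyMeasurable_indicator r).comp_measurable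
    (measurable_id.sub_const x)).aestronglyMeasurable

/-- Functions that are integrable over balls of radius `r`, uniformly in the centre. -/
def UnifLocInt (g : Rn n → ℂ) (r : ℝ) : Prop :=
  AEStronglyMeasurable g volume ∧ ∃ M : ℝ≥0∞, M ≠ ⊤ ∧ ∀ x, ∫⁻ y in ball x r, ‖g y‖ₑ ≤ M

lemma UnifLocInt.integrable {g : Rn n → ℂ} {r : ℝ} (hg : UnifLocInt g r) {k : Rn n → E}
    (hk : IsAngular k) (x : Rn n) :
    Integrable (fun y => g y • (ball (0 : Rn n) r).indicator k (y - x)) := by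
  obtain ⟨hm, M, hM, h⟩ := hg
  exact ⟨aestronglyMeasurable_smul_indicator hk r hm x,
    ((lintegral_enorm_smul_indicator k hk r g x).trans (h x)).trans_lt hM.lt_top⟩

lemma unifLocInt_of_bdd {g : Rn n → ℂ} (hg : AEStronglyMeasurable g volume) {b : ℝ}
    (hb : ∀ᵐ y, ‖g y‖ ≤ b) (r : ℝ) : UnifLocInt g r := by
  refine ⟨hg, ENNReal.ofReal b * volume (ball (0 : Rn n) r),
    ENNReal.mul_ne_top ENNReal.ofReal_ne_top (volume_ball_ne_top _ _), fun x => ?_⟩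
  rw [← Measure.addHaar_ball_center volume x, ← setLIntegral_const]
  refine lintegral_mono_ae (ae_restrict_of_ae ?_)
  filter_upwards [hb] with y hy
  rw [← ofReal_norm]
  exact ENNReal.ofReal_le_ofReal hy

lemma unifLocInt_of_memLp {g : Rn n → ℂ} (hg : MemLp g 2 volume) (r : ℝ) : UnifLocInt g r := by
  refine ⟨hg.1, eLpNorm g 2 volume * volume (ball (0 : Rn n) r) ^ (1 / 2 : ℝ),
    ENNReal.mul_ne_top hg.2.ne (ENNReal.rpow_ne_top_of_nonneg (by norm_num)
      (volume_ball_ne_top _ _)), fun x => ?_⟩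
  have h := lintegral_enorm_mul_enorm_le hg.1 ((stronglyMeasurable_const (b := (1 : ℂ))).indicator
    (measurableSet_ball (x := x) (ε := r))).aestronglyMeasurable
  rw [eLpNorm_indicator_const measurableSet_ball (by simp) (by simp)] at h
  rw [← lintegral_indicator measurableSet_ball]
  refine le_of_eq_of_le (lintegral_congr fun y => ?_) (h.trans_eq ?_)
  · by_cases hy : y ∈ ball x r <;> simp [hy]
  · simp [Measure.addHaar_ball_center]

/-- Moving the centre from x' to x amounts to translating the kernel by x' - x. -/
lemma enorm_angAvg_sub_le (k : Rn n → E) (hk : IsAngular k) {r : ℝ} {g : Rn n → ℂ}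
    (hg : UnifLocInt g r) (x x' : Rn n) :
    ‖angAvg k r g x - angAvg k r g x'‖ₑ ≤ (volume (ball (0 : Rn n) r))⁻¹ *
      ∫⁻ z, ‖g (z + x')‖ₑ * ‖(ball (0 : Rn n) r).indicator k (z + (x' - x))
        - (ball (0 : Rn n) r).indicator k z‖ₑ := by
  rcases le_or_gt r 0 with hr | hr
  · simp [angAvg, ball_eq_empty.2 hr]
  have h1 : ‖(volume.real (ball (0 : Rn n) r))⁻¹‖ₑ = (volume (ball (0 : Rn n) r))⁻¹ := by
    rw [measureReal_def, ← ENNReal.toReal_inv, Real.enorm_eq_ofReal ENNReal.toReal_nonneg,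
      ENNReal.ofReal_toReal (ENNReal.inv_ne_top.2 (volume_ball_ne_zero _ hr))]
  rw [angAvg, angAvg, ← smul_sub, enorm_smul, h1,
    ← integral_sub (hg.integrable hk x) (hg.integrable hk x')]
  gcongr
  refine (enorm_integral_le_lintegral_enorm _).trans_eq ?_
  rw [← lintegral_add_right_eq_self _ x']
  refine lintegral_congr fun z => ?_
  rw [← smul_sub, enorm_smul, add_sub_cancel_right, add_sub_assoc]

lemma norm_angAvg_le {k : Rn n → E} (hk : IsAngular k) {r : ℝ} (hr : 0 < r) {g : Rn n → ℂ}
    {b : ℝ} (hb : ∀ᵐ y, ‖g y‖ ≤ b) (x : Rn n) : ‖angAvg k r g x‖ ≤ b := by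
  have hv : 0 < volume.real (ball (0 : Rn n) r) :=
    ENNReal.toReal_pos (volume_ball_ne_zero _ hr) (volume_ball_ne_top _ _)
  rw [angAvg, norm_smul, norm_inv, Real.norm_of_nonneg hv.le, inv_mul_le_iff₀ hv, mul_comm]
  simp_rw [smul_indicator_sub]
  rw [integral_indicator measurableSet_ball]
  have h := norm_setIntegral_le_of_norm_le_const_ae (μ := volume) (s := ball x r)
    (f := fun y => g y • k (y - x)) (C := b) measure_ball_lt_top (by
      filter_upwards [ae_restrict_of_ae hb] with y hy
      rw [norm_smul]
      nlinarith [hk.norm_le (y - x), norm_nonneg (g y), norm_nonneg (k (y - x))])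
  rwa [measureReal_def, Measure.addHaar_ball_center, ← measureReal_def] at h

/-- The L^∞ bound on g is paired with the L¹ modulus of the truncated kernel: averages at scale r
are Hölder continuous of exponent 1/2 in the centre. -/
lemma norm_angAvg_sub_le [NeZero n] {k : Rn n → E} (hk : IsAngular k) {r : ℝ} (hr : 0 < r)
    {g : Rn n → ℂ} (hg : AEStronglyMeasurable g volume) {b : ℝ} (hb0 : 0 ≤ b)
    (hb : ∀ᵐ y, ‖g y‖ ≤ b) (x x' : Rn n) :
    ‖angAvg k r g x - angAvg k r g x'‖ ≤ (2 * n + 4) * b * √(‖x' - x‖ / r) := by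
  have h := enorm_angAvg_sub_le k hk (unifLocInt_of_bdd hg hb r) x x'
  have h2 : ∫⁻ z, ‖g (z + x')‖ₑ * ‖(ball (0 : Rn n) r).indicator k (z + (x' - x))
        - (ball (0 : Rn n) r).indicator k z‖ₑ
      ≤ ENNReal.ofReal b * (ENNReal.ofReal ((2 * n + 4) * √(‖x' - x‖ / r))
        * volume (ball (0 : Rn n) r)) := by
    refine le_trans (lintegral_mono_ae ?_) ((lintegral_const_mul' (ENNReal.ofReal b) (fun z =>
      ‖(ball (0 : Rn n) r).indicator k (z + (x' - x)) - (ball (0 : Rn n) r).indicator k z‖ₑ)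
        ENNReal.ofReal_ne_top).trans_le ?_)
    · filter_upwards [(measurePreserving_add_right volume x').quasiMeasurePreserving.ae hb]
        with z hz
      gcongr
      rw [← ofReal_norm]
      exact ENNReal.ofReal_le_ofReal hz
    · gcongr
      exact hk.lintegral_enorm_translate_sub_le hr _
  rw [← ofReal_norm] at h
  refine (ENNReal.ofReal_le_ofReal_iff (by positivity)).1 (h.trans ?_)
  calc _ ≤ (volume (ball (0 : Rn n) r))⁻¹ * (ENNReal.ofReal b *
        (ENNReal.ofReal ((2 * n + 4) * √(‖x' - x‖ / r)) * volume (ball (0 : Rn n) r))) := by gcongr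
    _ = ENNReal.ofReal b * ENNReal.ofReal ((2 * n + 4) * √(‖x' - x‖ / r)) *
        ((volume (ball (0 : Rn n) r))⁻¹ * volume (ball (0 : Rn n) r)) := by ring
    _ = _ := by
        rw [ENNReal.inv_mul_cancel (volume_ball_ne_zero _ hr) (volume_ball_ne_top _ _), mul_one,
          ← ENNReal.ofReal_mul hb0]
        congr 1
        ring

/-- Cauchy–Schwarz with the L² modulus of the truncated kernel. This continuity makes the maximal
function measurable and allows the low-pass limit to be taken pointwise. -/
lemma continuous_angAvg [NeZero n] {k : Rn n → E} (hk : IsAngular k) {r : ℝ} (hr : 0 < r)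
    {f : Rn n → ℂ} (hf : MemLp f 2 volume) : Continuous (angAvg k r f) := by
  rw [continuous_iff_continuousAt]
  intro x'
  rw [ContinuousAt, tendsto_iff_edist_tendsto_0]
  set F : Rn n → ℝ≥0∞ := fun x => (volume (ball (0 : Rn n) r))⁻¹ * (eLpNorm f 2 volume *
    (2 * (ENNReal.ofReal ((2 * n + 4) * √(‖x' - x‖ / r)) * volume (ball (0 : Rn n) r)))
        ^ (1 / 2 : ℝ)) with hF
  have hv1 : (volume (ball (0 : Rn n) r))⁻¹ ≠ ⊤ := ENNReal.inv_ne_top.2 (volume_ball_ne_zero _ hr)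
  have hFc : Continuous F := by
    refine ENNReal.continuous_const_mul hv1 |>.comp ?_
    refine ENNReal.continuous_const_mul hf.2.ne |>.comp ?_
    refine ENNReal.continuous_rpow_const.comp ?_
    refine ENNReal.continuous_const_mul (by norm_num) |>.comp ?_
    refine ENNReal.continuous_mul_const (volume_ball_ne_top _ _) |>.comp ?_
    refine ENNReal.continuous_ofReal.comp ?_
    fun_prop
  have hF0 : F x' = 0 := by simp [hF]
  have hlim : Filter.Tendsto F (nhds x') (nhds 0) := hF0 ▸ hFc.tendsto x'
  refine tendsto_of_tendsto_of_tendsto_of_le_of_le tendsto_const_nhds hlim (fun _ => zero_le)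
    fun x => ?_
  simp only [edist_eq_enorm_sub]
  refine (enorm_angAvg_sub_le k hk (unifLocInt_of_memLp hf r) x x').trans ?_
  simp only [hF]
  gcongr
  have hm := hk.stronglyMeasurable_indicator r
  have hp := measurePreserving_add_right (volume : Measure (Rn n)) x'
  refine (lintegral_enorm_mul_enorm_le (f := fun z => f (z + x')) (hf.1.comp_measurePreserving hp)
    ((hm.comp_measurable (measurable_id.add_const (x' - x))).sub hm).aestronglyMeasurable).trans ?_
  gcongr
  · exact (eLpNorm_comp_measurePreserving hf.1 hp).le
  · exact hk.eLpNorm_translate_sub_le hr (x' - x)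

/-- Averaging commutes with convolution. -/
lemma angAvg_conv [CompleteSpace E] {k : Rn n → E} (hk : IsAngular k) {r : ℝ}
    {g H : Rn n → ℂ} (hg : UnifLocInt g r) (hH : Integrable H) (x : Rn n) :
    angAvg k r (conv g H) x = ∫ w, H w • angAvg k r g (x - w) := by
  have h1 : ∀ y, conv g H y = ∫ w, H w * g (y - w) := by
    intro y
    rw [conv, convolution_eq_swap]
    exact integral_congr_ae (Filter.Eventually.of_forall fun w => by simp [mul_comm])
  have hmeas : AEStronglyMeasurable (fun p : Rn n × Rn n => (H p.2 * g (p.1 - p.2)) •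
      (ball (0 : Rn n) r).indicator k (p.1 - x)) (volume.prod volume) := by
    refine (hH.1.convolution_integrand (ContinuousLinearMap.mul ℂ ℂ) hg.1).smul ?_
    exact ((hk.stronglyMeasurable_indicator r).comp_measurable
      (measurable_fst.sub_const x)).aestronglyMeasurable
  have hshift : ∀ w, ∫⁻ y, ‖(H w * g (y - w)) • (ball (0 : Rn n) r).indicator k (y - x)‖ₑ
      ≤ ‖H w‖ₑ * ∫⁻ y in ball (x - w) r, ‖g y‖ₑ := by
    intro w
    rw [← lintegral_add_right_eq_self _ w]
    simp only [add_sub_cancel_right, mul_smul, enorm_smul (H w)]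
    rw [lintegral_const_mul' _ _ enorm_ne_top]
    refine mul_le_mul_right ?_ _
    refine le_trans (lintegral_mono fun y => ?_) (lintegral_enorm_smul_indicator k hk r g (x - w))
    rw [show y + w - x = y - (x - w) by abel]
  -- Tonelli in the order y first: each slice in w costs ‖H w‖ times the uniform local mass of g.
  have hint : Integrable (fun p : Rn n × Rn n => (H p.2 * g (p.1 - p.2)) •
      (ball (0 : Rn n) r).indicator k (p.1 - x)) (volume.prod volume) := by
    obtain ⟨-, M, hM, hb⟩ := hg
    refine ⟨hmeas, ?_⟩
    rw [HasFiniteIntegral, lintegral_prod_symm _ hmeas.enorm]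
    calc _ ≤ ∫⁻ w, ‖H w‖ₑ * M := by
          refine lintegral_mono fun w => (hshift w).trans ?_
          gcongr
          exact hb _
      _ = (∫⁻ w, ‖H w‖ₑ) * M := lintegral_mul_const' _ _ hM
      _ < ⊤ := ENNReal.mul_lt_top hH.2 hM.lt_top
  calc angAvg k r (conv g H) x
      = (volume.real (ball (0 : Rn n) r))⁻¹ •
        ∫ y, ∫ w, (H w * g (y - w)) • (ball (0 : Rn n) r).indicator k (y - x) := by
        unfold angAvg
        congr 1
        refine integral_congr_ae (Filter.Eventually.of_forall fun y => ?_)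
        simp only [h1, integral_smul_const]
    _ = (volume.real (ball (0 : Rn n) r))⁻¹ •
        ∫ w, ∫ y, (H w * g (y - w)) • (ball (0 : Rn n) r).indicator k (y - x) := by
        rw [integral_integral_swap hint]
    _ = ∫ w, H w • angAvg k r g (x - w) := by
        rw [← integral_smul]
        refine integral_congr_ae (Filter.Eventually.of_forall fun w => ?_)
        simp only [angAvg]
        rw [smul_comm (H w), ← integral_smul (H w),
          ← integral_add_right_eq_self (fun y => (H w * g (y - w)) • _) w]
        congr 2
        funext y
        rw [add_sub_cancel_right, mul_smul, show y + w - x = y - (x - w) by abel]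

end Averages

/-! ### Averages of Littlewood–Paley pieces -/

section Pieces

variable {n : ℕ} {E : Type*} [NormedAddCommGroup E] [NormedSpace ℂ E]

/-- The convolution is integrable and bounded, hence square integrable. This is the absolute
convergence needed for associativity in `conv_conv`. -/
lemma memLp_conv_norm (h T : 𝓢(Rn n, ℂ)) :
    MemLp ((fun x => ‖h x‖) ⋆[ContinuousLinearMap.mul ℝ ℝ, volume] fun x => ‖T x‖) 2 volume := by
  have hi := (h.integrable (μ := volume)).norm.integrable_convolution
    (ContinuousLinearMap.mul ℝ ℝ) (T.integrable (μ := volume)).norm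
  obtain ⟨M, hM⟩ : ∃ M : ℝ, ∀ x, ‖h x‖ ≤ M := ⟨_, h.norm_le_seminorm ℂ⟩
  have hb : ∀ x, ‖((fun x => ‖h x‖) ⋆[ContinuousLinearMap.mul ℝ ℝ, volume] fun x => ‖T x‖) x‖
      ≤ M * ∫ w, ‖T w‖ := by
    intro x
    rw [convolution_def, ← integral_sub_left_eq_self (fun w => ‖T w‖) volume x,
      ← integral_const_mul]
    refine norm_integral_le_of_norm_le ((T.integrable.norm.comp_sub_left x).const_mul M)
      (Filter.Eventually.of_forall fun t => ?_)
    simp only [ContinuousLinearMap.mul_apply', norm_mul, norm_norm]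
    gcongr
    exact hM t
  rw [memLp_two_iff_integrable_sq hi.1]
  refine (hi.norm.const_mul (M * ∫ w, ‖T w‖)).mono' (hi.1.pow 2)
    (Filter.Eventually.of_forall fun x => ?_)
  rw [norm_pow, sq]
  gcongr
  exact hb x

lemma conv_conv {f : Rn n → ℂ} (hf : MemLp f 2 volume) (h T : 𝓢(Rn n, ℂ)) :
    conv (conv f h) T = conv f (conv h T) := by
  funext x
  refine convolution_assoc _ _ _ _ (fun a b c => ?_) hf.1 h.continuous.aestronglyMeasurable
    T.continuous.aestronglyMeasurable (Filter.Eventually.of_forall fun y => convExists hf h y)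
    (Filter.Eventually.of_forall fun y => ?_) ?_
  · simp [mul_assoc]
  · exact (h.memLp 2 volume).norm.integrable_mul
      ((T.memLp 2 volume).norm.comp_measurePreserving (Measure.measurePreserving_sub_left volume y))
  · exact hf.norm.integrable_mul
      ((memLp_conv_norm h T).comp_measurePreserving (Measure.measurePreserving_sub_left volume x))

lemma conv_kernel_eq (φ : Cutoff) {f : Rn n → ℂ} (hf : MemLp f 2 volume) (j : ℕ) :
    conv f (kernel φ n j) = conv (conv f (kernel φ n j)) (fatKernel φ n j) := by
  rw [conv_conv hf, conv_kernel_fatKernel]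

lemma ae_norm_le_of_eLpNorm_le {u : Rn n → ℂ} {b : ℝ} (hb : 0 ≤ b)
    (h : eLpNorm u ⊤ volume ≤ ENNReal.ofReal b) : ∀ᵐ y, ‖u y‖ ≤ b := by
  rw [eLpNorm_exponent_top] at h
  filter_upwards [enorm_ae_le_eLpNormEssSup u volume] with y hy
  have := hy.trans h
  rwa [← ofReal_norm, ENNReal.ofReal_le_ofReal_iff hb] at this

/-- The decay of averages of a Littlewood–Paley piece over balls larger than its wavelength. -/
lemma exists_norm_angAvg_kernel_le_large [NeZero n] [CompleteSpace E] (φ : Cutoff) :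
    ∃ C : ℝ, 0 ≤ C ∧ ∀ (k : Rn n → E), IsAngular k → ∀ (f : Rn n → ℂ), MemLp f 2 volume →
      ∀ (j : ℕ) (b : ℝ), 0 ≤ b → (∀ᵐ y, ‖conv f (kernel φ n j) y‖ ≤ b) → ∀ (r : ℝ), 0 < r →
      ∀ x, ‖angAvg k r (conv f (kernel φ n j)) x‖ ≤ C * b * (√(2 ^ j * r))⁻¹ := by
  obtain ⟨C, hC, -, h2, -⟩ := exists_fatKernel_bounds φ n
  refine ⟨(2 * n + 4) * C, by positivity, fun k hk f hf j b hb0 hb r hr x => ?_⟩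
  set u := conv f (kernel φ n j) with hu
  set T := fatKernel φ n j with hT
  have hum : AEStronglyMeasurable u volume :=
    aestronglyMeasurable_conv hf.1 (kernel φ n j).continuous.aestronglyMeasurable
  have hUL := unifLocInt_of_bdd hum hb r
  have huT : u = conv u T := conv_kernel_eq φ hf j
  have hcont : Continuous (angAvg k r u) := by
    rw [continuous_iff_continuousAt]
    intro x'
    rw [ContinuousAt, tendsto_iff_norm_sub_tendsto_zero]
    have hc : Continuous fun y => (2 * n + 4) * b * √(‖x' - y‖ / r) := by fun_prop
    refine squeeze_zero (fun _ => norm_nonneg _)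
      (fun y => norm_angAvg_sub_le hk hr hum hb0 hb y x') ?_
    simpa using hc.tendsto x'
  -- Since T has integral zero, the average at x may be subtracted. The Hölder bound √(‖w‖ / r) is
  -- then integrated against the half-moment of T, of size 2^{-j/2}.
  have h0 : angAvg k r u x = ∫ w, T w • (angAvg k r u (x - w) - angAvg k r u x) := by
    have h1 : ∫ w, T w • angAvg k r u x = 0 := by
      rw [integral_smul_const, integral_fatKernel, zero_smul]
    conv_lhs => rw [huT, angAvg_conv hk hUL T.integrable]
    simp_rw [smul_sub]
    rw [integral_sub, h1, sub_zero]
    · refine (T.integrable.norm.mul_const b).mono' ?_ (Filter.Eventually.of_forall fun w => ?_)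
      · exact (T.continuous.smul (hcont.comp (by fun_prop))).aestronglyMeasurable
      · rw [norm_smul]
        gcongr
        exact norm_angAvg_le hk hr hb _
    · exact T.integrable.smul_const _
  rw [h0]
  calc _ ≤ ∫ w, (2 * n + 4) * b * (√r)⁻¹ * (‖T w‖ * √‖w‖) := by
        refine norm_integral_le_of_norm_le ((integrable_norm_mul_sqrt T).const_mul _)
          (Filter.Eventually.of_forall fun w => ?_)
        rw [norm_smul]
        have h3 := norm_angAvg_sub_le hk hr hum hb0 hb (x - w) x
        rw [sub_sub_cancel, Real.sqrt_div' _ hr.le, div_eq_mul_inv] at h3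
        calc _ ≤ ‖T w‖ * ((2 * n + 4) * b * (√‖w‖ * (√r)⁻¹)) := by gcongr
          _ = _ := by ring
    _ = (2 * n + 4) * b * (√r)⁻¹ * ∫ w, ‖T w‖ * √‖w‖ := integral_const_mul _ _
    _ ≤ (2 * n + 4) * b * (√r)⁻¹ * (C * (√(2 ^ j))⁻¹) := by
        gcongr
        exact h2 j
    _ = _ := by
        rw [Real.sqrt_mul (by positivity), mul_inv]
        ring

/-- The decay, for kernels with cancellation, of averages of a Littlewood–Paley piece over balls
smaller than its wavelength. -/
lemma exists_norm_angAvg_kernel_le_small (φ : Cutoff) :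
    ∃ C : ℝ, 0 ≤ C ∧ ∀ (k : Rn n → E), IsAngular k →
      ∀ (f : Rn n → ℂ), MemLp f 2 volume →
      ∀ (j : ℕ) (b : ℝ), 0 ≤ b → (∀ᵐ y, ‖conv f (kernel φ n j) y‖ ≤ b) → ∀ (r : ℝ), 0 < r →
      (∫ z, (ball (0 : Rn n) r).indicator k z = 0) →
      ∀ x, ‖angAvg k r (conv f (kernel φ n j)) x‖ ≤ C * b * (2 ^ j * r) := by
  obtain ⟨C, hC, -, -, h3⟩ := exists_fatKernel_bounds φ n
  refine ⟨C, hC, fun k hk f hf j b hb0 hb r hr hk0 x => ?_⟩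
  set u := conv f (kernel φ n j) with hu
  set T := fatKernel φ n j with hT
  have hum : AEStronglyMeasurable u volume :=
    aestronglyMeasurable_conv hf.1 (kernel φ n j).continuous.aestronglyMeasurable
  have hUL := unifLocInt_of_bdd hum hb r
  have huT : u = conv u T := conv_kernel_eq φ hf j
  -- Reproduction u = u ∗ T transfers the L¹ translation modulus of T to a Lipschitz bound of order
  -- 2^j for u.
  have hlip : ∀ y, ‖u y - u x‖ ≤ b * (C * (2 ^ j * ‖y - x‖)) := by
    intro y
    have hint : ∀ y, Integrable fun t => u t * T (y - t) := fun y =>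
      (T.integrable.comp_sub_left y).bdd_mul hum hb
    have h1 : u y - u x = ∫ t, u t * (T (y - t) - T (x - t)) := by
      conv_lhs => rw [huT]
      simp only [conv, convolution_def, ContinuousLinearMap.mul_apply', mul_sub]
      rw [integral_sub (hint y) (hint x)]
    have hTi : Integrable fun t => ‖T (y - t) - T (x - t)‖ :=
      ((T.integrable.comp_sub_left y).sub (T.integrable.comp_sub_left x)).norm
    rw [h1]
    calc _ ≤ ∫ t, b * ‖T (y - t) - T (x - t)‖ := by
          refine norm_integral_le_of_norm_le (hTi.const_mul b) ?_
          filter_upwards [hb] with t ht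
          rw [norm_mul]
          gcongr
      _ = b * ∫ t, ‖T (t + (y - x)) - T t‖ := by
          rw [integral_const_mul, ← integral_sub_left_eq_self
            (fun t => ‖T (t + (y - x)) - T t‖) volume x]
          congr 2
          funext t
          rw [show x - t + (y - x) = y - t by abel]
      _ ≤ _ := by
          gcongr
          exact h3 j (y - x)
  -- The truncated kernel has integral zero, so constants average to zero and only the oscillation
  -- of u over the ball counts.
  have h1 : angAvg k r u x = angAvg k r (fun y => u y - u x) x := by
    unfold angAvg
    congr 1
    have h2 : ∫ y, u x • (ball (0 : Rn n) r).indicator k (y - x) = 0 := by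
      rw [integral_smul, integral_sub_right_eq_self (fun z => (ball (0 : Rn n) r).indicator k z),
        hk0, smul_zero]
    have hc := (unifLocInt_of_bdd (g := fun _ : Rn n => u x) aestronglyMeasurable_const
      (b := ‖u x‖) (Filter.Eventually.of_forall fun _ => le_rfl) r).integrable hk x
    simp_rw [sub_smul]
    rw [integral_sub (hUL.integrable hk x) hc, h2, sub_zero]
  have hv : 0 < volume.real (ball (0 : Rn n) r) :=
    ENNReal.toReal_pos (volume_ball_ne_zero _ hr) (volume_ball_ne_top _ _)
  rw [h1, angAvg, norm_smul, norm_inv, Real.norm_of_nonneg hv.le, inv_mul_le_iff₀ hv, mul_comm]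
  rw [integral_congr_ae (Filter.Eventually.of_forall
    (smul_indicator_sub k r (fun y => u y - u x) x)), integral_indicator measurableSet_ball]
  have h := norm_setIntegral_le_of_norm_le_const (μ := volume) (s := ball x r)
    (f := fun y => (u y - u x) • k (y - x)) (C := C * b * (2 ^ j * r)) measure_ball_lt_top (by
      intro y hy
      rw [norm_smul]
      rw [mem_ball_iff_norm] at hy
      calc _ ≤ b * (C * (2 ^ j * ‖y - x‖)) * 1 := by
            gcongr
            · exact hlip y
            · exact hk.norm_le _
        _ ≤ b * (C * (2 ^ j * r)) * 1 := by gcongr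
        _ = _ := by ring)
  rwa [measureReal_def, Measure.addHaar_ball_center, ← measureReal_def] at h

/-- The average of the filtered function is the function `angAvg k r f`, bounded and continuous,
smoothed by an approximate identity; dominated convergence applies. No convergence of the series of
pieces themselves is needed. -/
lemma tendsto_angAvg_conv_lowPass [NeZero n] [CompleteSpace E] (φ : Cutoff) {k : Rn n → E}
    (hk : IsAngular k) {r : ℝ} (hr : 0 < r) {f : Rn n → ℂ} (hf : MemLp f 2 volume) (x : Rn n) :
    Filter.Tendsto (fun J : ℕ => angAvg k r (conv f (lowPass φ n J)) x) Filter.atTop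
      (nhds (angAvg k r f x)) := by
  have hcont := continuous_angAvg hk hr hf
  obtain ⟨B, hB⟩ : ∃ B : ℝ, ∀ x, ‖angAvg k r f x‖ ≤ B := by
    obtain ⟨-, M, hM, h⟩ := unifLocInt_of_memLp hf r
    refine ⟨(volume.real (ball (0 : Rn n) r))⁻¹ * M.toReal, fun x => ?_⟩
    rw [angAvg, norm_smul, norm_inv, Real.norm_of_nonneg measureReal_nonneg]
    gcongr
    rw [← toReal_enorm]
    refine ENNReal.toReal_mono hM ((enorm_integral_le_lintegral_enorm _).trans ?_)
    exact (lintegral_enorm_smul_indicator k hk r f x).trans (h x)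
  have h1 : ∀ J : ℕ, angAvg k r (conv f (lowPass φ n J)) x
      = ∫ w, lowPass φ n 0 w • angAvg k r f (x - ((2 : ℝ) ^ J)⁻¹ • w) := by
    intro J
    have h2 : (0 : ℝ) < 2 ^ J := by positivity
    rw [angAvg_conv hk (unifLocInt_of_memLp hf r) (lowPass φ n J).integrable,
      ← integral_dilate (fun w => lowPass φ n 0 w • angAvg k r f (x - ((2 : ℝ) ^ J)⁻¹ • w)) h2]
    refine integral_congr_ae (Filter.Eventually.of_forall fun w => ?_)
    simp only [lowPass_apply φ n J w, smul_assoc, inv_smul_smul₀ h2.ne', zpow_natCast]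
  simp_rw [h1]
  have h3 : angAvg k r f x = ∫ w, lowPass φ n 0 w • angAvg k r f x := by
    rw [integral_smul_const, integral_lowPass, one_smul]
  rw [h3]
  refine tendsto_integral_of_dominated_convergence (fun w => ‖lowPass φ n 0 w‖ * B)
    (fun J => ?_) ((lowPass φ n 0).integrable.norm.mul_const B) (fun J => ?_) ?_
  · exact ((lowPass φ n 0).continuous.smul (hcont.comp (by fun_prop))).aestronglyMeasurable
  · refine Filter.Eventually.of_forall fun w => ?_
    rw [norm_smul]
    gcongr
    exact hB _
  · refine Filter.Eventually.of_forall fun w => ?_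
    refine Filter.Tendsto.const_smul ?_ _
    have h4 : Filter.Tendsto (fun J : ℕ => x - ((2 : ℝ) ^ J)⁻¹ • w) Filter.atTop (nhds x) := by
      have h5 : Filter.Tendsto (fun J : ℕ => ((2 : ℝ) ^ J)⁻¹) Filter.atTop (nhds 0) := by
        simp_rw [← inv_pow]
        exact tendsto_pow_atTop_nhds_zero_of_lt_one (by norm_num) (by norm_num)
      simpa using tendsto_const_nhds.sub (h5.smul_const w)
    exact (hcont.tendsto x).comp h4

lemma conv_lowPass_succ (φ : Cutoff) {f : Rn n → ℂ} (hf : MemLp f 2 volume) (J : ℕ) :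
    conv f (lowPass φ n (J + 1 : ℕ))
      = conv f (lowPass φ n J) + conv f (kernel φ n (J + 1)) := by
  have h : (lowPass φ n (J + 1 : ℕ) : Rn n → ℂ)
      = (lowPass φ n J : Rn n → ℂ) + (kernel φ n (J + 1) : Rn n → ℂ) := by
    funext w
    rw [kernel_eq]
    simp
  unfold conv
  rw [h, (convExists hf _).distrib_add (convExists hf _)]

lemma unifLocInt_conv {f : Rn n → ℂ} (hf : MemLp f 2 volume) (h : 𝓢(Rn n, ℂ)) (r : ℝ) :
    UnifLocInt (conv f h) r := by
  have hm := h.continuous.aestronglyMeasurable (μ := (volume : Measure (Rn n)))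
  refine unifLocInt_of_bdd (aestronglyMeasurable_conv hf.1 hm)
    (b := (eLpNorm f 2 volume * eLpNorm h 2 volume).toReal)
    (Filter.Eventually.of_forall fun y => ?_) r
  rw [← toReal_enorm]
  exact ENNReal.toReal_mono (ENNReal.mul_ne_top hf.2.ne (h.memLp 2 volume).2.ne)
    (enorm_conv_le_two hf.1 hm y)

lemma angAvg_add {k : Rn n → E} (hk : IsAngular k) {r : ℝ} {g g' : Rn n → ℂ}
    (hg : UnifLocInt g r) (hg' : UnifLocInt g' r) (x : Rn n) :
    angAvg k r (g + g') x = angAvg k r g x + angAvg k r g' x := by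
  simp only [angAvg, Pi.add_apply, add_smul]
  rw [integral_add (hg.integrable hk x) (hg'.integrable hk x), smul_add]

/-- Averages of elements of `B` are controlled by those of their Littlewood–Paley pieces. -/
lemma norm_angAvg_le_of_pieces [NeZero n] [CompleteSpace E] {φ : Cutoff} {k : Rn n → E}
    (hk : IsAngular k) {r : ℝ} (hr : 0 < r) (f : BSpace φ n) (x : Rn n) {a : ℕ → ℝ} {S : ℝ}
    (ha : ∀ j, 1 ≤ j → ‖angAvg k r (conv f (kernel φ n j)) x‖ ≤ a j * ‖f‖)
    (hS : ∀ J, ∑ j ∈ Finset.Icc 1 J, a j ≤ S) :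
    ‖angAvg k r f x‖ ≤ (1 + S) * ‖f‖ := by
  have hJ : ∀ J : ℕ, ‖angAvg k r (conv f (lowPass φ n J)) x‖
      ≤ (1 + ∑ j ∈ Finset.Icc 1 J, a j) * ‖f‖ := by
    intro J
    induction J with
    | zero =>
      have h := norm_angAvg_le hk hr (ae_norm_le_of_eLpNorm_le (norm_nonneg f) f.eLpNorm_low_le) x
      simpa [lowPass, lowKernel] using h
    | succ J ih =>
      rw [conv_lowPass_succ φ f.memLp, angAvg_add hk (unifLocInt_conv f.memLp _ r)
        (unifLocInt_conv f.memLp _ r), Finset.sum_Icc_succ_top (by omega)]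
      refine (norm_add_le _ _).trans ?_
      have := ha (J + 1) (by omega)
      nlinarith
  refine le_of_tendsto (tendsto_angAvg_conv_lowPass φ hk hr f.memLp x).norm
    (Filter.Eventually.of_forall fun J => (hJ J).trans ?_)
  gcongr
  exact hS J

end Pieces

/-! ### Summing the two-sided dyadic decay by telescoping -/

/-- A bounded increasing function whose dyadic increments dominate `min a (√a)⁻¹`. -/
noncomputable def saturation (a : ℝ) : ℝ := √a / (1 + √a)

lemma saturation_nonneg (a : ℝ) : 0 ≤ saturation a := by unfold saturation; positivity

lemma saturation_le_one (a : ℝ) : saturation a ≤ 1 := by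
  unfold saturation
  rw [div_le_one (by positivity)]
  linarith

/-- With s = √a the increment is (√2 - 1) s / ((1 + √2 s)(1 + s)), of order s for small s and 1/s
for large s. The sum over a = 2^j r then telescopes, uniformly in r, with no splitting at 2^j r = 1.
-/
lemma min_le_saturation_sub {a : ℝ} (ha : 0 < a) :
    min a (√a)⁻¹ ≤ 12 * (saturation (2 * a) - saturation a) := by
  unfold saturation
  rw [Real.sqrt_mul zero_le_two]
  obtain ⟨s, hs, rfl⟩ : ∃ s : ℝ, 0 < s ∧ a = s ^ 2 :=
    ⟨√a, Real.sqrt_pos.2 ha, (Real.sq_sqrt ha.le).symm⟩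
  rw [Real.sqrt_sq hs.le]
  have h1 : (1.414 : ℝ) ≤ √2 := Real.le_sqrt_of_sq_le (by norm_num)
  have h2 : √2 ≤ 1.415 := Real.sqrt_le_iff.2 ⟨by norm_num, by norm_num⟩
  generalize √2 = q at h1 h2
  have h3 : q * s / (1 + q * s) - s / (1 + s) = (q - 1) * s / ((1 + q * s) * (1 + s)) := by
    have : 0 < 1 + q * s := by nlinarith
    field_simp
    ring
  rw [h3]
  have hden : (1 + q * s) * (1 + s) ≤ (1 + 1.415 * s) * (1 + s) := by gcongr
  have hden0 : 0 < (1 + q * s) * (1 + s) := by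
    have : 0 < 1 + q * s := by nlinarith
    positivity
  -- The denominator is at most 4.83 max(1, s²), and 12 (1.414 - 1) = 4.968 exceeds 4.83.
  rcases le_total s 1 with h | h
  · refine (min_le_left _ _).trans ?_
    rw [← mul_div_assoc, le_div_iff₀ hden0]
    have h4 : (1 + 1.415 * s) * (1 + s) ≤ 4.83 := by nlinarith
    have h5 : s ^ 2 * ((1 + q * s) * (1 + s)) ≤ s ^ 2 * 4.83 := by
      gcongr
      exact hden.trans h4
    nlinarith
  · refine (min_le_right _ _).trans ?_
    rw [← mul_div_assoc, le_div_iff₀ hden0, inv_mul_le_iff₀ hs]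
    nlinarith

lemma saturation_le_two_mul {a : ℝ} (ha : 0 < a) : saturation a ≤ saturation (2 * a) := by
  have h : 0 ≤ min a (√a)⁻¹ := le_min ha.le (by positivity)
  linarith [min_le_saturation_sub ha]

lemma sum_saturation_le (r : ℝ) (J : ℕ) :
    ∑ j ∈ Finset.Icc 1 J, (saturation (2 * (2 ^ j * r)) - saturation (2 ^ j * r)) ≤ 1 := by
  have h : ∑ j ∈ Finset.Icc 1 J, (saturation (2 * (2 ^ j * r)) - saturation (2 ^ j * r))
      = saturation (2 * (2 ^ J * r)) - saturation (2 * r) := by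
    induction J with
    | zero => simp
    | succ J ih =>
      rw [Finset.sum_Icc_succ_top (by omega), ih, pow_succ]
      ring_nf
  rw [h]
  linarith [saturation_le_one (2 * (2 ^ J * r)), saturation_nonneg (2 * r)]

/-! ### The field z / |z| and the pointwise bound for M^⋄ -/

section Direction

variable {n : ℕ}

/-- The unit vector field `z / |z|` with values in `ℂⁿ`. -/
noncomputable def direction (z : Rn n) : EuclideanSpace ℂ (Fin n) :=
  WithLp.toLp 2 fun i => ((z i / ‖z‖ : ℝ) : ℂ)

lemma norm_direction_sub (z w : Rn n) :
    ‖direction z - direction w‖ = ‖‖z‖⁻¹ • z - ‖w‖⁻¹ • w‖ := by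
  rw [EuclideanSpace.norm_eq, EuclideanSpace.norm_eq]
  congr 1
  refine Finset.sum_congr rfl fun i _ => ?_
  congr 1
  simp only [direction, PiLp.sub_apply, PiLp.smul_apply, smul_eq_mul]
  rw [← Complex.ofReal_sub, Complex.norm_real]
  congr 1
  ring

lemma isAngular_direction : IsAngular (direction (n := n)) where
  measurable := by
    refine Measurable.stronglyMeasurable ?_
    refine (WithLp.measurable_toLp 2 _).comp (measurable_pi_lambda _ fun i => ?_)
    refine Complex.measurable_ofReal.comp (Measurable.div ?_ measurable_norm)
    exact (EuclideanSpace.proj (𝕜 := ℝ) i).continuous.measurable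
  norm_le z := by
    have h := norm_direction_sub z 0
    have h0 : direction (0 : Rn n) = 0 := by
      ext i
      simp [direction]
    rw [h0, sub_zero, smul_zero, sub_zero, norm_smul, norm_inv, norm_norm] at h
    rw [h]
    exact inv_mul_le_one
  norm_sub_mul_le z w := by
    rw [norm_direction_sub]
    rcases eq_or_ne z 0 with rfl | hz
    · simp
    have hz' : ‖z‖ ≠ 0 := norm_ne_zero_iff.2 hz
    -- After multiplication by ‖z‖ the difference is z - w plus a multiple of w measuring ‖w‖ - ‖z‖;
    -- each is at most ‖z - w‖ in norm.
    calc ‖‖z‖⁻¹ • z - ‖w‖⁻¹ • w‖ * ‖z‖ = ‖‖z‖ • (‖z‖⁻¹ • z - ‖w‖⁻¹ • w)‖ := by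
          rw [norm_smul, norm_norm, mul_comm]
      _ = ‖(z - w) + (w - ‖z‖ • ‖w‖⁻¹ • w)‖ := by
          rw [smul_sub, smul_inv_smul₀ hz']
          congr 1
          abel
      _ ≤ ‖z - w‖ + ‖z - w‖ := by
          refine (norm_add_le _ _).trans (add_le_add le_rfl ?_)
          rcases eq_or_ne w 0 with rfl | hw
          · simp
          have hw' : ‖w‖ ≠ 0 := norm_ne_zero_iff.2 hw
          have h1 : w - ‖z‖ • ‖w‖⁻¹ • w = ((‖w‖ - ‖z‖) * ‖w‖⁻¹) • w := by
            rw [sub_mul, sub_smul, mul_inv_cancel₀ hw', one_smul, mul_smul]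
          rw [h1, norm_smul, norm_mul, norm_inv, norm_norm, mul_assoc, inv_mul_cancel₀ hw',
            mul_one, norm_sub_rev z w]
          exact abs_norm_sub_norm_le w z
      _ = 2 * ‖z - w‖ := by ring

lemma direction_neg (z : Rn n) : direction (-z) = -direction z := by
  ext i
  simp [direction, neg_div]

/-- The field is odd and the ball symmetric. This cancellation controls the balls smaller than the
wavelength of a piece. -/
lemma integral_indicator_direction (r : ℝ) :
    ∫ z, (ball (0 : Rn n) r).indicator direction z = 0 := by
  have h := integral_neg_eq_self (fun z => (ball (0 : Rn n) r).indicator direction z) volume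
  have h2 : ∀ z : Rn n, (ball (0 : Rn n) r).indicator direction (-z)
      = -(ball (0 : Rn n) r).indicator direction z := by
    intro z
    by_cases hz : z ∈ ball (0 : Rn n) r
    · have hz' : -z ∈ ball (0 : Rn n) r := by simpa using hz
      simp [hz, hz', direction_neg]
    · have hz' : -z ∉ ball (0 : Rn n) r := by simpa using hz
      simp [hz, hz']
  simp_rw [h2] at h
  rw [integral_neg] at h
  have h3 : (2 : ℂ) • ∫ z, (ball (0 : Rn n) r).indicator direction z = 0 := by
    rw [two_smul]
    nth_rewrite 1 [← h]
    exact neg_add_cancel _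
  exact (smul_eq_zero.1 h3).resolve_left two_ne_zero

lemma mDiamond_eq (f : Rn n → ℂ) (x : Rn n) :
    mDiamond f x = ⨆ (r : ℝ) (_ : 0 < r), ‖angAvg direction r f x‖ₑ := by
  unfold mDiamond
  refine iSup_congr fun r => iSup_congr fun _ => ?_
  rw [angAvg_eq_setAverage]
  congr 2
  funext y
  ext i
  simp [signVector, direction, mul_comm]

/-- The supremum runs over uncountably many radii, but each term is continuous in x, so the supremum
is lower semicontinuous. -/
lemma measurable_mDiamond [NeZero n] {f : Rn n → ℂ} (hf : MemLp f 2 volume) :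
    Measurable (mDiamond f) := by
  have h : mDiamond f = fun x => ⨆ (r : ℝ) (_ : 0 < r), ‖angAvg direction r f x‖ₑ :=
    funext fun x => mDiamond_eq f x
  rw [h]
  refine LowerSemicontinuous.measurable ?_
  exact lowerSemicontinuous_biSup fun r hr =>
    (continuous_angAvg isAngular_direction hr hf).enorm.lowerSemicontinuous

lemma enorm_angAvg_le_hlMax {E : Type*} [NormedAddCommGroup E] [NormedSpace ℂ E] {k : Rn n → E}
    (hk : IsAngular k) {r : ℝ} (hr : 0 < r) (f : Rn n → ℂ) (x : Rn n) :
    ‖angAvg k r f x‖ₑ ≤ hlMax (fun y => ‖f y‖ₑ) x := by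
  have h1 : ‖(volume.real (ball (0 : Rn n) r))⁻¹‖ₑ = (volume (ball x r))⁻¹ := by
    rw [measureReal_def, ← ENNReal.toReal_inv, Real.enorm_eq_ofReal ENNReal.toReal_nonneg,
      ENNReal.ofReal_toReal (ENNReal.inv_ne_top.2 (volume_ball_ne_zero _ hr)),
      Measure.addHaar_ball_center volume x]
  refine le_trans ?_ (le_iSup₂ (f := fun (r : ℝ) (_ : 0 < r) => (volume (ball x r))⁻¹ *
    ∫⁻ y in ball x r, ‖f y‖ₑ) r hr)
  rw [angAvg, enorm_smul, h1]
  gcongr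
  exact (enorm_integral_le_lintegral_enorm _).trans (lintegral_enorm_smul_indicator k hk r f x)

/-- The j-th piece contributes a multiple of min(2^j r, (2^j r)^{-1/2}) ‖f‖, and the sum over j
telescopes to a bound independent of r. The summand 1 in the constant is the low-frequency part. -/
lemma exists_mDiamond_le [NeZero n] (φ : Cutoff) :
    ∃ C : ℝ, 0 ≤ C ∧ ∀ (f : BSpace φ n) x, mDiamond f x ≤ ENNReal.ofReal (C * ‖f‖) := by
  obtain ⟨C₁, hC₁, h₁⟩ := exists_norm_angAvg_kernel_le_large (n := n)
    (E := EuclideanSpace ℂ (Fin n)) φ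
  obtain ⟨C₂, hC₂, h₂⟩ := exists_norm_angAvg_kernel_le_small (n := n)
    (E := EuclideanSpace ℂ (Fin n)) φ
  refine ⟨1 + (C₁ + C₂) * 12, by positivity, fun f x => ?_⟩
  rw [mDiamond_eq]
  refine iSup₂_le fun r hr => ?_
  rw [← ofReal_norm]
  refine ENNReal.ofReal_le_ofReal ?_
  refine norm_angAvg_le_of_pieces isAngular_direction hr f x
    (a := fun j => (C₁ + C₂) * 12 * (saturation (2 * (2 ^ j * r)) - saturation (2 ^ j * r)))
    (fun j hj => ?_) fun J => ?_
  · have hb := ae_norm_le_of_eLpNorm_le (norm_nonneg f) (f.eLpNorm_kernel_le hj)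
    have e1 := h₁ _ isAngular_direction f f.memLp j _ (norm_nonneg f) hb r hr x
    have e2 := h₂ _ isAngular_direction f f.memLp j _ (norm_nonneg f) hb r hr
      (integral_indicator_direction r) x
    have hpos : 0 < 2 ^ j * r := by positivity
    have e3 := min_le_saturation_sub hpos
    set m := min (2 ^ j * r) (√(2 ^ j * r))⁻¹ with hm
    have hm0 : 0 ≤ m := le_min hpos.le (by positivity)
    have e4 : ‖angAvg direction r (conv f (kernel φ n j)) x‖ ≤ (C₁ + C₂) * ‖f‖ * m := by
      rcases min_choice (2 ^ j * r) (√(2 ^ j * r))⁻¹ with hc | hc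
      · rw [← hm] at hc
        rw [← hc] at e2
        nlinarith [mul_nonneg (mul_nonneg hC₁ (norm_nonneg f)) hm0]
      · rw [← hm] at hc
        rw [← hc] at e1
        nlinarith [mul_nonneg (mul_nonneg hC₂ (norm_nonneg f)) hm0]
    calc _ ≤ _ := e4
      _ ≤ (C₁ + C₂) * ‖f‖ * (12 * (saturation (2 * (2 ^ j * r)) - saturation (2 ^ j * r))) := by
          gcongr
      _ = _ := by ring
  · rw [← Finset.mul_sum]
    calc _ ≤ (C₁ + C₂) * 12 * 1 := by
          gcongr
          exact sum_saturation_le r J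
      _ = _ := mul_one _

end Direction

/-! ### From pointwise bounds to membership in B -/

lemma hlMax_congr {n : ℕ} {u v : Rn n → ℝ≥0∞} (h : u =ᵐ[volume] v) : hlMax u = hlMax v := by
  funext x
  refine iSup_congr fun r => iSup_congr fun _ => ?_
  rw [lintegral_congr_ae (ae_restrict_of_ae h)]

/-- The factor 2 in the domination makes room for the sharp function. Applying the maximal theorem
to u / 2 gives 32 = 4 · 8. -/
lemma eLpNorm_two_le_of_le_hlMax {n : ℕ} [NeZero n] {f : Rn n → ℂ}
    (hf : AEStronglyMeasurable f volume) {u : Rn n → ℝ≥0∞} (hu : Measurable u)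
    (hfin : ∀ x, u x ≠ ⊤) (hle : ∀ x, u x ≤ 2 * hlMax (fun y => ‖f y‖ₑ) x) :
    eLpNorm (fun x => ((u x).toReal : ℂ)) 2 volume
      ≤ (32 * 4 ^ n) ^ (1 / 2 : ℝ) * eLpNorm f 2 volume := by
  have hmk : (fun y => ‖f y‖ₑ) =ᵐ[volume] fun y => ‖hf.mk f y‖ₑ := by
    filter_upwards [hf.ae_eq_mk] with y hy
    rw [hy]
  rw [hlMax_congr hmk] at hle
  have h := lintegral_sq_le_of_le_hlMax hf.stronglyMeasurable_mk.enorm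
    (V := fun x => (u x).toReal / 2) (hu.ennreal_toReal.div_const 2).aemeasurable
    (fun x => by positivity) (fun x => by
      rw [ENNReal.ofReal_div_of_pos two_pos, ENNReal.ofReal_toReal (hfin x), ENNReal.ofReal_ofNat]
      exact ENNReal.div_le_of_le_mul' (hle x))
  have hv : ∀ x, ‖((u x).toReal : ℂ)‖ₑ ^ 2 = 4 * ENNReal.ofReal (((u x).toReal / 2) ^ 2) := by
    intro x
    rw [← ofReal_norm, Complex.norm_real, ← ENNReal.ofReal_pow (norm_nonneg _),
      ← ENNReal.ofReal_ofNat 4, ← ENNReal.ofReal_mul (by norm_num), Real.norm_eq_abs, sq_abs]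
    congr 1
    ring
  simp only [eLpNorm_eq_lintegral_rpow_enorm_toReal two_ne_zero ENNReal.ofNat_ne_top,
    ENNReal.toReal_ofNat, ENNReal.rpow_ofNat]
  rw [← ENNReal.mul_rpow_of_nonneg _ _ (by norm_num)]
  gcongr
  calc _ = 4 * ∫⁻ x, ENNReal.ofReal (((u x).toReal / 2) ^ 2) := by
        simp_rw [hv]
        exact lintegral_const_mul' _ _ (by norm_num)
    _ ≤ 4 * (8 * 4 ^ n * ∫⁻ x, ‖hf.mk f x‖ₑ ^ 2) := by gcongr
    _ = 32 * 4 ^ n * ∫⁻ x, ‖hf.mk f x‖ₑ ^ 2 := by ring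
    _ = _ := by
        congr 1
        refine lintegral_congr_ae ?_
        filter_upwards [hmk] with y hy
        rw [hy]

/-- A bounded function dominated by the maximal function of an element of `L²` represents an
element of `B`. -/
lemma exists_represents (φ : Cutoff) (n : ℕ) [NeZero n] :
    ∃ C : ℝ, 0 ≤ C ∧ ∀ (f : Rn n → ℂ), MemLp f 2 volume → ∀ u : Rn n → ℝ≥0∞, Measurable u →
      ∀ b : ℝ, 0 ≤ b → (∀ x, u x ≤ ENNReal.ofReal b) →
      (∀ x, u x ≤ 2 * hlMax (fun y => ‖f y‖ₑ) x) →
      ∃ g : BSpace φ n, Represents g u ∧ ‖g‖ ≤ C * (b + (eLpNorm f 2 volume).toReal) := by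
  obtain ⟨C, hC, h⟩ := exists_bENorm_le φ n
  set D : ℝ≥0∞ := (32 * 4 ^ n) ^ (1 / 2 : ℝ) with hD
  have hDt : D ≠ ⊤ := ENNReal.rpow_ne_top_of_nonneg (by norm_num)
    (ENNReal.mul_ne_top (by norm_num) (ENNReal.pow_ne_top (by norm_num)))
  refine ⟨C + D.toReal, by positivity, fun f hf u hu b hb hub huM => ?_⟩
  have hfin : ∀ x, u x ≠ ⊤ := fun x => ((hub x).trans_lt ENNReal.ofReal_lt_top).ne
  set v : Rn n → ℂ := fun x => ((u x).toReal : ℂ) with hv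
  have hvm : AEStronglyMeasurable v volume :=
    (Complex.measurable_ofReal.comp hu.ennreal_toReal).aestronglyMeasurable
  have h2 := eLpNorm_two_le_of_le_hlMax hf.1 hu hfin huM
  have hv2 : MemLp v 2 volume := ⟨hvm, h2.trans_lt (ENNReal.mul_lt_top hDt.lt_top hf.2)⟩
  have hinf : eLpNorm v ⊤ volume ≤ ENNReal.ofReal b := by
    rw [eLpNorm_exponent_top]
    refine eLpNormEssSup_le_of_ae_enorm_bound (Filter.Eventually.of_forall fun x => ?_)
    refine le_trans (le_of_eq ?_) (hub x)
    rw [hv, ← ofReal_norm, Complex.norm_real, Real.norm_of_nonneg ENNReal.toReal_nonneg,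
      ENNReal.ofReal_toReal (hfin x)]
  have hbn : bENorm φ v ≤ ENNReal.ofReal C * ENNReal.ofReal b + D * eLpNorm f 2 volume :=
    (h v).trans (by gcongr)
  have htop : ENNReal.ofReal C * ENNReal.ofReal b + D * eLpNorm f 2 volume ≠ ⊤ :=
    ENNReal.add_ne_top.2 ⟨ENNReal.mul_ne_top ENNReal.ofReal_ne_top ENNReal.ofReal_ne_top,
      ENNReal.mul_ne_top hDt hf.2.ne⟩
  obtain ⟨g, hg, hgn⟩ := exists_bSpace hv2 (φ := φ) (hbn.trans_lt htop.lt_top)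
  refine ⟨g, ?_, ?_⟩
  · filter_upwards [hg] with x hx
    exact ⟨hfin x, hx⟩
  · rw [hgn]
    refine (ENNReal.toReal_mono htop hbn).trans ?_
    rw [ENNReal.toReal_add (ENNReal.mul_ne_top ENNReal.ofReal_ne_top ENNReal.ofReal_ne_top)
      (ENNReal.mul_ne_top hDt hf.2.ne), ENNReal.toReal_mul, ENNReal.toReal_mul,
      ENNReal.toReal_ofReal hC, ENNReal.toReal_ofReal hb]
    nlinarith [mul_nonneg hC (ENNReal.toReal_nonneg (a := eLpNorm f 2 volume)),
      mul_nonneg (ENNReal.toReal_nonneg (a := D)) hb]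

lemma BSpace.toReal_eLpNorm_two_le {φ : Cutoff} {n : ℕ} (f : BSpace φ n) :
    (eLpNorm f 2 volume).toReal ≤ ‖f‖ :=
  ENNReal.toReal_le_of_le_ofReal (norm_nonneg _) f.eLpNorm_two_le

/-- The L^∞ bound comes from the decay of the pieces, the L² bound from the Hardy–Littlewood maximal
theorem; together they control the norm of B. -/
lemma boundedOnB_mDiamond (φ : Cutoff) (n : ℕ) [NeZero n] : BoundedOnB φ n mDiamond := by
  obtain ⟨C, hC, h⟩ := exists_mDiamond_le (n := n) φ
  obtain ⟨D, hD, h'⟩ := exists_represents φ n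
  refine ⟨D * (C + 1), fun f => ?_⟩
  obtain ⟨g, hg, hgn⟩ := h' f f.memLp _ (measurable_mDiamond f.memLp) (C * ‖f‖)
    (by positivity) (h f) fun x => by
      rw [mDiamond_eq]
      refine (iSup₂_le fun r hr => enorm_angAvg_le_hlMax isAngular_direction hr f x).trans ?_
      rw [two_mul]
      exact le_self_add
  refine ⟨g, hg, hgn.trans ?_⟩
  rw [mul_assoc]
  gcongr
  linarith [f.toReal_eLpNorm_two_le]

/-! ### Averages over small balls of elements of B -/

lemma isAngular_one {n : ℕ} : IsAngular (fun _ : Rn n => (1 : ℂ)) where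
  measurable := stronglyMeasurable_const
  norm_le _ := by simp
  norm_sub_mul_le _ _ := by simp

/-- Averages of elements of `B` over balls of radius `2 ^ (-m)` grow at most linearly in `m`. -/
lemma exists_norm_setAverage_le (φ : Cutoff) (n : ℕ) [NeZero n] :
    ∃ C : ℝ, 0 < C ∧ ∀ (g : BSpace φ n) (m : ℕ),
      ‖⨍ y in ball (0 : Rn n) ((2 : ℝ) ^ m)⁻¹, g y‖ ≤ C * (m + 1) * ‖g‖ := by
  obtain ⟨C, hC, h⟩ := exists_norm_angAvg_kernel_le_large (n := n) (E := ℂ) φ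
  refine ⟨1 + 12 * C, by positivity, fun g m => ?_⟩
  set r : ℝ := ((2 : ℝ) ^ m)⁻¹ with hr_def
  have hr : 0 < r := by positivity
  have h1 : ⨍ y in ball (0 : Rn n) r, g y = angAvg (fun _ => (1 : ℂ)) r g 0 := by
    rw [angAvg_eq_setAverage]
    simp
  rw [h1]
  -- The constant kernel has no cancellation. Each piece with j ≤ m, of wavelength at least the
  -- radius, costs up to ‖g‖, which gives m; the pieces with j > m decay and telescope to 12 C.
  have h2 := norm_angAvg_le_of_pieces isAngular_one hr g 0 (S := m + 12 * C)
    (a := fun j => (if j ∈ Finset.Icc 1 m then 1 else 0)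
      + 12 * C * (saturation (2 * (2 ^ j * r)) - saturation (2 ^ j * r)))
    (fun j hj => ?_) fun J => ?_
  · refine h2.trans ?_
    gcongr
    nlinarith [mul_nonneg hC (Nat.cast_nonneg (α := ℝ) m)]
  · have hb := ae_norm_le_of_eLpNorm_le (norm_nonneg g) (g.eLpNorm_kernel_le hj)
    have hpos : 0 < 2 ^ j * r := by positivity
    by_cases hjm : j ≤ m
    · have e1 := norm_angAvg_le isAngular_one hr hb 0
      rw [if_pos (Finset.mem_Icc.2 ⟨hj, hjm⟩)]
      have e2 := saturation_le_two_mul hpos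
      have e3 : 0 ≤ 12 * C * (saturation (2 * (2 ^ j * r)) - saturation (2 ^ j * r)) :=
        mul_nonneg (by positivity) (by linarith)
      nlinarith [norm_nonneg g, mul_nonneg e3 (norm_nonneg g)]
    · rw [if_neg (by simp [hjm]), zero_add]
      have e1 := h _ isAngular_one g g.memLp j _ (norm_nonneg g) hb r hr 0
      have e2 : 1 ≤ 2 ^ j * r := by
        rw [hr_def, ← div_eq_mul_inv, one_le_div (by positivity)]
        exact pow_le_pow_right₀ one_le_two (by omega)
      have e3 := min_le_saturation_sub hpos
      rw [min_eq_right] at e3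
      · calc _ ≤ _ := e1
          _ ≤ C * ‖g‖ * (12 * (saturation (2 * (2 ^ j * r)) - saturation (2 ^ j * r))) := by
              gcongr
          _ = _ := by ring
      · exact (inv_le_one_of_one_le₀ (Real.one_le_sqrt.2 e2)).trans e2
  · rw [Finset.sum_add_distrib, ← Finset.mul_sum]
    refine add_le_add ?_ ?_
    · rw [Finset.sum_ite_mem, Finset.sum_const, nsmul_eq_mul, mul_one]
      have : (Finset.Icc 1 J ∩ Finset.Icc 1 m).card ≤ m := by
        refine (Finset.card_le_card Finset.inter_subset_right).trans ?_
        simp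
      exact_mod_cast this
    · calc _ ≤ 12 * C * 1 := by
            gcongr
            exact sum_saturation_le r J
        _ = _ := mul_one _

/-! ### Trigonometric sums and lacunary sine waves -/

/-- A trigonometric sum with frequencies of modulus in `[lo, hi]` and coefficients of total mass
at most `W`. -/
def IsTrigSum (lo hi W : ℝ) (g : C(ℝ, ℝ)) : Prop :=
  ∃ (ι : Type) (_ : Fintype ι) (q : ι → ℝ) (c : ι → ℂ), (∀ i, lo ≤ |q i| ∧ |q i| ≤ hi) ∧
    ∑ i, ‖c i‖ ≤ W ∧
      ∀ t, ((g t : ℝ) : ℂ) = ∑ i, c i * Complex.exp (2 * Real.pi * q i * t * Complex.I)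

lemma IsTrigSum.mono {lo hi W lo' hi' W' : ℝ} {g : C(ℝ, ℝ)} (h : IsTrigSum lo hi W g)
    (h1 : lo' ≤ lo) (h2 : hi ≤ hi') (h3 : W ≤ W') : IsTrigSum lo' hi' W' g := by
  obtain ⟨ι, _, q, c, hq, hc, hg⟩ := h
  exact ⟨ι, _, q, c, fun i => ⟨h1.trans (hq i).1, (hq i).2.trans h2⟩, hc.trans h3, hg⟩

lemma isTrigSum_zero (lo hi : ℝ) : IsTrigSum lo hi 0 0 :=
  ⟨Empty, inferInstance, fun _ => 0, fun _ => 0, fun i => i.elim, by simp, by simp⟩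

lemma IsTrigSum.add {lo hi W W' : ℝ} {g g' : C(ℝ, ℝ)} (h : IsTrigSum lo hi W g)
    (h' : IsTrigSum lo hi W' g') : IsTrigSum lo hi (W + W') (g + g') := by
  obtain ⟨ι, _, q, c, hq, hc, hg⟩ := h
  obtain ⟨κ, _, p, d, hp, hd, hg'⟩ := h'
  refine ⟨ι ⊕ κ, inferInstance, Sum.elim q p, Sum.elim c d, ?_, ?_, fun t => ?_⟩
  · rintro (i | i)
    · exact hq i
    · exact hp i
  · simpa using add_le_add hc hd
  · simp [hg, hg']

lemma IsTrigSum.smul {lo hi W : ℝ} {g : C(ℝ, ℝ)} (h : IsTrigSum lo hi W g) (a : ℝ) :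
    IsTrigSum lo hi (|a| * W) (a • g) := by
  obtain ⟨ι, _, q, c, hq, hc, hg⟩ := h
  refine ⟨ι, inferInstance, q, fun i => a * c i, hq, ?_, fun t => ?_⟩
  · simp only [norm_mul, Complex.norm_real, Real.norm_eq_abs]
    rw [← Finset.mul_sum]
    gcongr
  · simp [hg, Finset.mul_sum, mul_assoc]

/-- Frequencies of a product are sums of frequencies. The lower bound lo' - hi is useful when the
second factor oscillates faster than the first. -/
lemma IsTrigSum.mul {lo hi W lo' hi' W' : ℝ} {g g' : C(ℝ, ℝ)} (h : IsTrigSum lo hi W g)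
    (h' : IsTrigSum lo' hi' W' g') :
    IsTrigSum (lo' - hi) (hi + hi') (W * W') (g * g') := by
  obtain ⟨ι, _, q, c, hq, hc, hg⟩ := h
  obtain ⟨κ, _, p, d, hp, hd, hg'⟩ := h'
  refine ⟨ι × κ, inferInstance, fun i => q i.1 + p i.2, fun i => c i.1 * d i.2, fun i => ⟨?_, ?_⟩,
    ?_, fun t => ?_⟩
  · have h1 := abs_sub_abs_le_abs_sub (p i.2) (-q i.1)
    rw [abs_neg, sub_neg_eq_add, add_comm (p i.2)] at h1
    linarith [(hq i.1).2, (hp i.2).1]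
  · exact (abs_add_le _ _).trans (add_le_add (hq i.1).2 (hp i.2).2)
  · rw [Fintype.sum_prod_type]
    simp only [norm_mul]
    rw [← Finset.sum_mul_sum]
    have h0 : 0 ≤ W := le_trans (by positivity) hc
    gcongr
  · rw [Fintype.sum_prod_type]
    simp only [ContinuousMap.mul_apply, Complex.ofReal_mul, hg, hg']
    rw [Finset.sum_mul_sum]
    refine Finset.sum_congr rfl fun i _ => Finset.sum_congr rfl fun j _ => ?_
    rw [mul_mul_mul_comm, ← Complex.exp_add]
    push_cast
    ring_nf

/-- The sine wave of frequency `a`. -/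
noncomputable def sinWave (a : ℝ) : C(ℝ, ℝ) :=
  ⟨fun t => Real.sin (2 * Real.pi * a * t), by fun_prop⟩

/-- The cosine wave of frequency `a`. -/
noncomputable def cosWave (a : ℝ) : C(ℝ, ℝ) :=
  ⟨fun t => Real.cos (2 * Real.pi * a * t), by fun_prop⟩

lemma isTrigSum_sinWave (a : ℝ) : IsTrigSum |a| |a| 1 (sinWave a) := by
  refine ⟨Bool, inferInstance, fun b => if b then -a else a,
    fun b => if b then Complex.I / 2 else -(Complex.I / 2), ?_, ?_, fun t => ?_⟩
  · intro b; cases b <;> simp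
  · simp; norm_num
  · simp only [sinWave, ContinuousMap.coe_mk, Complex.ofReal_sin, Fintype.sum_bool, Complex.sin]
    push_cast
    simp
    ring_nf

lemma isTrigSum_cosWave (a : ℝ) : IsTrigSum |a| |a| 1 (cosWave a) := by
  refine ⟨Bool, inferInstance, fun b => if b then -a else a, fun _ => 1 / 2, ?_, ?_, fun t => ?_⟩
  · intro b; cases b <;> simp
  · simp
  · simp only [cosWave, ContinuousMap.coe_mk, Complex.ofReal_cos, Fintype.sum_bool, Complex.cos]
    push_cast
    simp
    ring_nf

lemma sinWave_sq (a : ℝ) : sinWave a ^ 2 = (1 / 2 : ℝ) • 1 - (1 / 2 : ℝ) • cosWave (2 * a) := by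
  ext t
  have h := Real.cos_sq_add_sin_sq (2 * Real.pi * a * t)
  have h2 := Real.cos_two_mul (2 * Real.pi * a * t)
  simp only [sinWave, cosWave, ContinuousMap.pow_apply, ContinuousMap.coe_mk,
    ContinuousMap.sub_apply, ContinuousMap.smul_apply, ContinuousMap.one_apply, smul_eq_mul]
  rw [show 2 * Real.pi * (2 * a) * t = 2 * (2 * Real.pi * a * t) by ring, h2]
  linarith

lemma sinWave_pow_three (a : ℝ) :
    sinWave a ^ 3 = (3 / 4 : ℝ) • sinWave a + (-(1 / 4) : ℝ) • sinWave (3 * a) := by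
  ext t
  have h2 := Real.sin_three_mul (2 * Real.pi * a * t)
  simp only [sinWave, ContinuousMap.pow_apply, ContinuousMap.coe_mk,
    ContinuousMap.add_apply, ContinuousMap.smul_apply, smul_eq_mul]
  rw [show 2 * Real.pi * (3 * a) * t = 3 * (2 * Real.pi * a * t) by ring, h2]
  ring

/-- The sum of the sine waves of frequencies `a 1, …, a N`. -/
noncomputable def waveSum (a : ℕ → ℝ) (N : ℕ) : C(ℝ, ℝ) := ∑ j ∈ Finset.Icc 1 N, sinWave (a j)

lemma waveSum_succ (a : ℕ → ℝ) (N : ℕ) :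
    waveSum a (N + 1) = waveSum a N + sinWave (a (N + 1)) := by
  unfold waveSum
  rw [Finset.sum_Icc_succ_top (by omega)]

/-- Only the upper end of the frequency range matters below, where the sum is multiplied by a faster
wave. -/
lemma isTrigSum_waveSum {a : ℕ → ℝ} (h1 : ∀ j, 2 * a j ≤ a (j + 1))
    (h2 : ∀ j, 2 ^ (j + 1) ≤ a (j + 1)) (N : ℕ) :
    IsTrigSum 1 (a N) N (waveSum a N) := by
  induction N with
  | zero => simpa [waveSum] using isTrigSum_zero 1 (a 0)
  | succ N ih =>
    rw [waveSum_succ, Nat.cast_succ]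
    have h3 : 1 ≤ a (N + 1) := (one_le_pow₀ one_le_two).trans (h2 N)
    refine (ih.mono le_rfl (by linarith [h1 N]) le_rfl).add
      ((isTrigSum_sinWave _).mono ?_ ?_ le_rfl)
    · rwa [abs_of_nonneg (by linarith)]
    · rw [abs_of_nonneg (by linarith)]

/-! ### Moments of lacunary sums under a functional that damps high frequencies -/

section Functional

variable {L : C(ℝ, ℝ) →ₗ[ℝ] ℝ} {C : ℝ}

/-- Near-orthogonality of lacunary sine waves. -/
lemma abs_sq_waveSum_sub_le (hC : 0 ≤ C)
    (hL : ∀ lo hi W g, 0 < lo → IsTrigSum lo hi W g → |L g| ≤ C * W / lo)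
    {a : ℕ → ℝ} (h1 : ∀ j, 2 * a j ≤ a (j + 1))
    (h2 : ∀ j, 2 ^ (j + 1) ≤ a (j + 1)) (N : ℕ) :
    |L (waveSum a N ^ 2) - N / 2 * L 1| ≤ 6 * C := by
  -- Adding wave N + 1 costs at most C (2N + 1) / 2^N. This series has sum 6, and 6 - (4N + 6) / 2^N
  -- is its N-th partial sum.
  have key : |L (waveSum a N ^ 2) - N / 2 * L 1| ≤ C * (6 - (4 * N + 6) / 2 ^ N) := by
    induction N with
    | zero => simp [waveSum]
    | succ N ih =>
      have hpos : (0 : ℝ) < 2 ^ N := by positivity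
      have ha := h2 N
      rw [pow_succ] at ha
      have e1 : |L (waveSum a N * sinWave (a (N + 1)))| ≤ C * N / 2 ^ N := by
        refine hL _ _ _ _ hpos (((isTrigSum_waveSum h1 h2 N).mul (isTrigSum_sinWave _)).mono ?_
          le_rfl (by rw [mul_one]))
        rw [abs_of_nonneg (by linarith)]
        linarith [h1 N]
      have e2 : |L (cosWave (2 * a (N + 1)))| ≤ C * 1 / 2 ^ N := by
        refine hL _ _ _ _ hpos ((isTrigSum_cosWave _).mono ?_ le_rfl le_rfl)
        rw [abs_of_nonneg (by linarith)]
        linarith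
      have e3 : waveSum a (N + 1) ^ 2 = waveSum a N ^ 2
          + (2 : ℝ) • (waveSum a N * sinWave (a (N + 1)))
          + ((1 / 2 : ℝ) • 1 - (1 / 2 : ℝ) • cosWave (2 * a (N + 1))) := by
        rw [waveSum_succ, ← sinWave_sq, add_sq, two_smul]
        ring
      rw [e3]
      simp only [map_add, map_sub, map_smul, smul_eq_mul]
      rw [abs_le] at ih e1 e2 ⊢
      have e4 : (4 * ((N + 1 : ℕ) : ℝ) + 6) / 2 ^ (N + 1)
          = (4 * N + 6) / 2 ^ N - (2 * N + 1) / 2 ^ N := by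
        rw [pow_succ]; push_cast; field_simp; ring
      have e5 : C * (6 - (4 * ((N + 1 : ℕ) : ℝ) + 6) / 2 ^ (N + 1))
          = C * (6 - (4 * N + 6) / 2 ^ N) + 2 * (C * N / 2 ^ N) + C * 1 / 2 ^ N := by
        rw [e4]; ring
      rw [e5]
      have e6 : 0 ≤ C * 1 / 2 ^ N := by positivity
      push_cast
      constructor <;> linarith [ih.1, ih.2, e1.1, e1.2, e2.1, e2.2]
  refine key.trans ?_
  have : (0 : ℝ) ≤ (4 * N + 6) / 2 ^ N := by positivity
  nlinarith

lemma cube_le_two_pow (J : ℕ) : (J : ℝ) ^ 3 ≤ 8 * 2 ^ J := by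
  have h : J ^ 3 ≤ 8 * 2 ^ J := by
    rcases lt_or_ge J 4 with h | h
    · interval_cases J <;> norm_num
    · induction J, h using Nat.le_induction with
      | base => norm_num
      | succ J hJ ih =>
        rw [pow_succ 2]
        nlinarith [Nat.mul_le_mul hJ hJ, Nat.mul_le_mul_left J hJ, Nat.mul_le_mul_left (J * J) hJ]
  exact_mod_cast h

/-- The fourth moment of a lacunary sum is at most of the order of the square of its length. -/
lemma fourth_waveSum_le (hpos : ∀ g : C(ℝ, ℝ), 0 ≤ g → 0 ≤ L g) (hC : 0 ≤ C)
    (hL : ∀ lo hi W g, 0 < lo → IsTrigSum lo hi W g → |L g| ≤ C * W / lo)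
    {a : ℕ → ℝ} (h1 : ∀ j, 4 * a j ≤ a (j + 1)) (h0 : ∀ j, 0 ≤ a j)
    (h2 : ∀ j, 2 ^ (j + 1) ≤ a (j + 1)) (J : ℕ) :
    L (waveSum a J ^ 4) ≤ (4 * L 1 + 200 * C) * J ^ 2 := by
  have h1' : ∀ j, 2 * a j ≤ a (j + 1) := fun j => by linarith [h1 j, h0 j]
  have hmono : ∀ g g' : C(ℝ, ℝ), (∀ t, g t ≤ g' t) → L g ≤ L g' := fun g g' h => by
    have := hpos (g' - g) (sub_nonneg.2 (ContinuousMap.le_def.2 h))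
    rw [map_sub] at this
    linarith
  have hL1 : 0 ≤ L 1 := hpos 1 (fun _ => zero_le_one)
  have hs : ∀ b t, sinWave b t ^ 2 ≤ 1 := fun b t => Real.sin_sq_le_one _
  induction J with
  | zero => simp [waveSum]
  | succ J ih =>
    set T := waveSum a J with hT
    set s := sinWave (a (J + 1)) with hs_def
    have hp : (0 : ℝ) < 2 ^ J := by positivity
    have ha := h2 J
    rw [pow_succ] at ha
    have hTt := isTrigSum_waveSum h1' h2 J
    have hJ0 : (0 : ℝ) ≤ J := J.cast_nonneg
    -- Ratio 4 keeps 3 a_J below a_{J+1}, leaving a frequency gap of at least 2^J / 2, and J³ ≤ 8 ·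
    -- 2^J absorbs the coefficient mass of T³.
    have e1 : |L (T ^ 3 * s)| ≤ 16 * C := by
      have hT3 := (hTt.mul (hTt.mul hTt)).mul
        (isTrigSum_sinWave (a (J + 1)))
      have hlo : (2 : ℝ) ^ J / 2 ≤ |a (J + 1)| - (a J + (a J + a J)) := by
        rw [abs_of_nonneg (by linarith)]
        linarith [h1 J]
      have h3 := hL _ _ _ _ (by positivity) (hT3.mono hlo le_rfl le_rfl)
      rw [show T ^ 3 * s = T * (T * T) * s by ring]
      refine h3.trans ?_
      rw [div_le_iff₀ (by positivity)]
      have := cube_le_two_pow J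
      nlinarith
    have e2 : |L (T * s ^ 3)| ≤ C := by
      have hs3 : IsTrigSum (a (J + 1)) (3 * a (J + 1)) 1 (s ^ 3) := by
        have ha0 : 0 ≤ a (J + 1) := by linarith
        rw [hs_def, sinWave_pow_three]
        refine (((isTrigSum_sinWave (a (J + 1))).smul (3 / 4)).mono (lo' := a (J + 1))
          (hi' := 3 * a (J + 1)) ?_ ?_ le_rfl).add
          (((isTrigSum_sinWave (3 * a (J + 1))).smul (-(1 / 4))).mono ?_ ?_ le_rfl) |>.mono
            le_rfl le_rfl ?_
        · rw [abs_of_nonneg ha0]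
        · rw [abs_of_nonneg ha0]; linarith
        · rw [abs_of_nonneg (by linarith)]; linarith
        · rw [abs_of_nonneg (by linarith)]
        · norm_num [abs_of_nonneg]
      have hlo : (2 : ℝ) ^ J ≤ a (J + 1) - a J := by linarith [h1' J]
      refine (hL _ _ _ _ hp ((hTt.mul hs3).mono hlo le_rfl le_rfl)).trans ?_
      rw [div_le_iff₀ hp, mul_one]
      gcongr
      exact_mod_cast J.lt_two_pow_self.le
    have e3 : L (T ^ 2 * s ^ 2) ≤ J / 2 * L 1 + 6 * C := by
      have h3 := (abs_le.1 (abs_sq_waveSum_sub_le hC hL h1' h2 J)).2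
      have h4 : L (T ^ 2 * s ^ 2) ≤ L (T ^ 2) := hmono _ _ fun t => by
        simp only [ContinuousMap.mul_apply, ContinuousMap.pow_apply]
        exact mul_le_of_le_one_right (sq_nonneg _) (hs _ _)
      linarith
    have e4 : L (s ^ 4) ≤ L 1 := hmono _ _ fun t => by
      simp only [ContinuousMap.pow_apply, ContinuousMap.one_apply]
      have := hs (a (J + 1)) t
      rw [show s t ^ 4 = s t ^ 2 * s t ^ 2 by ring]
      exact mul_le_one₀ this (sq_nonneg _) this
    have e5 : waveSum a (J + 1) ^ 4 = T ^ 4 + (4 : ℝ) • (T ^ 3 * s) + (6 : ℝ) • (T ^ 2 * s ^ 2)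
        + (4 : ℝ) • (T * s ^ 3) + s ^ 4 := by
      rw [waveSum_succ]
      ext t
      simp
      ring
    rw [e5]
    simp only [map_add, map_smul, smul_eq_mul]
    have e6 := (abs_le.1 e1).2
    have e7 := (abs_le.1 e2).2
    push_cast
    -- The increment is at most (3J + 1) L(1) + 104 C, which is below (4 L(1) + 200 C)((J + 1)² -
    -- J²).
    nlinarith [mul_nonneg hJ0 hC, mul_nonneg hJ0 hL1]

end Functional

/-- The fourth-moment estimate needs ratio 4, so the frequencies 2^k are split by the parity of k:
4^j = 2^{2j} and 4^j / 2 = 2^{2j-1}. -/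
lemma waveSum_two_pow_eq (N : ℕ) : waveSum (fun j => 2 ^ j) N
    = waveSum (fun j => 4 ^ j) (N / 2) + waveSum (fun j => 4 ^ j / 2) ((N + 1) / 2) := by
  induction N with
  | zero => simp [waveSum]
  | succ N ih =>
    rw [waveSum_succ, ih]
    rcases Nat.even_or_odd' N with ⟨M, rfl | rfl⟩
    · rw [show 2 * M / 2 = M by omega, show (2 * M + 1) / 2 = M by omega,
        show (2 * M + 1 + 1) / 2 = M + 1 by omega, waveSum_succ (fun j => 4 ^ j / 2), add_assoc]
      congr 3
      rw [pow_succ, pow_succ, pow_mul]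
      norm_num
      ring
    · rw [show (2 * M + 1) / 2 = M by omega, show (2 * M + 1 + 1) / 2 = M + 1 by omega,
        show (2 * M + 1 + 1 + 1) / 2 = M + 1 by omega, waveSum_succ (fun j => 4 ^ j),
        add_right_comm]
      congr 3
      rw [show 2 * M + 1 + 1 = 2 * (M + 1) by ring, pow_mul]
      norm_num

lemma waveSum_apply (N : ℕ) (t : ℝ) : waveSum (fun j => 2 ^ j) N t = lacunary N t := by
  simp [waveSum, lacunary, sinWave]

section Functional

variable {L : C(ℝ, ℝ) →ₗ[ℝ] ℝ} {C : ℝ}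

/-- The two halves E and O, each of length at most N, are recombined by (E + O)⁴ ≤ 8 (E⁴ + O⁴). -/
lemma fourth_waveSum_two_pow_le (hpos : ∀ g : C(ℝ, ℝ), 0 ≤ g → 0 ≤ L g) (hC : 0 ≤ C)
    (hL : ∀ lo hi W g, 0 < lo → IsTrigSum lo hi W g → |L g| ≤ C * W / lo) (N : ℕ) :
    L (waveSum (fun j => 2 ^ j) N ^ 4) ≤ 16 * (4 * L 1 + 200 * C) * N ^ 2 := by
  have hL1 : 0 ≤ L 1 := hpos 1 (fun _ => zero_le_one)
  have h24 : ∀ j : ℕ, (2 : ℝ) * 2 ^ (j + 1) ≤ 4 ^ (j + 1) := fun j => by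
    rw [← pow_succ', show (4 : ℝ) = 2 ^ 2 by norm_num, ← pow_mul]
    exact pow_le_pow_right₀ one_le_two (by omega)
  have e1 := fourth_waveSum_le hpos hC hL (a := fun j => 4 ^ j)
    (fun j => by rw [pow_succ]; linarith)
    (fun j => by positivity) (fun j => by
      have : (0 : ℝ) < 2 ^ (j + 1) := by positivity
      linarith [h24 j]) (N / 2)
  have e2 := fourth_waveSum_le hpos hC hL (a := fun j => 4 ^ j / 2)
    (fun j => by rw [pow_succ]; linarith) (fun j => by positivity)
    (fun j => by linarith [h24 j]) ((N + 1) / 2)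
  set E := waveSum (fun j => 4 ^ j) (N / 2)
  set O := waveSum (fun j => 4 ^ j / 2) ((N + 1) / 2)
  have e3 := hpos ((8 : ℝ) • (E ^ 4 + O ^ 4) - (E + O) ^ 4) (ContinuousMap.le_def.2 fun t => by
    simp only [ContinuousMap.zero_apply, ContinuousMap.sub_apply, ContinuousMap.smul_apply,
      ContinuousMap.add_apply, ContinuousMap.pow_apply, smul_eq_mul]
    nlinarith [sq_nonneg (E t - O t), sq_nonneg (E t + O t), sq_nonneg (E t ^ 2 - O t ^ 2),
      mul_nonneg (sq_nonneg (E t - O t)) (sq_nonneg (E t + O t)),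
      sq_nonneg ((E t - O t) ^ 2), sq_nonneg ((E t - O t) * (E t + O t))])
  rw [map_sub, map_smul, map_add, smul_eq_mul] at e3
  rw [waveSum_two_pow_eq]
  have hK : 0 ≤ 4 * L 1 + 200 * C := by positivity
  have hN1 : ((N / 2 : ℕ) : ℝ) ≤ N := by exact_mod_cast Nat.div_le_self N 2
  have hN2 : (((N + 1) / 2 : ℕ) : ℝ) ≤ N := by
    exact_mod_cast (by omega : (N + 1) / 2 ≤ N)
  have hq1 : ((N / 2 : ℕ) : ℝ) ^ 2 ≤ (N : ℝ) ^ 2 := by gcongr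
  have hq2 : (((N + 1) / 2 : ℕ) : ℝ) ^ 2 ≤ (N : ℝ) ^ 2 := by gcongr
  have := mul_le_mul_of_nonneg_left hq1 hK
  have := mul_le_mul_of_nonneg_left hq2 hK
  linarith

lemma abs_sq_waveSum_two_pow_sub_le (hC : 0 ≤ C)
    (hL : ∀ lo hi W g, 0 < lo → IsTrigSum lo hi W g → |L g| ≤ C * W / lo) (N : ℕ) :
    |L (waveSum (fun j => 2 ^ j) N ^ 2) - N / 2 * L 1| ≤ 6 * C :=
  abs_sq_waveSum_sub_le hC hL (fun j => by rw [pow_succ]; linarith) (fun j => le_rfl) N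

/-- The absolute value of a continuous function. -/
noncomputable def absC (g : C(ℝ, ℝ)) : C(ℝ, ℝ) := ⟨fun t => |g t|, by fun_prop⟩

/-- The first moment of a lacunary sum is at least of the order of the square root of its
length. -/
lemma exists_sqrt_le_abs_waveSum (hpos : ∀ g : C(ℝ, ℝ), 0 ≤ g → 0 ≤ L g) (hC : 0 ≤ C)
    (hL : ∀ lo hi W g, 0 < lo → IsTrigSum lo hi W g → |L g| ≤ C * W / lo) (h1 : 0 < L 1) :
    ∃ c : ℝ, 0 < c ∧ ∃ N₀ : ℕ, ∀ N ≥ N₀, c * √N ≤ L (absC (waveSum (fun j => 2 ^ j) N)) := by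
  set m := L 1 with hm
  set K := 16 * (4 * m + 200 * C) with hK
  have hK0 : 0 < K := by positivity
  -- With threshold μ√N the quartic term below is at most mN / 8; N₀ makes the error 6C at most mN /
  -- 8 too. Of the second moment mN / 2 at least mN / 4 is left.
  set μ := √(8 * K / m) with hμ
  have hμ0 : 0 < μ := Real.sqrt_pos.2 (by positivity)
  have hμ2 : μ ^ 2 = 8 * K / m := Real.sq_sqrt (by positivity)
  obtain ⟨N₀, hN₀⟩ := exists_nat_ge (48 * C / m)
  refine ⟨m / (4 * μ), by positivity, N₀ + 1, fun N hN => ?_⟩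
  have hNN : (N₀ : ℝ) + 1 ≤ N := by exact_mod_cast hN
  have hNpos : (0 : ℝ) < N := by linarith [N₀.cast_nonneg (α := ℝ)]
  set S := waveSum (fun j => 2 ^ j) N
  have hl : 0 < μ * √N := by positivity
  have hl2 : (μ * √N) ^ 2 = 8 * K / m * N := by rw [mul_pow, hμ2, Real.sq_sqrt hNpos.le]
  -- Pointwise x² ≤ l x + x⁴ / l² for x ≥ 0: the first term suffices when x ≤ l, the second when x ≥
  -- l.
  have e1 := hpos ((μ * √N) • absC S + ((μ * √N) ^ 2)⁻¹ • S ^ 4 - S ^ 2)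
    (ContinuousMap.le_def.2 fun t => by
      simp only [ContinuousMap.zero_apply, ContinuousMap.sub_apply, ContinuousMap.smul_apply,
        ContinuousMap.add_apply, ContinuousMap.pow_apply, smul_eq_mul, absC, ContinuousMap.coe_mk]
      rw [← sq_abs (S t), show S t ^ 4 = |S t| ^ 4 by rw [show 4 = 2 * 2 from rfl, pow_mul, pow_mul,
        sq_abs]]
      have hx := abs_nonneg (S t)
      generalize |S t| = x at hx
      generalize μ * √N = l at hl
      rcases le_total x l with h | h
      · have : 0 ≤ (l ^ 2)⁻¹ * x ^ 4 := by positivity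
        nlinarith
      · have h3 : x ^ 2 ≤ (l ^ 2)⁻¹ * x ^ 4 := by
          rw [inv_mul_eq_div, le_div_iff₀ (by positivity)]
          have : l ^ 2 ≤ x ^ 2 := by gcongr
          nlinarith [sq_nonneg x]
        have : 0 ≤ l * x := by positivity
        linarith)
  rw [map_sub, map_add, map_smul, map_smul, smul_eq_mul, smul_eq_mul, hl2] at e1
  have e2 := fourth_waveSum_two_pow_le hpos hC hL N
  have e3 := (abs_le.1 (abs_sq_waveSum_two_pow_sub_le hC hL N)).1
  rw [← hm] at e2 e3
  have e4 : (8 * K / m * N)⁻¹ * L (S ^ 4) ≤ m * N / 8 := by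
    calc _ ≤ (8 * K / m * N)⁻¹ * (K * N ^ 2) := by gcongr
      _ = _ := by field_simp
  have e5 : 6 * C ≤ m * N / 8 := by
    rw [div_le_iff₀ h1] at hN₀
    nlinarith
  have e6 : m * N / 4 ≤ μ * √N * L (absC S) := by linarith
  have hs : √(N : ℝ) * √N = N := Real.mul_self_sqrt hNpos.le
  have hs0 : 0 < √(N : ℝ) := Real.sqrt_pos.2 hNpos
  rw [div_mul_eq_mul_div, div_le_iff₀ (by positivity)]
  refine le_of_mul_le_mul_right ?_ hs0
  calc m * √N * √N = m * N := by rw [mul_assoc, hs]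
    _ ≤ 4 * (μ * √N * L (absC S)) := by linarith
    _ = _ := by ring

end Functional

/-! ### Weighted norms of lacunary sums on ℝⁿ -/

section Testing

variable {n : ℕ} [NeZero n]

lemma continuous_coord : Continuous fun x : Rn n => x 0 :=
  (EuclideanSpace.proj (𝕜 := ℝ) (0 : Fin n)).continuous

lemma integrable_mul_comp_coord {η : Rn n → ℝ} (hη : Continuous η) (hs : HasCompactSupport η)
    (g : C(ℝ, ℝ)) : Integrable fun x : Rn n => η x * g (x 0) :=
  (hη.mul (g.continuous.comp continuous_coord)).integrable_of_hasCompactSupport hs.mul_right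

/-- Integration of a function of the first coordinate against a compactly supported weight. -/
noncomputable def testFunctional (η : Rn n → ℝ) (hη : Continuous η) (hs : HasCompactSupport η) :
    C(ℝ, ℝ) →ₗ[ℝ] ℝ where
  toFun g := ∫ x, η x * g (x 0)
  map_add' g g' := by
    rw [← integral_add (integrable_mul_comp_coord hη hs g) (integrable_mul_comp_coord hη hs g')]
    simp [mul_add]
  map_smul' c g := by
    rw [RingHom.id_apply, smul_eq_mul, ← integral_const_mul]
    simp [mul_left_comm]

/-- The integral is the Fourier transform of η at the point -q on the first axis, and that transform
is a Schwartz function. -/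
lemma exists_norm_integral_mul_exp_le {η : Rn n → ℝ} (hη : ContDiff ℝ ∞ η)
    (hs : HasCompactSupport η) : ∃ C : ℝ, 0 ≤ C ∧ ∀ q : ℝ, q ≠ 0 →
      ‖∫ x : Rn n, (η x : ℂ) * Complex.exp (2 * Real.pi * q * x 0 * Complex.I)‖ ≤ C / |q| := by
  have hs' : HasCompactSupport fun x => (η x : ℂ) := hs.comp_left Complex.ofReal_zero
  set H : 𝓢(Rn n, ℂ) := hs'.toSchwartzMap (Complex.ofRealCLM.contDiff.comp hη) with hH
  obtain ⟨C, hC, h⟩ := (𝓕 H).decay 1 0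
  refine ⟨C, hC.le, fun q hq => ?_⟩
  have h1 := h (EuclideanSpace.single 0 (-q))
  simp only [pow_one, norm_iteratedFDeriv_zero, PiLp.norm_single, norm_neg,
    Real.norm_eq_abs] at h1
  rw [le_div_iff₀ (abs_pos.2 hq), mul_comm]
  refine le_of_eq_of_le ?_ h1
  rw [SchwartzMap.fourier_coe, Real.fourier_eq']
  congr 2
  refine integral_congr_ae (Filter.Eventually.of_forall fun x => ?_)
  simp only [EuclideanSpace.inner_single_right, smul_eq_mul]
  rw [mul_comm]
  congr 1
  congr 1
  simp
  ring

lemma exists_abs_testFunctional_le {η : Rn n → ℝ} (hη : ContDiff ℝ ∞ η)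
    (hs : HasCompactSupport η) : ∃ C : ℝ, 0 ≤ C ∧ ∀ lo hi W g, 0 < lo → IsTrigSum lo hi W g →
      |testFunctional η hη.continuous hs g| ≤ C * W / lo := by
  obtain ⟨C, hC, h⟩ := exists_norm_integral_mul_exp_le hη hs
  refine ⟨C, hC, fun lo hi W g hlo hg => ?_⟩
  obtain ⟨ι, _, q, c, hq, hc, hg⟩ := hg
  have h1 : ((testFunctional η hη.continuous hs g : ℝ) : ℂ)
      = ∑ i, c i * ∫ x : Rn n, (η x : ℂ) * Complex.exp (2 * Real.pi * q i * x 0 * Complex.I) := by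
    change ((∫ x, η x * g (x 0) : ℝ) : ℂ) = _
    rw [← integral_complex_ofReal]
    simp_rw [← integral_const_mul]
    rw [← integral_finsetSum]
    · refine integral_congr_ae (Filter.Eventually.of_forall fun x => ?_)
      simp only [Complex.ofReal_mul, hg, Finset.mul_sum]
      refine Finset.sum_congr rfl fun i _ => ?_
      ring
    · intro i _
      refine Integrable.const_mul ?_ _
      refine Continuous.integrable_of_hasCompactSupport ?_ ?_
      · have := hη.continuous
        have := continuous_coord (n := n)
        fun_prop
      · exact (hs.comp_left Complex.ofReal_zero).mul_right
  rw [← Real.norm_eq_abs, ← Complex.norm_real, h1]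
  refine (norm_sum_le _ _).trans ?_
  calc _ ≤ ∑ i, ‖c i‖ * (C / lo) := by
        refine Finset.sum_le_sum fun i _ => ?_
        rw [norm_mul]
        have hqi : 0 < |q i| := hlo.trans_le (hq i).1
        gcongr
        refine (h (q i) (abs_pos.1 hqi)).trans ?_
        gcongr
        exact (hq i).1
    _ ≤ W * (C / lo) := by
        rw [← Finset.sum_mul]
        gcongr
    _ = _ := by ring

/-- The weighted `L²` norm of a lacunary sum. -/
lemma exists_integral_mul_sq_lacunary_le {η : Rn n → ℝ} (hη : ContDiff ℝ ∞ η)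
    (hs : HasCompactSupport η) :
    ∃ C : ℝ, 0 ≤ C ∧ ∀ N : ℕ, 1 ≤ N → ∫ x : Rn n, η x * lacunary N (x 0) ^ 2 ≤ C * N := by
  obtain ⟨C, hC, hL⟩ := exists_abs_testFunctional_le hη hs
  refine ⟨|testFunctional η hη.continuous hs 1| + 6 * C, by positivity, fun N hN => ?_⟩
  have h := (abs_le.1 (abs_sq_waveSum_two_pow_sub_le hC hL N)).2
  have h2 : testFunctional η hη.continuous hs (waveSum (fun j => 2 ^ j) N ^ 2)
      = ∫ x : Rn n, η x * lacunary N (x 0) ^ 2 := by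
    simp [testFunctional, waveSum_apply]
  rw [← h2]
  have hN' : (1 : ℝ) ≤ N := by exact_mod_cast hN
  have h3 := le_abs_self (testFunctional η hη.continuous hs 1)
  have h4 := abs_nonneg (testFunctional η hη.continuous hs 1)
  nlinarith [mul_le_mul_of_nonneg_left h3 (by positivity : (0 : ℝ) ≤ N / 2)]

/-- At t = 2^{-(N+2)} every phase 2π 2^k t with k ≤ N lies in (0, π/2], so all sines are positive.
-/
lemma lacunary_pos {N : ℕ} (hN : 1 ≤ N) : 0 < lacunary N (1 / 2 ^ (N + 2)) := by
  refine Finset.sum_pos (fun k hk => ?_) ⟨1, Finset.mem_Icc.2 ⟨le_rfl, hN⟩⟩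
  refine Real.sin_pos_of_pos_of_lt_pi (by positivity) ?_
  have h1 : (2 : ℝ) ^ k ≤ 2 ^ N := pow_le_pow_right₀ one_le_two (Finset.mem_Icc.1 hk).2
  have h2 : (0 : ℝ) < 2 ^ N := by positivity
  rw [mul_one_div, div_lt_iff₀ (by positivity), pow_add]
  nlinarith [Real.pi_pos, mul_le_mul_of_nonneg_left h1 Real.pi_pos.le, mul_pos Real.pi_pos h2]

lemma continuous_lacunary (N : ℕ) : Continuous (lacunary N) := by
  unfold lacunary
  fun_prop

/-- The weighted `L¹` norm of a lacunary sum. -/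
lemma exists_sqrt_le_integral_mul_abs_lacunary {η : Rn n → ℝ} (hη : ContDiff ℝ ∞ η)
    (hs : HasCompactSupport η) (h0 : ∀ x, 0 ≤ η x) (h1 : ∀ x ∈ ball (0 : Rn n) (1 / 4), 0 < η x) :
    ∃ c : ℝ, 0 < c ∧ ∀ N : ℕ, 1 ≤ N → c * √N ≤ ∫ x : Rn n, η x * |lacunary N (x 0)| := by
  obtain ⟨C, hC, hL⟩ := exists_abs_testFunctional_le hη hs
  have hpos : ∀ g : C(ℝ, ℝ), 0 ≤ g → 0 ≤ testFunctional η hη.continuous hs g := fun g hg =>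
    integral_nonneg fun x => mul_nonneg (h0 x) (hg (x 0))
  have hstrict : ∀ g : C(ℝ, ℝ), 0 ≤ g → (∃ t, 0 ≤ t ∧ t < 1 / 4 ∧ g t ≠ 0) →
      0 < testFunctional η hη.continuous hs g := by
    rintro g hg ⟨t, ht0, ht, hgt⟩
    refine Continuous.integral_pos_of_hasCompactSupport_nonneg_nonzero
      (x := EuclideanSpace.single 0 t)
      (hη.continuous.mul (g.continuous.comp continuous_coord)) hs.mul_right
      (fun x => mul_nonneg (h0 x) (hg (x 0))) ?_
    refine mul_ne_zero (h1 _ ?_).ne' (by simpa using hgt)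
    rw [mem_ball_zero_iff, PiLp.norm_single, Real.norm_of_nonneg ht0]
    exact ht
  obtain ⟨c, hc, N₀, hN₀⟩ := exists_sqrt_le_abs_waveSum hpos hC hL
    (hstrict 1 (fun _ => zero_le_one) ⟨0, le_rfl, by norm_num, by simp⟩)
  have hT : ∀ N, testFunctional η hη.continuous hs (absC (waveSum (fun j => 2 ^ j) N))
      = ∫ x : Rn n, η x * |lacunary N (x 0)| := by
    intro N
    simp [testFunctional, absC, waveSum_apply]
  -- The moment argument covers only N ≥ N₀. The finitely many remaining N are handled by the
  -- minimum of positive integrals.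
  have hsmall : ∀ M : ℕ, ∃ c : ℝ, 0 < c ∧ ∀ N, 1 ≤ N → N ≤ M →
      c * √N ≤ ∫ x : Rn n, η x * |lacunary N (x 0)| := by
    intro M
    induction M with
    | zero => exact ⟨1, one_pos, fun N h h' => by omega⟩
    | succ M ih =>
      obtain ⟨d, hd, h⟩ := ih
      have hM : 0 < ∫ x : Rn n, η x * |lacunary (M + 1) (x 0)| := by
        rw [← hT]
        refine hstrict _ (fun t => abs_nonneg _) ⟨1 / 2 ^ (M + 1 + 2), by positivity, ?_, ?_⟩
        · rw [pow_succ, pow_succ, pow_succ]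
          rw [div_lt_div_iff₀ (by positivity) (by norm_num)]
          have : (1 : ℝ) ≤ 2 ^ M := one_le_pow₀ one_le_two
          linarith
        · simp only [absC, ContinuousMap.coe_mk, waveSum_apply]
          exact abs_ne_zero.2 (lacunary_pos (by omega)).ne'
      have hsq : 0 < √((M + 1 : ℕ) : ℝ) := Real.sqrt_pos.2 (by positivity)
      refine ⟨min d ((∫ x : Rn n, η x * |lacunary (M + 1) (x 0)|) / √((M + 1 : ℕ) : ℝ)),
        lt_min hd (div_pos hM hsq), fun N hN hN' => ?_⟩
      rcases Nat.lt_or_ge N (M + 1) with hlt | hge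
      · refine le_trans ?_ (h N hN (by omega))
        gcongr
        exact min_le_left _ _
      · obtain rfl : N = M + 1 := by omega
        rw [← le_div_iff₀ hsq]
        exact min_le_right _ _
  obtain ⟨d, hd, hd'⟩ := hsmall N₀
  refine ⟨min c d, lt_min hc hd, fun N hN => ?_⟩
  rcases le_total N N₀ with h | h
  · refine le_trans ?_ (hd' N hN h)
    gcongr
    exact min_le_right _ _
  · rw [← hT]
    refine le_trans ?_ (hN₀ N h)
    gcongr
    exact min_le_left _ _

end Testing

/-! ### Frequency-side bounds for the cut-off lacunary sums -/

section Upper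

variable {n : ℕ}

/-- A function is bounded by the L¹ norm of its Fourier transform, and convolution becomes
multiplication there. -/
lemma norm_conv_fourierInv_le (W σ : 𝓢(Rn n, ℂ)) (x : Rn n) :
    ‖conv W (𝓕⁻ σ : 𝓢(Rn n, ℂ)) x‖ ≤ ∫ ξ, ‖𝓕 (W : Rn n → ℂ) ξ‖ * ‖σ ξ‖ := by
  have h1 : conv W (𝓕⁻ σ : 𝓢(Rn n, ℂ)) x
      = SchwartzMap.convolution (ContinuousLinearMap.mul ℂ ℂ) W (𝓕⁻ σ) x := by
    rw [SchwartzMap.convolution_apply, conv]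
  have h2 : SchwartzMap.convolution (ContinuousLinearMap.mul ℂ ℂ) W (𝓕⁻ σ)
      = 𝓕⁻ (𝓕 (SchwartzMap.convolution (ContinuousLinearMap.mul ℂ ℂ) W (𝓕⁻ σ))) := by simp
  rw [h1, h2, SchwartzMap.fourierInv_coe, Real.fourierInv_eq', SchwartzMap.fourier_convolution]
  refine (norm_integral_le_integral_norm _).trans_eq ?_
  refine integral_congr_ae (Filter.Eventually.of_forall fun ξ => ?_)
  simp [Complex.norm_exp, SchwartzMap.fourier_coe]

/-- Dilation only relabels frequencies in an L¹ norm of the transform, so f_N can be replaced by F_N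
with rescaled symbols. -/
lemma integral_norm_fourier_dilate (G : Rn n → ℂ) (s : Rn n → ℝ) {R : ℝ} (hR : 0 < R) :
    ∫ ξ, ‖𝓕 (fun x => G (R • x)) ξ‖ * s ξ = ∫ ξ, ‖𝓕 G ξ‖ * s (R • ξ) := by
  rw [← integral_dilate _ hR]
  refine integral_congr_ae (Filter.Eventually.of_forall fun ξ => ?_)
  have h : R ^ n • 𝓕 (fun x => G (R • x)) (R • ξ) = 𝓕 G ξ := by
    rw [Real.fourier_eq', Real.fourier_eq', ← integral_smul,
      ← integral_dilate (fun x => Complex.exp (↑(-2 * Real.pi * inner ℝ x ξ) * Complex.I) • G x) hR]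
    refine integral_congr_ae (Filter.Eventually.of_forall fun x => ?_)
    simp only [inner_smul_left, inner_smul_right, conj_trivial]
  simp only [smul_eq_mul]
  rw [← h, norm_smul, norm_pow, Real.norm_of_nonneg hR.le, mul_assoc]

/-- The contribution of one frequency to a Littlewood–Paley piece with symbol `τ`. -/
lemma integral_norm_translate_mul_le (H : 𝓢(Rn n, ℂ)) {τ : Rn n → ℝ} (hτm : Continuous τ)
    (hτ0 : ∀ ξ, 0 ≤ τ ξ) (hτ1 : ∀ ξ, τ ξ ≤ 1) {v : Rn n} {ρ ε : ℝ} (hρ : 0 < ρ) (hε : 0 ≤ ε)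
    (h : (∀ ξ, τ ξ ≠ 0 → ρ ≤ ‖ξ - v‖) ∨ 1 ≤ ε) :
    Integrable (fun ξ => ‖H (ξ - v)‖ * τ ξ) ∧ ∫ ξ, ‖H (ξ - v)‖ * τ ξ
      ≤ ρ⁻¹ * (∫ ξ, ‖ξ‖ * ‖H ξ‖) + ε * ∫ ξ, ‖H ξ‖ := by
  have hi0 : Integrable fun ξ => ‖H (ξ - v)‖ := (H.integrable.comp_sub_right v).norm
  have hi1 : Integrable fun ξ => ‖ξ‖ * ‖H ξ‖ := by simpa using H.integrable_pow_mul volume 1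
  have hint : Integrable (fun ξ => ‖H (ξ - v)‖ * τ ξ) := by
    refine hi0.mono' (by fun_prop) (Filter.Eventually.of_forall fun ξ => ?_)
    rw [Real.norm_of_nonneg (mul_nonneg (norm_nonneg _) (hτ0 ξ))]
    exact mul_le_of_le_one_right (norm_nonneg _) (hτ1 ξ)
  refine ⟨hint, ?_⟩
  have p0 : 0 ≤ ∫ ξ, ‖ξ‖ * ‖H ξ‖ := by positivity
  have p1 : 0 ≤ ∫ ξ, ‖H ξ‖ := by positivity
  rcases h with h | h
  · calc _ ≤ ∫ ξ, ρ⁻¹ * (‖ξ - v‖ * ‖H (ξ - v)‖) := by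
          refine integral_mono hint ((hi1.comp_sub_right v).const_mul _) fun ξ => ?_
          simp only
          by_cases hξ : τ ξ = 0
          · rw [hξ, mul_zero]; positivity
          · calc ‖H (ξ - v)‖ * τ ξ ≤ ‖H (ξ - v)‖ * 1 := by gcongr; exact hτ1 ξ
              _ = ρ⁻¹ * (ρ * ‖H (ξ - v)‖) := by field_simp
              _ ≤ _ := by gcongr; exact h ξ hξ
      _ = ρ⁻¹ * ∫ ξ, ‖ξ‖ * ‖H ξ‖ := by
          rw [integral_const_mul, integral_sub_right_eq_self (fun ξ => ‖ξ‖ * ‖H ξ‖)]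
      _ ≤ _ := by
          have : 0 ≤ ε * ∫ ξ, ‖H ξ‖ := by positivity
          linarith
  · calc _ ≤ ∫ ξ, ‖H (ξ - v)‖ := integral_mono hint hi0 fun ξ =>
          mul_le_of_le_one_right (norm_nonneg _) (hτ1 ξ)
      _ = ∫ ξ, ‖H ξ‖ := integral_sub_right_eq_self (fun ξ => ‖H ξ‖) v
      _ ≤ _ := by
          have : 0 ≤ ρ⁻¹ * ∫ ξ, ‖ξ‖ * ‖H ξ‖ := by positivity
          nlinarith

lemma sum_two_div_two_pow_le (N : ℕ) : ∑ k ∈ Finset.Icc 1 N, ((2 : ℝ) ^ k / 2)⁻¹ ≤ 2 := by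
  have h : ∑ k ∈ Finset.Icc 1 N, ((2 : ℝ) ^ k / 2)⁻¹ = 2 - 2 / 2 ^ N := by
    induction N with
    | zero => simp
    | succ N ih =>
      rw [Finset.sum_Icc_succ_top (by omega), ih, pow_succ]
      field_simp
      ring
  rw [h]
  have : (0 : ℝ) < 2 / 2 ^ N := by positivity
  linarith

variable [NeZero n]

lemma fourier_modulate (ψ : Rn n → ℝ) (q : ℝ) (ξ : Rn n) :
    𝓕 (fun x : Rn n => (ψ x : ℂ) * Complex.exp (2 * Real.pi * q * x 0 * Complex.I)) ξ
      = 𝓕 (fun x : Rn n => (ψ x : ℂ)) (ξ - EuclideanSpace.single 0 q) := by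
  rw [Real.fourier_eq', Real.fourier_eq']
  refine integral_congr_ae (Filter.Eventually.of_forall fun x => ?_)
  simp only [inner_sub_right, EuclideanSpace.inner_single_right, smul_eq_mul]
  rw [mul_left_comm, ← Complex.exp_add, mul_comm]
  congr 2
  simp
  ring

lemma integrable_fourier_modulate {ψ : Rn n → ℝ} (hψ : Continuous ψ) (hs : HasCompactSupport ψ)
    (ξ : Rn n) (q : ℝ) : Integrable fun x : Rn n =>
      Complex.exp (↑(-2 * Real.pi * inner ℝ x ξ) * Complex.I) •
        ((ψ x : ℂ) * Complex.exp (2 * Real.pi * q * x 0 * Complex.I)) := by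
  simp only [smul_eq_mul]
  refine Continuous.integrable_of_hasCompactSupport ?_ ?_
  · have h1 : Continuous fun x : Rn n => x 0 := continuous_coord
    have h2 : Continuous fun x : Rn n => (inner ℝ x ξ : ℝ) := continuous_id.inner continuous_const
    have h3 : Continuous fun x : Rn n => (ψ x : ℂ) := Complex.continuous_ofReal.comp hψ
    refine Continuous.mul (Complex.continuous_exp.comp ?_) (h3.mul (Complex.continuous_exp.comp ?_))
    · exact (Complex.continuous_ofReal.comp (continuous_const.mul h2)).mul continuous_const
    · exact (continuous_const.mul (Complex.continuous_ofReal.comp h1)).mul continuous_const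
  · have h4 : HasCompactSupport fun x : Rn n => (ψ x : ℂ) := hs.comp_left Complex.ofReal_zero
    exact HasCompactSupport.mul_left (HasCompactSupport.mul_right h4)

lemma norm_fourier_cutLacunary_le {ψ : Rn n → ℝ} (hψ : Continuous ψ) (hs : HasCompactSupport ψ)
    (N : ℕ) (ξ : Rn n) :
    ‖𝓕 (cutLacunary ψ N) ξ‖ ≤ ∑ k ∈ Finset.Icc 1 N,
      (‖𝓕 (fun x : Rn n => (ψ x : ℂ)) (ξ - EuclideanSpace.single 0 (2 ^ k))‖
        + ‖𝓕 (fun x : Rn n => (ψ x : ℂ)) (ξ - EuclideanSpace.single 0 (-(2 ^ k)))‖) := by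
  have h1 : cutLacunary ψ N = fun x => ∑ k ∈ Finset.Icc 1 N, (Complex.I / 2) *
      ((ψ x : ℂ) * Complex.exp (2 * Real.pi * (-(2 ^ k) : ℝ) * x 0 * Complex.I)
        - (ψ x : ℂ) * Complex.exp (2 * Real.pi * (2 ^ k : ℝ) * x 0 * Complex.I)) := by
    funext x
    simp only [cutLacunary, lacunary, Complex.ofReal_mul, Complex.ofReal_sum, Complex.ofReal_sin,
      Finset.mul_sum, Complex.sin]
    refine Finset.sum_congr rfl fun k _ => ?_
    push_cast
    ring_nf
  set G : ℝ → Rn n → ℂ := fun q x => Complex.exp (↑(-2 * Real.pi * inner ℝ x ξ) * Complex.I) •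
    ((ψ x : ℂ) * Complex.exp (2 * Real.pi * q * x 0 * Complex.I)) with hG
  have hint : ∀ q : ℝ, Integrable (G q) := integrable_fourier_modulate hψ hs ξ
  have hF : ∀ q : ℝ, 𝓕 (fun x : Rn n => (ψ x : ℂ)) (ξ - EuclideanSpace.single 0 q)
      = ∫ x, G q x := fun q => by
    rw [← fourier_modulate, Real.fourier_eq']
  have hpt : ∀ x, Complex.exp (↑(-2 * Real.pi * inner ℝ x ξ) * Complex.I) • cutLacunary ψ N x
      = ∑ k ∈ Finset.Icc 1 N, (Complex.I / 2) * (G (-(2 ^ k)) x - G (2 ^ k) x) := by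
    intro x
    rw [h1, Finset.smul_sum]
    refine Finset.sum_congr rfl fun k _ => ?_
    simp only [hG, smul_eq_mul]
    ring
  have h2 : 𝓕 (cutLacunary ψ N) ξ = ∑ k ∈ Finset.Icc 1 N, (Complex.I / 2) *
      (𝓕 (fun x : Rn n => (ψ x : ℂ)) (ξ - EuclideanSpace.single 0 (-(2 ^ k)))
        - 𝓕 (fun x : Rn n => (ψ x : ℂ)) (ξ - EuclideanSpace.single 0 (2 ^ k))) := by
    have hk : ∀ k ∈ Finset.Icc 1 N, Integrable fun x =>
        (Complex.I / 2) * (G (-(2 ^ k)) x - G (2 ^ k) x) := fun k _ =>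
      ((hint (-(2 ^ k))).sub (hint (2 ^ k))).const_mul (Complex.I / 2)
    rw [Real.fourier_eq', integral_congr_ae (Filter.Eventually.of_forall hpt),
      integral_finsetSum _ hk]
    refine Finset.sum_congr rfl fun k _ => ?_
    rw [hF, hF, integral_const_mul, integral_sub (hint _) (hint _)]
  rw [h2]
  refine (norm_sum_le _ _).trans (Finset.sum_le_sum fun k _ => ?_)
  rw [norm_mul]
  have h3 : ‖Complex.I / 2‖ ≤ 1 := by simp; norm_num
  calc _ ≤ 1 * ‖𝓕 (fun x : Rn n => (ψ x : ℂ)) (ξ - EuclideanSpace.single 0 (-(2 ^ k)))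
        - 𝓕 (fun x : Rn n => (ψ x : ℂ)) (ξ - EuclideanSpace.single 0 (2 ^ k))‖ := by gcongr
    _ ≤ _ := by
        rw [one_mul, add_comm]
        exact norm_sub_le _ _

/-- A frequency ±2^k far from the support of τ contributes a multiple of 2^{-k}, by the first moment
of the transform of ψ. The weights ε are a soft indicator of the frequencies near the support, and
the bound on their sum limits how many there are. -/
lemma exists_integral_fourier_cutLacunary_le {ψ : Rn n → ℝ} (hψ : ContDiff ℝ ∞ ψ)
    (hs : HasCompactSupport ψ) :
    ∃ C : ℝ, 0 ≤ C ∧ ∀ (N : ℕ) (τ : Rn n → ℝ), Continuous τ → (∀ ξ, 0 ≤ τ ξ) → (∀ ξ, τ ξ ≤ 1) →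
      ∀ ε : ℕ → ℝ, (∀ k, 0 ≤ ε k) → (∑ k ∈ Finset.Icc 1 N, ε k ≤ 36) →
      (∀ k, 1 ≤ k → ∀ q : ℝ, |q| = 2 ^ k →
        (∀ ξ, τ ξ ≠ 0 → (2 : ℝ) ^ k / 2 ≤ ‖ξ - EuclideanSpace.single 0 q‖) ∨ 1 ≤ ε k) →
      ∫ ξ, ‖𝓕 (cutLacunary ψ N) ξ‖ * τ ξ ≤ C := by
  have hs' : HasCompactSupport fun x => (ψ x : ℂ) := hs.comp_left Complex.ofReal_zero
  set P : 𝓢(Rn n, ℂ) := hs'.toSchwartzMap (Complex.ofRealCLM.contDiff.comp hψ) with hP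
  set H : 𝓢(Rn n, ℂ) := 𝓕 P with hH
  have hHP : ∀ ξ, 𝓕 (fun x : Rn n => (ψ x : ℂ)) ξ = H ξ := fun ξ => by
    rw [hH, SchwartzMap.fourier_coe]; rfl
  set A₀ := ∫ ξ, ‖H ξ‖
  set A₁ := ∫ ξ, ‖ξ‖ * ‖H ξ‖
  have p0 : 0 ≤ A₀ := by positivity
  have p1 : 0 ≤ A₁ := by positivity
  refine ⟨2 * (2 * A₁ + 36 * A₀), by positivity, fun N τ hτm hτ0 hτ1 ε hε hε' h => ?_⟩
  have hk : ∀ k, 1 ≤ k → ∀ q : ℝ, |q| = 2 ^ k →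
      Integrable (fun ξ => ‖H (ξ - EuclideanSpace.single 0 q)‖ * τ ξ) ∧
      ∫ ξ, ‖H (ξ - EuclideanSpace.single 0 q)‖ * τ ξ ≤ ((2 : ℝ) ^ k / 2)⁻¹ * A₁ + ε k * A₀ :=
    fun k hk q hq =>
      integral_norm_translate_mul_le H hτm hτ0 hτ1 (by positivity) (hε k) (h k hk q hq)
  have q1 : ∀ k : ℕ, |(2 : ℝ) ^ k| = 2 ^ k := fun k => abs_of_pos (by positivity)
  have q2 : ∀ k : ℕ, |-((2 : ℝ) ^ k)| = 2 ^ k := fun k => by rw [abs_neg, q1]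
  have hsum : ∀ k ∈ Finset.Icc 1 N, Integrable fun ξ =>
      ‖H (ξ - EuclideanSpace.single 0 (2 ^ k))‖ * τ ξ
      + ‖H (ξ - EuclideanSpace.single 0 (-(2 ^ k)))‖ * τ ξ := fun k hk' =>
    (hk k (Finset.mem_Icc.1 hk').1 _ (q1 k)).1.add (hk k (Finset.mem_Icc.1 hk').1 _ (q2 k)).1
  calc _ ≤ ∫ ξ, ∑ k ∈ Finset.Icc 1 N, (‖H (ξ - EuclideanSpace.single 0 (2 ^ k))‖ * τ ξ
        + ‖H (ξ - EuclideanSpace.single 0 (-(2 ^ k)))‖ * τ ξ) := by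
        refine integral_mono_of_nonneg (Filter.Eventually.of_forall fun ξ =>
          mul_nonneg (norm_nonneg _) (hτ0 ξ)) (integrable_finsetSum _ hsum)
          (Filter.Eventually.of_forall fun ξ => ?_)
        simp only [← add_mul, ← Finset.sum_mul]
        have := norm_fourier_cutLacunary_le hψ.continuous hs N ξ
        simp only [hHP] at this
        exact mul_le_mul_of_nonneg_right this (hτ0 ξ)
    _ = ∑ k ∈ Finset.Icc 1 N, ((∫ ξ, ‖H (ξ - EuclideanSpace.single 0 (2 ^ k))‖ * τ ξ)
        + ∫ ξ, ‖H (ξ - EuclideanSpace.single 0 (-(2 ^ k)))‖ * τ ξ) := by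
        rw [integral_finsetSum _ hsum]
        refine Finset.sum_congr rfl fun k hk' => ?_
        exact integral_add (hk k (Finset.mem_Icc.1 hk').1 _ (q1 k)).1
          (hk k (Finset.mem_Icc.1 hk').1 _ (q2 k)).1
    _ ≤ ∑ k ∈ Finset.Icc 1 N, 2 * (((2 : ℝ) ^ k / 2)⁻¹ * A₁ + ε k * A₀) := by
        refine Finset.sum_le_sum fun k hk' => ?_
        linarith [(hk k (Finset.mem_Icc.1 hk').1 _ (q1 k)).2,
          (hk k (Finset.mem_Icc.1 hk').1 _ (q2 k)).2]
    _ = 2 * ((∑ k ∈ Finset.Icc 1 N, ((2 : ℝ) ^ k / 2)⁻¹) * A₁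
        + (∑ k ∈ Finset.Icc 1 N, ε k) * A₀) := by
        rw [← Finset.mul_sum, Finset.sum_add_distrib, Finset.sum_mul, Finset.sum_mul]
    _ ≤ _ := by
        gcongr
        exact sum_two_div_two_pow_le N

end Upper

/-! ### Uniform boundedness of f_N in B -/

lemma Cutoff.nonneg (φ : Cutoff) (t : ℝ) : 0 ≤ φ.toFun t :=
  (φ.eq_zero _ (le_max_right t 2)).symm.le.trans (φ.antitone (le_max_left t 2))

lemma Cutoff.le_one (φ : Cutoff) (t : ℝ) : φ.toFun t ≤ 1 :=
  (φ.antitone (min_le_left t 1)).trans (φ.eq_one _ (min_le_right t 1)).le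

section Witness

variable {n : ℕ}

lemma norm_symbol_le_one (φ : Cutoff) (k : ℤ) (ξ : Rn n) : ‖φ.symbol n k ξ‖ ≤ 1 := by
  rw [Cutoff.symbol_apply, Complex.norm_real, Real.norm_of_nonneg (φ.nonneg _)]
  exact φ.le_one _

lemma norm_lt_of_symbol_ne_zero (φ : Cutoff) {k : ℤ} {ξ : Rn n} (h : φ.symbol n k ξ ≠ 0) :
    ‖ξ‖ < 2 * 2 ^ k := by
  by_contra! h'
  refine h ?_
  rw [Cutoff.symbol_apply, φ.eq_zero _ ((le_div_iff₀ (by positivity)).2 h'), Complex.ofReal_zero]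

lemma norm_symbol_sub_le_one (φ : Cutoff) (k l : ℤ) (ξ : Rn n) :
    ‖(φ.symbol n k - φ.symbol n l) ξ‖ ≤ 1 := by
  rw [sub_apply, Cutoff.symbol_apply, Cutoff.symbol_apply, ← Complex.ofReal_sub,
    Complex.norm_real, Real.norm_eq_abs, abs_le]
  constructor <;> linarith [φ.nonneg (‖ξ‖ / 2 ^ k), φ.nonneg (‖ξ‖ / 2 ^ l),
    φ.le_one (‖ξ‖ / 2 ^ k), φ.le_one (‖ξ‖ / 2 ^ l)]

lemma norm_bounds_of_symbol_sub_ne_zero (φ : Cutoff) {k : ℤ} {ξ : Rn n}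
    (h : (φ.symbol n k - φ.symbol n (k - 1)) ξ ≠ 0) :
    (2 : ℝ) ^ (k - 1) ≤ ‖ξ‖ ∧ ‖ξ‖ ≤ 4 * 2 ^ (k - 1) := by
  have hk : (2 : ℝ) ^ k = 2 * 2 ^ (k - 1) := by
    rw [← zpow_one_add₀ two_ne_zero]; congr 1; ring
  have hp : (0 : ℝ) < 2 ^ (k - 1) := by positivity
  constructor
  · by_contra! h'
    refine h ?_
    rw [sub_apply, Cutoff.symbol_apply, Cutoff.symbol_apply,
      φ.eq_one _ ((div_le_one hp).2 h'.le),
      φ.eq_one _ ((div_le_one (by positivity)).2 (by linarith)), sub_self]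
  · by_contra! h'
    refine h ?_
    rw [sub_apply, Cutoff.symbol_apply, Cutoff.symbol_apply,
      φ.eq_zero _ ((le_div_iff₀ hp).2 (by linarith)),
      φ.eq_zero _ ((le_div_iff₀ (by positivity)).2 (by linarith)), sub_self]

variable [NeZero n]

lemma contDiff_witness {ψ : Rn n → ℝ} (hψ : ContDiff ℝ ∞ ψ) (N : ℕ) :
    ContDiff ℝ ∞ (witness ψ N) := by
  have h0 : ContDiff ℝ ∞ fun x : Rn n => x 0 :=
    (EuclideanSpace.proj (𝕜 := ℝ) (0 : Fin n)).contDiff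
  have h1 : ContDiff ℝ ∞ (cutLacunary ψ N) := by
    refine Complex.ofRealCLM.contDiff.comp (hψ.mul ?_)
    unfold lacunary
    exact ContDiff.sum fun k _ => Real.contDiff_sin.comp (contDiff_const.mul h0)
  exact h1.comp (contDiff_const_smul _)

lemma hasCompactSupport_cutLacunary {ψ : Rn n → ℝ} (hs : HasCompactSupport ψ) (N : ℕ) :
    HasCompactSupport (cutLacunary ψ N) :=
  (HasCompactSupport.mul_right hs).comp_left Complex.ofReal_zero

lemma hasCompactSupport_witness {ψ : Rn n → ℝ} (hs : HasCompactSupport ψ) (N : ℕ) :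
    HasCompactSupport (witness ψ N) :=
  (hasCompactSupport_cutLacunary hs N).comp_homeomorph
    (Homeomorph.smulOfNeZero ((2 : ℝ) ^ Nat.log 2 N) (by positivity))

lemma norm_conv_witness_le {ψ : Rn n → ℝ} (hψ : ContDiff ℝ ∞ ψ) (hs : HasCompactSupport ψ)
    (N : ℕ) (σ : 𝓢(Rn n, ℂ)) (x : Rn n) :
    ‖conv (witness ψ N) (𝓕⁻ σ : 𝓢(Rn n, ℂ)) x‖
      ≤ ∫ ξ, ‖𝓕 (cutLacunary ψ N) ξ‖ * ‖σ ((2 : ℝ) ^ Nat.log 2 N • ξ)‖ := by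
  rw [← integral_norm_fourier_dilate (cutLacunary ψ N) (fun ξ => ‖σ ξ‖) (by positivity)]
  exact norm_conv_fourierInv_le ((hasCompactSupport_witness hs N).toSchwartzMap
    (contDiff_witness hψ N)) σ x

/-- On this range min(a, a^{-1/2}) ≥ 1/3, whence 36 = 3 · 12. The telescoping sum thereby counts the
lacunary frequencies close to a given annulus. -/
lemma one_le_saturation_sub {a : ℝ} (h1 : 1 / 2 < a) (h2 : a < 8) :
    1 ≤ 36 * (saturation (2 * a) - saturation a) := by
  have h := min_le_saturation_sub (by linarith : 0 < a)
  have h3 : √a ≤ 3 := Real.sqrt_le_iff.2 ⟨by norm_num, by linarith⟩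
  have h4 : 0 < √a := Real.sqrt_pos.2 (by linarith)
  have h5 : 1 / 3 ≤ min a (√a)⁻¹ := by
    refine le_min (by linarith) ?_
    rw [one_div]
    exact inv_anti₀ h4 h3
  linarith

lemma exists_norm_conv_kernel_witness_le (φ : Cutoff) {ψ : Rn n → ℝ} (hψ : ContDiff ℝ ∞ ψ)
    (hs : HasCompactSupport ψ) :
    ∃ C : ℝ, 0 ≤ C ∧ ∀ N : ℕ, 2 ≤ N → ∀ x, ‖conv (witness ψ N) (lowKernel φ n) x‖ ≤ C ∧
      ∀ j : ℕ, ‖conv (witness ψ N) (kernel φ n j) x‖ ≤ C := by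
  obtain ⟨C, hC, h⟩ := exists_integral_fourier_cutLacunary_le hψ hs
  refine ⟨C, hC, fun N hN x => ?_⟩
  have hm : 1 ≤ Nat.log 2 N := Nat.log_pos one_lt_two hN
  set m := Nat.log 2 N
  have hR : (2 : ℝ) ≤ 2 ^ m := le_self_pow₀ one_le_two (by omega)
  have hR0 : (0 : ℝ) < 2 ^ m := by positivity
  have hc : ∀ σ : 𝓢(Rn n, ℂ), Continuous fun ξ : Rn n => ‖σ ((2 : ℝ) ^ m • ξ)‖ := fun σ =>
    (σ.continuous.comp (continuous_const_smul _)).norm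
  have hnorm : ∀ ξ : Rn n, ‖(2 : ℝ) ^ m • ξ‖ = 2 ^ m * ‖ξ‖ := fun ξ => by
    rw [norm_smul, Real.norm_of_nonneg hR0.le]
  have hv : ∀ (ξ : Rn n) (q : ℝ), |q| - ‖ξ‖ ≤ ‖ξ - EuclideanSpace.single 0 q‖ ∧
      ‖ξ‖ - |q| ≤ ‖ξ - EuclideanSpace.single 0 q‖ := fun ξ q => by
    have h1 := norm_sub_norm_le (EuclideanSpace.single (0 : Fin n) q) ξ
    have h2 := norm_sub_norm_le ξ (EuclideanSpace.single (0 : Fin n) q)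
    rw [norm_sub_rev, PiLp.norm_single, Real.norm_eq_abs] at h1
    rw [PiLp.norm_single, Real.norm_eq_abs] at h2
    exact ⟨h1, h2⟩
  refine ⟨?_, fun j => ?_⟩
  · refine (norm_conv_witness_le hψ hs N _ x).trans (h N _ (hc _) (fun _ => norm_nonneg _)
      (fun _ => norm_symbol_le_one φ 0 _) (fun _ => 0) (fun _ => le_rfl) (by simp) ?_)
    -- As m ≥ 1, the rescaled low-frequency symbol lives in ‖ξ‖ ≤ 1, while every frequency 2^k is at
    -- least 2.
    refine fun k hk q hq => Or.inl fun ξ hξ => ?_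
    have h1 := norm_lt_of_symbol_ne_zero φ (norm_ne_zero_iff.1 hξ)
    rw [hnorm, zpow_zero] at h1
    have h2 := (hv ξ q).1
    have h3 : ‖ξ‖ ≤ 1 := by nlinarith [norm_nonneg ξ]
    have h4 : (2 : ℝ) ≤ 2 ^ k := le_self_pow₀ one_le_two (by omega)
    rw [hq] at h2
    linarith
  -- The rescaled symbol lives in ρ ≤ ‖ξ‖ ≤ 4ρ. Frequencies 2^k outside (ρ/2, 8ρ) stay at distance
  -- at least 2^k / 2 from it; those inside are counted by the saturation increments.
  · set ρ : ℝ := 2 ^ ((j : ℤ) - 1) / 2 ^ m with hρ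
    have hρ0 : 0 < ρ := by positivity
    refine (norm_conv_witness_le hψ hs N _ x).trans (h N _ (hc _) (fun _ => norm_nonneg _)
      (fun _ => norm_symbol_sub_le_one φ _ _ _)
      (fun k => 36 * (saturation (2 * (2 ^ k * ρ⁻¹)) - saturation (2 ^ k * ρ⁻¹)))
      (fun k => ?_) ?_ ?_)
    · have := saturation_le_two_mul (a := 2 ^ k * ρ⁻¹) (by positivity)
      linarith
    · rw [← Finset.mul_sum]
      linarith [sum_saturation_le ρ⁻¹ N]
    · intro k hk q hq
      have hξρ : ∀ ξ : Rn n, ‖(φ.symbol n j - φ.symbol n ((j : ℤ) - 1)) ((2 : ℝ) ^ m • ξ)‖ ≠ 0 →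
          ρ ≤ ‖ξ‖ ∧ ‖ξ‖ ≤ 4 * ρ := fun ξ hξ => by
        have := norm_bounds_of_symbol_sub_ne_zero φ (norm_ne_zero_iff.1 hξ)
        rw [hnorm] at this
        rw [hρ, div_le_iff₀ hR0, ← mul_div_assoc, le_div_iff₀ hR0, mul_comm]
        exact this
      have hK : (0 : ℝ) < 2 ^ k := by positivity
      rcases le_or_gt (8 * ρ) (2 ^ k) with h8 | h8
      · refine Or.inl fun ξ hξ => ?_
        have h1 := (hv ξ q).1
        have h2 := (hξρ ξ hξ).2
        rw [hq] at h1
        linarith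
      · rcases le_or_gt ((2 : ℝ) ^ k) (ρ / 2) with h2 | h2
        · refine Or.inl fun ξ hξ => ?_
          have h1 := (hv ξ q).2
          have h3 := (hξρ ξ hξ).1
          rw [hq] at h1
          linarith
        · refine Or.inr (one_le_saturation_sub ?_ ?_)
          · rw [← div_eq_mul_inv, lt_div_iff₀ hρ0]; linarith
          · rw [← div_eq_mul_inv, div_lt_iff₀ hρ0]; linarith

/-- The squared L² norm of F_N is O(N), and dilation by 2^m divides it by 2^{mn} ≥ 2^m ≥ N / 2. This
fixes the size of the dilation. -/
lemma exists_eLpNorm_two_witness_le {ψ : Rn n → ℝ} (hψ : ContDiff ℝ ∞ ψ)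
    (hs : HasCompactSupport ψ) :
    ∃ C : ℝ, 0 ≤ C ∧ ∀ N : ℕ, 1 ≤ N → eLpNorm (witness ψ N) 2 volume ≤ ENNReal.ofReal C := by
  have hs2 : HasCompactSupport fun x => ψ x ^ 2 := hs.comp_left (g := fun t : ℝ => t ^ 2) (by simp)
  obtain ⟨C, hC, h⟩ := exists_integral_mul_sq_lacunary_le (hψ.pow 2) hs2
  refine ⟨√(2 * C), by positivity, fun N hN => ?_⟩
  have hw : MemLp (witness ψ N) 2 volume :=
    (contDiff_witness hψ N).continuous.memLp_of_hasCompactSupport (hasCompactSupport_witness hs N)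
  have hi : ∫ x, ‖witness ψ N x‖ ^ 2 ≤ 2 * C := by
    have hR0 : (0 : ℝ) < 2 ^ Nat.log 2 N := by positivity
    have h1 := integral_dilate (fun x : Rn n => ψ x ^ 2 * lacunary N (x 0) ^ 2) hR0
    have h2 : ∀ x, ‖witness ψ N x‖ ^ 2 = ((2 ^ Nat.log 2 N : ℝ) ^ n)⁻¹ *
        ((2 ^ Nat.log 2 N : ℝ) ^ n • (ψ ((2 : ℝ) ^ Nat.log 2 N • x) ^ 2 *
          lacunary N (((2 : ℝ) ^ Nat.log 2 N • x) 0) ^ 2)) := fun x => by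
      rw [witness, cutLacunary, Complex.norm_real, Real.norm_eq_abs, sq_abs, mul_pow, smul_eq_mul,
        inv_mul_cancel_left₀ (by positivity)]
    simp_rw [h2]
    rw [integral_const_mul, h1, inv_mul_le_iff₀ (by positivity)]
    have h3 : (N : ℝ) ≤ 2 * 2 ^ Nat.log 2 N := by
      have := Nat.lt_pow_succ_log_self one_lt_two N
      rw [pow_succ] at this
      have h4 : N ≤ 2 * 2 ^ Nat.log 2 N := by omega
      exact_mod_cast h4
    have h5 : (2 ^ Nat.log 2 N : ℝ) ≤ (2 ^ Nat.log 2 N : ℝ) ^ n :=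
      le_self_pow₀ (one_le_pow₀ one_le_two) (NeZero.ne n)
    calc _ ≤ C * N := h N hN
      _ ≤ C * (2 * (2 ^ Nat.log 2 N) ^ n) := by gcongr; linarith
      _ = _ := by ring
  rw [hw.eLpNorm_eq_integral_rpow_norm two_ne_zero ENNReal.ofNat_ne_top]
  refine ENNReal.ofReal_le_ofReal ?_
  simp only [ENNReal.toReal_ofNat, Real.rpow_ofNat]
  rw [Real.sqrt_eq_rpow, one_div]
  gcongr

lemma memLp_witness {ψ : Rn n → ℝ} (hψ : ContDiff ℝ ∞ ψ) (hs : HasCompactSupport ψ) (N : ℕ)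
    (p : ℝ≥0∞) : MemLp (witness ψ N) p volume :=
  (contDiff_witness hψ N).continuous.memLp_of_hasCompactSupport (hasCompactSupport_witness hs N)

/-- The dilated cut-off lacunary sums are uniformly bounded in `B`. -/
lemma exists_witness_mem (φ : Cutoff) {ψ : Rn n → ℝ} (hψ : ContDiff ℝ ∞ ψ)
    (hs : HasCompactSupport ψ) :
    ∃ C : ℝ, 0 ≤ C ∧ ∀ N : ℕ, 2 ≤ N → ∃ f : BSpace φ n,
      (∀ᵐ x ∂(volume : Measure (Rn n)), f x = witness ψ N x) ∧ ‖f‖ ≤ C := by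
  obtain ⟨C₁, hC₁, h₁⟩ := exists_norm_conv_kernel_witness_le φ hψ hs
  obtain ⟨C₂, hC₂, h₂⟩ := exists_eLpNorm_two_witness_le hψ hs
  refine ⟨C₁ + C₁ + C₂, by positivity, fun N hN => ?_⟩
  have htop : ∀ u : Rn n → ℂ, (∀ x, ‖u x‖ ≤ C₁) → eLpNorm u ⊤ volume ≤ ENNReal.ofReal C₁ :=
    fun u hu => by
      rw [eLpNorm_exponent_top]
      exact eLpNormEssSup_le_of_ae_bound (Filter.Eventually.of_forall hu)
  have hb : bENorm φ (witness ψ N) ≤ ENNReal.ofReal (C₁ + C₁ + C₂) := by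
    rw [ENNReal.ofReal_add (by positivity) hC₂, ENNReal.ofReal_add hC₁ hC₁]
    refine add_le_add (add_le_add (htop _ fun x => (h₁ N hN x).1) ?_) (h₂ N (by omega))
    exact iSup₂_le fun j _ => htop _ fun x => (h₁ N hN x).2 j
  obtain ⟨f, hf, hn⟩ := exists_bSpace (memLp_witness hψ hs N 2) (hb.trans_lt ENNReal.ofReal_lt_top)
  exact ⟨f, hf, hn.trans_le (ENNReal.toReal_le_of_le_ofReal (by positivity) hb)⟩

end Witness

/-! ### Measurability and lower bounds for the sharp function -/

section Sharp

variable {n : ℕ}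

lemma mSharp_congr {f g : Rn n → ℂ} (h : f =ᵐ[volume] g) : mSharp f = mSharp g := by
  funext x
  refine iSup_congr fun r => iSup_congr fun _ => ?_
  have h1 : ∀ᵐ y ∂volume.restrict (ball x r), f y = g y := ae_restrict_of_ae h
  rw [setAverage_congr_fun measurableSet_ball (h.mono fun y hy _ => hy)]
  refine laverage_congr ?_
  filter_upwards [h1] with y hy
  rw [hy]

lemma laverage_ball_eq (u : Rn n → ℝ≥0∞) (x : Rn n) (r : ℝ) :
    ⨍⁻ y in ball x r, u y ∂volume = (volume (ball x r))⁻¹ * ∫⁻ y in ball x r, u y := by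
  rw [setLAverage_eq, mul_comm, div_eq_mul_inv]

lemma angAvg_one_eq (r : ℝ) (f : Rn n → ℂ) (x : Rn n) :
    angAvg (fun _ => (1 : ℂ)) r f x = ⨍ z in ball x r, f z := by
  rw [angAvg_eq_setAverage]
  simp only [smul_eq_mul, mul_one]

lemma laverage_sub_average_le_hlMax (f : Rn n → ℂ) (hf : AEStronglyMeasurable f volume)
    (x : Rn n) {r : ℝ} (hr : 0 < r) :
    ⨍⁻ y in ball x r, ‖f y - ⨍ z in ball x r, f z‖ₑ ∂volume ≤ 2 * hlMax (fun y => ‖f y‖ₑ) x := by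
  have h1 : ‖⨍ z in ball x r, f z‖ₑ ≤ hlMax (fun y => ‖f y‖ₑ) x := by
    have := enorm_angAvg_le_hlMax (isAngular_one (n := n)) hr f x
    rwa [angAvg_one_eq] at this
  rw [laverage_ball_eq]
  calc _ ≤ (volume (ball x r))⁻¹ * ∫⁻ y in ball x r, (‖f y‖ₑ + ‖⨍ z in ball x r, f z‖ₑ) := by
        gcongr
        exact enorm_sub_le
    _ = (volume (ball x r))⁻¹ * (∫⁻ y in ball x r, ‖f y‖ₑ) + ‖⨍ z in ball x r, f z‖ₑ := by
        rw [lintegral_add_left' hf.enorm.restrict, mul_add, lintegral_const,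
          Measure.restrict_apply_univ, mul_comm ‖_‖ₑ, ← mul_assoc,
          ENNReal.inv_mul_cancel (volume_ball_ne_zero x hr) (volume_ball_ne_top x r), one_mul]
    _ ≤ _ := by
        rw [two_mul]
        refine add_le_add ?_ h1
        exact le_iSup₂ (f := fun (r : ℝ) (_ : 0 < r) => (volume (ball x r))⁻¹ *
          ∫⁻ y in ball x r, ‖f y‖ₑ) r hr

lemma mSharp_le_hlMax {f : Rn n → ℂ} (hf : AEStronglyMeasurable f volume) (x : Rn n) :
    mSharp f x ≤ 2 * hlMax (fun y => ‖f y‖ₑ) x :=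
  iSup₂_le fun _ hr => laverage_sub_average_le_hlMax f hf x hr

lemma hlMax_le_of_le {u : Rn n → ℝ≥0∞} {b : ℝ≥0∞} (h : ∀ x, u x ≤ b) (x : Rn n) :
    hlMax u x ≤ b := by
  refine iSup₂_le fun r hr => ?_
  calc _ ≤ (volume (ball x r))⁻¹ * ∫⁻ _ in ball x r, b := by
        gcongr with y
        exact h y
    _ = b := by
        rw [lintegral_const, Measure.restrict_apply_univ, mul_comm b, ← mul_assoc,
          ENNReal.inv_mul_cancel (volume_ball_ne_zero x hr) (volume_ball_ne_top x r), one_mul]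

/-- Each mean oscillation is continuous in the centre, by dominated convergence after moving the
ball to the origin, so the supremum is lower semicontinuous. -/
lemma measurable_mSharp [NeZero n] {f : Rn n → ℂ} (hf : Continuous f) (hf2 : MemLp f 2 volume)
    {B : ℝ} (hB : ∀ x, ‖f x‖ ≤ B) : Measurable (mSharp f) := by
  refine LowerSemicontinuous.measurable (lowerSemicontinuous_biSup fun r hr => ?_)
  refine Continuous.lowerSemicontinuous ?_
  have ha : Continuous fun x => ⨍ z in ball x r, f z := by
    simpa only [← angAvg_one_eq] using continuous_angAvg (isAngular_one (n := n)) hr hf2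
  have hab : ∀ x, ‖⨍ z in ball x r, f z‖ₑ ≤ ENNReal.ofReal B := fun x => by
    have h1 := enorm_angAvg_le_hlMax (isAngular_one (n := n)) hr f x
    rw [angAvg_one_eq] at h1
    exact h1.trans (hlMax_le_of_le (fun y => by
      rw [← ofReal_norm]; exact ENNReal.ofReal_le_ofReal (hB y)) x)
  have heq : ∀ x, ⨍⁻ y in ball x r, ‖f y - ⨍ z in ball x r, f z‖ₑ ∂volume
      = (volume (ball (0 : Rn n) r))⁻¹ *
        ∫⁻ y in ball (0 : Rn n) r, ‖f (x + y) - ⨍ z in ball x r, f z‖ₑ := by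
    intro x
    rw [laverage_ball_eq, Measure.addHaar_ball_center volume x, ← lintegral_indicator
      measurableSet_ball, ← lintegral_indicator measurableSet_ball,
      ← lintegral_add_left_eq_self _ x]
    congr 2
    funext y
    simp [Set.indicator]
  simp_rw [heq]
  refine ENNReal.continuous_const_mul (ENNReal.inv_ne_top.2 (volume_ball_ne_zero _ hr)) |>.comp ?_
  rw [continuous_iff_continuousAt]
  intro x
  refine tendsto_lintegral_filter_of_dominated_convergence
    (fun _ => ENNReal.ofReal B + ENNReal.ofReal B) (Filter.Eventually.of_forall fun z => ?_)
    (Filter.Eventually.of_forall fun z => Filter.Eventually.of_forall fun y => ?_) ?_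
    (Filter.Eventually.of_forall fun y => ?_)
  · exact ((hf.comp (continuous_const.add continuous_id)).sub continuous_const).enorm.measurable
  · refine enorm_sub_le.trans (add_le_add ?_ (hab z))
    rw [← ofReal_norm]
    exact ENNReal.ofReal_le_ofReal (hB _)
  · rw [lintegral_const, Measure.restrict_apply_univ]
    exact ENNReal.mul_ne_top (by simp) (volume_ball_ne_top _ _)
  · exact ((hf.comp (continuous_id.add continuous_const)).sub ha).enorm.tendsto x

variable [NeZero n]

lemma lacunary_neg (N : ℕ) (t : ℝ) : lacunary N (-t) = -lacunary N t := by
  simp [lacunary, Finset.sum_neg_distrib]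

lemma integrable_mul_abs_lacunary_sub {η : Rn n → ℝ} (hη : Continuous η)
    (hs : HasCompactSupport η) (N : ℕ) (a : ℝ) :
    Integrable fun x : Rn n => η x * |lacunary N (x 0) - a| :=
  (hη.mul (((continuous_lacunary N).comp continuous_coord).sub
    continuous_const).abs).integrable_of_hasCompactSupport hs.mul_right

/-- The weight is even and the lacunary sum S odd, so a and -a give the same integral; then 2|S| ≤
|S - a| + |S + a|. Subtracting a mean thus cannot lower the L¹ size. -/
lemma integral_mul_abs_lacunary_le {η : Rn n → ℝ} (hη : Continuous η)
    (hs : HasCompactSupport η) (h0 : ∀ x, 0 ≤ η x) (he : ∀ x, η (-x) = η x) (N : ℕ) (a : ℝ) :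
    ∫ x : Rn n, η x * |lacunary N (x 0)| ≤ ∫ x : Rn n, η x * |lacunary N (x 0) - a| := by
  have h1 := integrable_mul_abs_lacunary_sub hη hs N a
  have h2 : ∫ x : Rn n, η x * |lacunary N (x 0) + a|
      = ∫ x : Rn n, η x * |lacunary N (x 0) - a| := by
    rw [← integral_neg_eq_self]
    refine integral_congr_ae (Filter.Eventually.of_forall fun x => ?_)
    simp only [he, PiLp.neg_apply, lacunary_neg]
    rw [← abs_neg]
    ring_nf
  have h3 := integrable_mul_abs_lacunary_sub hη hs N (-a)
  have h4 := integrable_mul_abs_lacunary_sub hη hs N 0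
  simp only [sub_neg_eq_add, sub_zero] at h3 h4
  have h5 : ∫ x : Rn n, 2 * (η x * |lacunary N (x 0)|)
      ≤ ∫ x : Rn n, (η x * |lacunary N (x 0) - a| + η x * |lacunary N (x 0) + a|) := by
    refine integral_mono (h4.const_mul 2) (h1.add h3) fun x => ?_
    simp only
    rw [← mul_add, mul_left_comm]
    refine mul_le_mul_of_nonneg_left ?_ (h0 x)
    have := abs_add_le (lacunary N (x 0) - a) (lacunary N (x 0) + a)
    rwa [sub_add_add_cancel, ← two_mul, abs_mul, abs_two] at this
  rw [integral_const_mul, integral_add h1 h3, h2] at h5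
  linarith

/-- Near the origin the sharp function of a dilated cut-off lacunary sum is large. -/
lemma exists_sqrt_le_mSharp_witness {ψ : Rn n → ℝ} (h1 : ∀ x ∈ ball (0 : Rn n) 2, ψ x = 1) :
    ∃ c : ℝ, 0 < c ∧ ∀ N : ℕ, 1 ≤ N → ∀ x ∈ ball (0 : Rn n) (2 ^ (Nat.log 2 N + 1))⁻¹,
      ENNReal.ofReal (c * √N) ≤ mSharp (witness ψ N) x := by
  -- The bump is supported in radius 1/2, so that after rescaling its support lies in the ball of
  -- radius R⁻¹ about any x with ‖x‖ < R⁻¹ / 2.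
  let η : ContDiffBump (0 : Rn n) := ⟨1 / 4, 1 / 2, by norm_num, by norm_num⟩
  obtain ⟨c, hc, h⟩ := exists_sqrt_le_integral_mul_abs_lacunary (η := η) η.contDiff
    η.hasCompactSupport (fun _ => η.nonneg) fun x hx => by
      rw [η.one_of_mem_closedBall (ball_subset_closedBall hx)]; exact one_pos
  set v := volume (ball (0 : Rn n) 1) with hv
  have hv0 : v ≠ 0 := volume_ball_ne_zero 0 one_pos
  have hvt : v ≠ ⊤ := volume_ball_ne_top 0 1
  refine ⟨c * v.toReal⁻¹, mul_pos hc (inv_pos.2 (ENNReal.toReal_pos hv0 hvt)), fun N hN x hx => ?_⟩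
  set R : ℝ := 2 ^ Nat.log 2 N with hR
  have hR0 : 0 < R := by positivity
  have hr0 : 0 < R⁻¹ := by positivity
  refine le_trans ?_ (le_iSup₂ (f := fun (r : ℝ) (_ : 0 < r) => ⨍⁻ y in ball x r,
    ‖witness ψ N y - ⨍ z in ball x r, witness ψ N z‖ₑ ∂volume) R⁻¹ hr0)
  set a := ⨍ z in ball x R⁻¹, witness ψ N z with ha
  -- The function is real near the origin, so passing to real parts replaces the complex mean by
  -- `a.re`.
  set I := ∫ y : Rn n, η y * |lacunary N (y 0) - a.re| with hI
  have hcI : c * √N ≤ I := (h N hN).trans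
    (integral_mul_abs_lacunary_le η.continuous η.hasCompactSupport (fun _ => η.nonneg)
      (fun y => η.neg y) N a.re)
  have hbelow : ENNReal.ofReal ((R ^ n)⁻¹ * I) ≤ ∫⁻ y in ball x R⁻¹, ‖witness ψ N y - a‖ₑ := by
    have hint := integrable_mul_abs_lacunary_sub η.continuous η.hasCompactSupport N a.re
    have e1 : (R ^ n)⁻¹ * I = ∫ y : Rn n, η (R • y) * |lacunary N ((R • y) 0) - a.re| := by
      rw [hI, ← integral_dilate _ hR0, integral_smul, smul_eq_mul, inv_mul_cancel_left₀
        (by positivity)]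
    rw [e1, ofReal_integral_eq_lintegral_ofReal (hint.comp_smul hR0.ne')
      (Filter.Eventually.of_forall fun y => mul_nonneg η.nonneg (abs_nonneg _)),
      ← lintegral_indicator measurableSet_ball]
    refine lintegral_mono fun y => ?_
    by_cases hy : R • y ∈ ball (0 : Rn n) (1 / 2)
    · rw [mem_ball_zero_iff, norm_smul, Real.norm_of_nonneg hR0.le] at hy
      rw [mem_ball_zero_iff, pow_succ, ← hR, mul_inv] at hx
      have hy' : ‖y‖ < R⁻¹ / 2 := by
        rw [div_eq_inv_mul, ← mul_inv, mul_comm, mul_inv, ← div_eq_inv_mul, lt_div_iff₀' hR0]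
        simpa using hy
      have hmem : y ∈ ball x R⁻¹ := by
        rw [mem_ball, dist_eq_norm]
        linarith [norm_sub_le y x]
      have hw : witness ψ N y = ((lacunary N ((R • y) 0) : ℝ) : ℂ) := by
        rw [witness, cutLacunary, h1, one_mul]
        rw [mem_ball_zero_iff, norm_smul, Real.norm_of_nonneg hR0.le]
        linarith
      rw [Set.indicator_of_mem hmem, ← ofReal_norm, hw]
      refine ENNReal.ofReal_le_ofReal ?_
      calc _ ≤ 1 * |lacunary N ((R • y) 0) - a.re| := by
            gcongr
            exact η.le_one
        _ ≤ _ := by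
            rw [one_mul]
            simpa using Complex.abs_re_le_norm (((lacunary N ((R • y) 0) : ℝ) : ℂ) - a)
    · have : η (R • y) = 0 := by
        rw [← Function.notMem_support, η.support_eq]
        exact hy
      rw [this, zero_mul, ENNReal.ofReal_zero]
      exact bot_le
  calc ENNReal.ofReal (c * v.toReal⁻¹ * √N) ≤ ENNReal.ofReal (v.toReal⁻¹ * I) := by
        refine ENNReal.ofReal_le_ofReal ?_
        rw [mul_right_comm, mul_comm]
        gcongr
    _ = (volume (ball x R⁻¹))⁻¹ * ENNReal.ofReal ((R ^ n)⁻¹ * I) := by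
        rw [volume_ball_eq x hr0, ← hv, ENNReal.ofReal_mul (by positivity),
          ENNReal.ofReal_mul (by positivity), ← ENNReal.toReal_inv,
          ENNReal.ofReal_toReal (ENNReal.inv_ne_top.2 hv0),
          ENNReal.mul_inv (Or.inr hvt) (Or.inr hv0),
          inv_pow, mul_mul_mul_comm, ENNReal.inv_mul_cancel
          (by simpa using pow_pos hR0 n) ENNReal.ofReal_ne_top, one_mul, mul_comm]
    _ ≤ _ := by
        rw [laverage_ball_eq]
        gcongr

end Sharp

/-! ### Failure of boundedness for M^♯ -/

section Unbounded

variable {n : ℕ}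

lemma BSpace.ext_of_ae {φ : Cutoff} {f g : BSpace φ n} (h : f =ᵐ[volume] g) : f = g :=
  Subtype.ext (Lp.ext h)

lemma le_norm_average_of_represents {φ : Cutoff} {g : BSpace φ n} {u : Rn n → ℝ≥0∞}
    (hg : Represents g u) {r b : ℝ} (hr : 0 < r)
    (hu : ∀ x ∈ ball (0 : Rn n) r, ENNReal.ofReal b ≤ u x) :
    b ≤ ‖⨍ y in ball (0 : Rn n) r, g y‖ := by
  have hi : IntegrableOn g (ball (0 : Rn n) r) := by
    have : IsFiniteMeasure (volume.restrict (ball (0 : Rn n) r)) :=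
      ⟨by rw [Measure.restrict_apply_univ]; exact measure_ball_lt_top⟩
    exact (g.memLp.restrict _).integrable one_le_two
  have hv : 0 < volume.real (ball (0 : Rn n) r) :=
    ENNReal.toReal_pos (volume_ball_ne_zero 0 hr) (volume_ball_ne_top 0 r)
  have h1 : b * volume.real (ball (0 : Rn n) r) ≤ ∫ y in ball (0 : Rn n) r, (g y).re := by
    have h2 : ∫ _ in ball (0 : Rn n) r, b = b * volume.real (ball (0 : Rn n) r) := by
      rw [setIntegral_const, smul_eq_mul, mul_comm]
    rw [← h2]
    refine setIntegral_mono_on_ae (integrableOn_const (volume_ball_ne_top 0 r)) hi.re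
      measurableSet_ball ?_
    filter_upwards [hg] with y hy hyr
    rw [hy.2, Complex.ofReal_re]
    exact (ENNReal.ofReal_le_iff_le_toReal hy.1).1 (hu y hyr)
  have h3 : ∫ y in ball (0 : Rn n) r, (g y).re = (∫ y in ball (0 : Rn n) r, g y).re :=
    integral_re hi
  rw [setAverage_eq, norm_smul, norm_inv, Real.norm_of_nonneg hv.le, le_inv_mul_iff₀ hv, mul_comm]
  exact (h1.trans_eq h3).trans (Complex.re_le_norm _)

variable [NeZero n]

lemma witness_ne_zero {ψ : Rn n → ℝ} (h1 : ∀ x ∈ ball (0 : Rn n) 2, ψ x = 1) {N : ℕ}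
    (hN : 1 ≤ N) : witness ψ N ≠ 0 := by
  intro h
  set v : Rn n := EuclideanSpace.single 0 (1 / 2 ^ (N + 2)) with hv
  have hR : (2 : ℝ) ^ Nat.log 2 N ≠ 0 := by positivity
  have h2 := congrFun h (((2 : ℝ) ^ Nat.log 2 N)⁻¹ • v)
  have hv2 : v ∈ ball (0 : Rn n) 2 := by
    rw [mem_ball_zero_iff, hv, PiLp.norm_single, Real.norm_of_nonneg (by positivity)]
    have : (1 : ℝ) / 2 ^ (N + 2) ≤ 1 :=
      (div_le_one (by positivity)).2 (one_le_pow₀ one_le_two)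
    linarith
  rw [witness, smul_inv_smul₀ hR, cutLacunary, h1 v hv2, one_mul, Pi.zero_apply,
    Complex.ofReal_eq_zero, hv] at h2
  have h3 := lacunary_pos hN
  simp only [PiLp.single_apply, if_true] at h2
  exact h3.ne' h2

lemma exists_represents_mSharp (φ : Cutoff) {f : Rn n → ℂ} (hf : Continuous f)
    (hs : HasCompactSupport f) : ∃ g : BSpace φ n, Represents g (mSharp f) := by
  obtain ⟨C, -, h⟩ := exists_represents φ n
  have hf2 : MemLp f 2 volume := hf.memLp_of_hasCompactSupport hs
  obtain ⟨B, hB⟩ := hf.bounded_above_of_compact_support hs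
  have hB0 : 0 ≤ B := (norm_nonneg _).trans (hB 0)
  obtain ⟨g, hg, -⟩ := h f hf2 _ (measurable_mSharp hf hf2 hB) (2 * B) (by positivity)
    (fun x => by
      refine (mSharp_le_hlMax hf2.1 x).trans ?_
      rw [ENNReal.ofReal_mul two_pos.le, ENNReal.ofReal_ofNat]
      gcongr
      refine hlMax_le_of_le (fun y => ?_) x
      rw [← ofReal_norm]
      exact ENNReal.ofReal_le_ofReal (hB y)) fun x => mSharp_le_hlMax hf2.1 x
  exact ⟨g, hg⟩

/-- Since m ≥ 1, m + 2 ≤ 3m, and m log 2 ≤ log N with log 2 > 1/2. -/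
lemma log_two_add_two_le {N : ℕ} (hN : 2 ≤ N) : (Nat.log 2 N : ℝ) + 2 ≤ 6 * Real.log N := by
  have hm : 1 ≤ Nat.log 2 N := Nat.log_pos one_lt_two hN
  have h1 : (2 : ℝ) ^ Nat.log 2 N ≤ N := by exact_mod_cast Nat.pow_log_le_self 2 (by omega)
  have h2 := Real.log_le_log (by positivity) h1
  rw [Real.log_pow] at h2
  have h3 : (1 : ℝ) ≤ Nat.log 2 N := by exact_mod_cast hm
  nlinarith [Real.log_two_gt_d9]

/-- The sharp maximal function amplifies the norms of the dilated cut-off lacunary sums. -/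
theorem exists_sqrt_div_log_le_mSharp (φ : Cutoff) {ψ : Rn n → ℝ} (hψ : ContDiff ℝ ∞ ψ)
    (hs : HasCompactSupport ψ) (h1 : ∀ x ∈ ball (0 : Rn n) 2, ψ x = 1) :
    ∃ c : ℝ, 0 < c ∧ ∀ N : ℕ, 2 ≤ N → ∃ f g : BSpace φ n,
      (∀ᵐ x ∂(volume : Measure (Rn n)), f x = witness ψ N x) ∧
      Represents g (mSharp (witness ψ N)) ∧
      0 < ‖f‖ ∧ c * (Real.sqrt N / Real.log N) ≤ ‖g‖ / ‖f‖ := by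
  obtain ⟨A, hA, hf⟩ := exists_witness_mem φ hψ hs
  obtain ⟨D, hD, havg⟩ := exists_norm_setAverage_le φ n
  obtain ⟨d, hd, hlow⟩ := exists_sqrt_le_mSharp_witness h1
  refine ⟨d / (6 * D * (A + 1)), by positivity, fun N hN => ?_⟩
  obtain ⟨f, hfw, hfA⟩ := hf N hN
  have hwc := (contDiff_witness hψ N).continuous
  obtain ⟨g, hg⟩ := exists_represents_mSharp φ hwc (hasCompactSupport_witness hs N)
  have hf0 : 0 < ‖f‖ := by
    rw [norm_pos_iff]
    rintro rfl
    refine witness_ne_zero h1 (by omega : 1 ≤ N) ((hwc.ae_eq_iff_eq volume continuous_const).1 ?_)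
    have h0 : ((0 : BSpace φ n) : Rn n → ℂ) =ᵐ[volume] 0 := Lp.coeFn_zero ℂ 2 volume
    filter_upwards [hfw, h0] with x hx hx0
    rw [← hx, hx0]
    rfl
  refine ⟨f, g, hfw, hg, hf0, ?_⟩
  -- The lower bound for M^♯ holds on the ball of radius 2^{-(m+1)}, so the upper bound for averages
  -- is used at m + 1 and costs a factor m + 2.
  have h2 := (le_norm_average_of_represents hg (by positivity) (hlow N (by omega))).trans
    (havg g (Nat.log 2 N + 1))
  have hlog : 0 < Real.log N := Real.log_pos (by exact_mod_cast hN)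
  have h3 : d * √N ≤ D * (6 * Real.log N) * ‖g‖ := by
    refine h2.trans ?_
    gcongr
    push_cast
    linarith [log_two_add_two_le hN]
  rw [le_div_iff₀ hf0]
  calc d / (6 * D * (A + 1)) * (√N / Real.log N) * ‖f‖
      = d * √N * ‖f‖ / (6 * D * (A + 1) * Real.log N) := by field_simp
    _ ≤ D * (6 * Real.log N) * ‖g‖ * (A + 1) / (6 * D * (A + 1) * Real.log N) := by
        gcongr
        linarith
    _ = ‖g‖ := by field_simp

theorem not_boundedOnB_mSharp (φ : Cutoff) (n : ℕ) [NeZero n] : ¬ BoundedOnB φ n mSharp := by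
  rintro ⟨C, hC⟩
  let ψ : ContDiffBump (0 : Rn n) := ⟨2, 3, by norm_num, by norm_num⟩
  obtain ⟨c, hc, h⟩ := exists_sqrt_div_log_le_mSharp φ (ψ := ψ) ψ.contDiff ψ.hasCompactSupport
    fun x hx => ψ.one_of_mem_closedBall (ball_subset_closedBall hx)
  have hbound : ∀ N : ℕ, 2 ≤ N → c * (√N / Real.log N) ≤ C := by
    intro N hN
    obtain ⟨f, g, hf, hg, hf0, hle⟩ := h N hN
    obtain ⟨g', hg', hn⟩ := hC f
    rw [mSharp_congr hf] at hg'
    have hgg : g = g' := BSpace.ext_of_ae (by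
      filter_upwards [hg, hg'] with x hx hx'
      rw [hx.2, hx'.2])
    rw [hgg] at hle
    exact hle.trans ((div_le_iff₀ hf0).2 hn)
  obtain ⟨k, hk⟩ := exists_nat_gt (4 * C / c)
  have hk2 : (2 : ℕ) ≤ k + 2 := by omega
  have hlog : Real.log ((k + 2 : ℕ) : ℝ) ≤ (k + 2 : ℕ) := Real.log_le_self (by positivity)
  have hlog0 : 0 < Real.log ((k + 2 : ℕ) : ℝ) := Real.log_pos (by exact_mod_cast hk2)
  -- For N = (k + 2)⁴ one has √N = (k + 2)² and log N = 4 log(k + 2) ≤ 4 (k + 2), so the ratio is at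
  -- least (k + 2) / 4.
  have h4 := hbound ((k + 2) ^ 4) (hk2.trans (Nat.le_self_pow (by norm_num) _))
  have hsqrt : √(((k + 2) ^ 4 : ℕ) : ℝ) = ((k + 2 : ℕ) : ℝ) ^ 2 := by
    rw [Real.sqrt_eq_iff_mul_self_eq (by positivity) (by positivity)]
    push_cast
    ring
  rw [hsqrt, Nat.cast_pow, Real.log_pow] at h4
  have h5 : ((k + 2 : ℕ) : ℝ) / 4 ≤ ((k + 2 : ℕ) : ℝ) ^ 2 / (((4 : ℕ) : ℝ) *
      Real.log ((k + 2 : ℕ) : ℝ)) := by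
    rw [div_le_div_iff₀ (by norm_num) (by positivity)]
    push_cast at hlog ⊢
    nlinarith
  have h6 : c * (((k + 2 : ℕ) : ℝ) / 4) ≤ C := (mul_le_mul_of_nonneg_left h5 hc.le).trans h4
  rw [div_lt_iff₀ hc] at hk
  push_cast at h6
  nlinarith

end Unbounded

end MaxOp

theorem theorem1 (n : ℕ) [NeZero n] (φ : MaxOp.Cutoff) :
    -- `B` is a Banach space
    CompleteSpace (MaxOp.BSpace φ n) ∧
    -- `B` is translation-invariant
    (∀ (x₀ : MaxOp.Rn n) (f : MaxOp.BSpace φ n), ∃ g : MaxOp.BSpace φ n,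
      (∀ᵐ x ∂(volume : Measure (MaxOp.Rn n)), g x = f (x - x₀)) ∧ ‖g‖ = ‖f‖) ∧
    MaxOp.BoundedOnB φ n MaxOp.mDiamond ∧
    ¬ MaxOp.BoundedOnB φ n MaxOp.mSharp ∧
    -- the quantitative failure along the dilated cut-off lacunary sums
    (∀ ψ : MaxOp.Rn n → ℝ, ContDiff ℝ ∞ ψ → HasCompactSupport ψ →
      (∀ x ∈ ball (0 : MaxOp.Rn n) 2, ψ x = 1) →
      ∃ c : ℝ, 0 < c ∧ ∀ N : ℕ, 2 ≤ N → ∃ f g : MaxOp.BSpace φ n,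
        (∀ᵐ x ∂(volume : Measure (MaxOp.Rn n)), f x = MaxOp.witness ψ N x) ∧
        MaxOp.Represents g (MaxOp.mSharp (MaxOp.witness ψ N)) ∧
        0 < ‖f‖ ∧ c * (Real.sqrt N / Real.log N) ≤ ‖g‖ / ‖f‖) := by
  exact ⟨inferInstance, fun x₀ f => MaxOp.exists_translate x₀ f, MaxOp.boundedOnB_mDiamond φ n,
    MaxOp.not_boundedOnB_mSharp φ n,
    fun _ hψ hs h1 => MaxOp.exists_sqrt_div_log_le_mSharp φ hψ hs h1⟩
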